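/- Let $\mathcal B$ be a generalized Boolean algebra (a distributive lattice with least element $\emptyset$ and relative complements), $\mathcal L$ a set, $\theta=(\theta_a)_{a\in\mathcal L}$ a family of endomorphisms of $\mathcal B$ (maps preserving $\emptyset,\cup,\cap,\setminus$), and $\mathcal I=(\mathcal I_a)_{a\in\mathcal L}$ a family of ideals of $\mathcal B$ such that $\theta_a(C)\supseteq A$ for some $C\in\mathcal B$ implies $A\in\mathcal I_a$. Put $\Delta_A=\{a\in\mathcal L:\theta_a(A)\neq\emptyset\}$ and $\mathcal B_{\rm reg}=\{A\in\mathcal B: 0<|\Delta_C|<\infty \text{ for all } \emptyset\neq C\subseteq A\}$. Let $R$ be a commutative unital ring, and let $L_R(\mathcal B,\mathcal L,\theta,\mathcal I)$ be the universal associative, not necessarily unital, $R$-algebra generated by $p_A$ ($A\in\mathcal B$) and $s_{a,A},s^*_{a,A}$ ($a\in\mathcal L$, $A\in\mathcal I_a$) subject to 1. $p_\emptyset=0$, $p_{A\cap A'}=p_Ap_{A'}$, $p_{A\cup A'}=p_A+p_{A'}-p_{A\cap A'}$; 2. $p_As_{a,C}=s_{a,C}p_{\theta_a(A)}$ and $s^*_{a,C}p_A=p_{\theta_a(A)}s^*_{a,C}$;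 3. $s^*_{a,C}s_{a',C'}=\delta_{a,a'}\,p_{C\cap C'}$; 4. $s_{a,C}p_{C'}=s_{a,C\cap C'}$ and $p_{C'}s^*_{a,C}=s^*_{a,C\cap C'}$; 5. $p_A=\sum_{a\in\Delta_A}s_{a,\theta_a(A)}s^*_{a,\theta_a(A)}$ for $A\in\mathcal B_{\rm reg}$. For a finite word $\alpha=\alpha_1\cdots\alpha_n$ over $\mathcal L$ let $\theta_\alpha=\theta_{\alpha_n}\circ\cdots\circ\theta_{\alpha_1}$; let $\mathcal I_\alpha=\{A: A\subseteq\theta_{\alpha_2\cdots\alpha_n}(C)\text{ for some }C\in\mathcal I_{\alpha_1}\}$ if $n\ge1$, and $\theta_\omega=\mathrm{id}$, $\mathcal I_\omega=\mathcal B$ for the empty word $\omega$. Let $S=S_{(\mathcal B,\mathcal L,\theta,\mathcal I)}$ be the inverse semigroup with zero consisting of $0$ and the triples $(\alpha,A,\beta)$ with $\alpha,\beta$ finite words and $\emptyset\neq A\in\mathcal I_\alpha\cap\mathcal I_\beta$, with $(\alpha,A,\beta)^*=(\beta,A,\alpha)$ and with product $$(\alpha,A,\beta)(\gamma,C,\delta)=\begin{cases}(\alpha\gamma',\theta_{\gamma'}(A)\cap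 C,\delta)&\gamma=\beta\gamma',\\(\alpha,A\cap\theta_{\beta'}(C),\delta\beta')&\beta=\gamma\beta',\\0&\text{otherwise,}\end{cases}$$ where a triple with middle entry $\emptyset$ is read as $0$. The map $\varphi(\alpha,A,\beta)=\alpha\beta^{-1}$ from $S\setminus\{0\}$ to the free group $\mathbb F[\mathcal L]$ on $\mathcal L$ makes $S$ strongly $E^*$-unitary, that is, $\varphi(st)=\varphi(s)\varphi(t)$ whenever $st\ne0$, and $\varphi^{-1}(e)$ consists of idempotents. Let $E$ be the semilattice of idempotents of $S$. A finite set $Z$ of elements below $x\in E$ is a cover of $x$ if every $0\neq y\le x$ satisfies $yz\neq0$ for some $z\in Z$; a tight filter is a proper filter of $E$ that meets every finite cover of each of its elements. Let $T$ be the space of tight filters, with the topology induced from $\{0,1\}^E$, and let $V_x=\{\xi\in T:x\in\xi\}$. For $g\in\mathbb F[\mathcal L]$ let $E_g=\{ss^*:s\ne0,\ \varphi(s)=g\}\cup\{0\}$, let $U_g=\bigcup_{x\in E_g}V_x$, and let $D_g$ be the $R$-module of locally constant, compactly supported functions $T\to R$ with support in $U_g$. The maps $E_{g^{-1}}\to E_g$,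 $s^*s\mapsto ss^*$ ($\varphi(s)=g$), induce homeomorphisms $\phi_g:U_{g^{-1}}\to U_g$ and isomorphisms $\alpha_g:D_{g^{-1}}\to D_g$, $f\mapsto f\circ\phi_{g^{-1}}$. The partial skew group ring $L_R(S)$ is $\bigoplus_{g}D_g\delta_g$ with $(a\delta_g)(b\delta_h)=\alpha_g(\alpha_{g^{-1}}(a)b)\delta_{gh}$. For $x\in E_g$ write $x\delta_g$ for $1_{V_x}\delta_g$. Theorem. There is an isomorphism of (not necessarily unital) $R$-algebras $L_R(\mathcal B,\mathcal L,\theta,\mathcal I)\to L_R(S_{(\mathcal B,\mathcal L,\theta,\mathcal I)})$ with $$p_A\mapsto(\omega,A,\omega)\delta_e,\qquad s_{a,A}\mapsto(a,A,a)\delta_a,\qquad s^*_{a,A}\mapsto(\omega,A,\omega)\delta_{a^{-1}}$$ for all $A\in\mathcal B$ in the first case, and all $a\in\mathcal L$ and $A\in\mathcal I_a$ in the other two. -/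

import Mathlib

/-- An inverse semigroup with zero: a regular semigroup with zero whose idempotents commute
(equivalently, every `s` has a unique inverse `s⁻¹`, i.e. a unique element with
`s * s⁻¹ * s = s` and `s⁻¹ * s * s⁻¹ = s⁻¹`). -/
class InverseSemigroupWithZero (S : Type*) extends SemigroupWithZero S, Inv S where
  mul_inv_mul : ∀ s : S, s * s⁻¹ * s = s
  inv_mul_inv : ∀ s : S, s⁻¹ * s * s⁻¹ = s⁻¹
  idem_comm : ∀ e f : S, e * e = e → f * f = f → e * f = f * e

namespace InverseSemigroupWithZero

variable {S : Type*} [InverseSemigroupWithZero S]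

theorem inv_unique {s t : S} (h1 : s * t * s = s) (h2 : t * s * t = t) : t = s⁻¹ := by
  have e1 : (s * t) * (s * t) = s * t := by rw [← mul_assoc, h1]
  have e2 : (t * s) * (t * s) = t * s := by rw [← mul_assoc, h2]
  have e3 : (s * s⁻¹) * (s * s⁻¹) = s * s⁻¹ := by rw [← mul_assoc, mul_inv_mul]
  have e4 : (s⁻¹ * s) * (s⁻¹ * s) = s⁻¹ * s := by rw [← mul_assoc, inv_mul_inv]
  calc t = t * (s * s⁻¹ * s) * t := by rw [mul_inv_mul, h2]
    _ = t * ((s * s⁻¹) * (s * t)) := by simp only [mul_assoc]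
    _ = t * ((s * t) * (s * s⁻¹)) := by rw [idem_comm _ _ e3 e1]
    _ = (t * s * t) * s * s⁻¹ := by simp only [mul_assoc]
    _ = t * s * s⁻¹ := by rw [h2]
    _ = t * s * (s⁻¹ * s * s⁻¹) := by rw [inv_mul_inv]
    _ = (t * s) * (s⁻¹ * s) * s⁻¹ := by simp only [mul_assoc]
    _ = (s⁻¹ * s) * (t * s) * s⁻¹ := by rw [idem_comm _ _ e2 e4]
    _ = s⁻¹ * (s * t * s) * s⁻¹ := by simp only [mul_assoc]
    _ = s⁻¹ := by rw [h1, inv_mul_inv]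

theorem inv_inv' (s : S) : s⁻¹⁻¹ = s := (inv_unique (inv_mul_inv s) (mul_inv_mul s)).symm

theorem mul_inv_idem (s : S) : (s * s⁻¹) * (s * s⁻¹) = s * s⁻¹ := by
  rw [← mul_assoc, mul_inv_mul]

theorem inv_mul_idem (s : S) : (s⁻¹ * s) * (s⁻¹ * s) = s⁻¹ * s := by
  rw [← mul_assoc, inv_mul_inv]

theorem inv_of_idem {e : S} (he : e * e = e) : e⁻¹ = e :=
  (inv_unique (by rw [he, he]) (by rw [he, he])).symm

theorem mul_inv_rev' (s t : S) : (s * t)⁻¹ = t⁻¹ * s⁻¹ := by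
  have h := idem_comm _ _ (inv_mul_idem s) (mul_inv_idem t)
  refine (inv_unique ?_ ?_).symm
  · calc s * t * (t⁻¹ * s⁻¹) * (s * t) = s * ((t * t⁻¹) * (s⁻¹ * s)) * t := by
          simp only [mul_assoc]
      _ = s * ((s⁻¹ * s) * (t * t⁻¹)) * t := by rw [h]
      _ = (s * s⁻¹ * s) * (t * t⁻¹ * t) := by simp only [mul_assoc]
      _ = s * t := by rw [mul_inv_mul, mul_inv_mul]
  · calc t⁻¹ * s⁻¹ * (s * t) * (t⁻¹ * s⁻¹) = t⁻¹ * ((s⁻¹ * s) * (t * t⁻¹)) * s⁻¹ := by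
          simp only [mul_assoc]
      _ = t⁻¹ * ((t * t⁻¹) * (s⁻¹ * s)) * s⁻¹ := by rw [h]
      _ = (t⁻¹ * t * t⁻¹) * (s⁻¹ * s * s⁻¹) := by simp only [mul_assoc]
      _ = t⁻¹ * s⁻¹ := by rw [inv_mul_inv, inv_mul_inv]

theorem conj_idem (s : S) {e : S} (he : e * e = e) :
    (s * e * s⁻¹) * (s * e * s⁻¹) = s * e * s⁻¹ := by
  calc (s * e * s⁻¹) * (s * e * s⁻¹) = s * (e * (s⁻¹ * s)) * e * s⁻¹ := by
        simp only [mul_assoc]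
    _ = s * ((s⁻¹ * s) * e) * e * s⁻¹ := by rw [idem_comm _ _ he (inv_mul_idem s)]
    _ = (s * s⁻¹ * s) * (e * e) * s⁻¹ := by simp only [mul_assoc]
    _ = s * e * s⁻¹ := by rw [mul_inv_mul, he]

/-- The set of idempotents of `S`. -/
@[ext]
structure Idem (S : Type*) [InverseSemigroupWithZero S] where
  val : S
  idem : val * val = val

/-- The semilattice of idempotents: `e ≤ f` iff `e * f = e`, and `e ⊓ f = e * f`. -/
instance : SemilatticeInf (Idem S) where
  le e f := e.1 * f.1 = e.1
  le_refl e := e.2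
  le_trans a b c hab hbc := by
    rw [← hab, mul_assoc, hbc]
  le_antisymm a b hab hba := Idem.ext <| by
    rw [← hab, idem_comm _ _ a.2 b.2]; exact hba
  inf e f := ⟨e.1 * f.1, by
    calc (e.1 * f.1) * (e.1 * f.1) = e.1 * (f.1 * e.1) * f.1 := by simp only [mul_assoc]
      _ = e.1 * (e.1 * f.1) * f.1 := by rw [idem_comm _ _ f.2 e.2]
      _ = (e.1 * e.1) * (f.1 * f.1) := by simp only [mul_assoc]
      _ = e.1 * f.1 := by rw [e.2, f.2]⟩
  inf_le_left e f := by
    change e.1 * f.1 * e.1 = e.1 * f.1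
    rw [mul_assoc, idem_comm _ _ f.2 e.2, ← mul_assoc, e.2]
  inf_le_right e f := by
    change e.1 * f.1 * f.1 = e.1 * f.1
    rw [mul_assoc, f.2]
  le_inf a b c hab hac := by
    change a.1 * (b.1 * c.1) = a.1
    rw [← mul_assoc, hab, hac]

instance : OrderBot (Idem S) where
  bot := ⟨0, by rw [zero_mul]⟩
  bot_le a := zero_mul a.1

theorem Idem.le_def {e f : Idem S} : e ≤ f ↔ e.1 * f.1 = e.1 := Iff.rfl

theorem Idem.inf_val (e f : Idem S) : (e ⊓ f).1 = e.1 * f.1 := rfl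

theorem Idem.bot_val : (⊥ : Idem S).1 = 0 := rfl

theorem Idem.ne_bot_iff {e : Idem S} : e ≠ ⊥ ↔ e.1 ≠ 0 :=
  not_congr ⟨fun h => by rw [h]; rfl, fun h => Idem.ext h⟩

/-- The range idempotent `s s⁻¹`. -/
def ran (s : S) : Idem S := ⟨s * s⁻¹, mul_inv_idem s⟩

/-- The source idempotent `s⁻¹ s`. -/
def src (s : S) : Idem S := ⟨s⁻¹ * s, inv_mul_idem s⟩

/-- The conjugate `s e s⁻¹` of an idempotent `e`. -/
def conj (s : S) (e : Idem S) : Idem S := ⟨s * e.1 * s⁻¹, conj_idem s e.2⟩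

end InverseSemigroupWithZero

/-- A finite set `Z` is a cover of `x` in a meet semilattice with minimum if its elements are
below `x` and every nonzero `y ≤ x` meets some element of `Z`. -/
def IsFiniteCover {E : Type*} [SemilatticeInf E] [OrderBot E] (Z : Finset E) (x : E) : Prop :=
  (∀ z ∈ Z, z ≤ x) ∧ ∀ y ≤ x, y ≠ ⊥ → ∃ z ∈ Z, z ⊓ y ≠ ⊥

/-- Tight filters of a meet semilattice `E` with minimum: proper filters `ξ` such that every
finite cover of an element of `ξ` meets `ξ`. -/
@[ext]
structure TightFilter (E : Type*) [SemilatticeInf E] [OrderBot E] where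
  carrier : Set E
  nonempty : carrier.Nonempty
  bot_notMem : ⊥ ∉ carrier
  mem_of_le : ∀ {x y : E}, x ∈ carrier → x ≤ y → y ∈ carrier
  inf_mem : ∀ {x y : E}, x ∈ carrier → y ∈ carrier → x ⊓ y ∈ carrier
  tight : ∀ x ∈ carrier, ∀ Z : Finset E, IsFiniteCover Z x → ∃ z ∈ Z, z ∈ carrier

namespace TightFilter

variable {E : Type*} [SemilatticeInf E] [OrderBot E]

open Classical in
/-- The indicator of a tight filter, as a point of `{0,1}^E`. -/
noncomputable def indicator (ξ : TightFilter E) : E → Bool := fun x => decide (x ∈ ξ.carrier)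

/-- The space of tight filters has the topology of pointwise convergence, i.e. the subspace
topology from the product space `{0,1}^E` of discrete spaces. -/
noncomputable instance : TopologicalSpace (TightFilter E) :=
  TopologicalSpace.induced indicator inferInstance

/-- The basic set `V_x` of all tight filters containing `x`. -/
def V (x : E) : Set (TightFilter E) := {ξ | x ∈ ξ.carrier}

theorem isClopen_V (x : E) : IsClopen (V x) := by
  have hc : Continuous (indicator (E := E)) := continuous_induced_dom
  have h : V x = (fun ξ : TightFilter E => indicator ξ x) ⁻¹' {true} := by
    ext ξ; simp [V, indicator]
  rw [h]
  exact (isClopen_discrete _).preimage ((continuous_apply x).comp hc)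

theorem isCompact_V (x : E) : IsCompact (V x) := by
  have hi : Topology.IsInducing (indicator (E := E)) := ⟨rfl⟩
  rw [hi.isCompact_iff]
  have hcl : ∀ (y : E) (b : Bool), IsClosed {χ : E → Bool | χ y = b} := fun y b =>
    isClosed_eq (continuous_apply y) continuous_const
  have himg : indicator '' (V x) =
      {χ : E → Bool | χ x = true} ∩ {χ | χ ⊥ = false} ∩
      (⋂ y, ⋂ z, ⋂ (_ : y ≤ z), ({χ | χ y = false} ∪ {χ | χ z = true})) ∩
      (⋂ y, ⋂ z, ({χ | χ y = false} ∪ {χ | χ z = false} ∪ {χ | χ (y ⊓ z) = true})) ∩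
      (⋂ y, ⋂ Z : Finset E, ⋂ (_ : IsFiniteCover Z y),
        ({χ | χ y = false} ∪ ⋃ z ∈ Z, {χ | χ z = true})) := by
    ext χ
    simp only [Set.mem_image, Set.mem_inter_iff, Set.mem_ofPred_eq, Set.mem_iInter, Set.mem_union,
      Set.mem_iUnion, exists_prop]
    constructor
    · rintro ⟨ξ, hξ, rfl⟩
      simp only [indicator, decide_eq_true_eq, decide_eq_false_iff_not]
      refine ⟨⟨⟨⟨hξ, ξ.bot_notMem⟩, ?_⟩, ?_⟩, ?_⟩
      · intro y z hyz
        by_cases h : y ∈ ξ.carrier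
        · exact Or.inr (ξ.mem_of_le h hyz)
        · exact Or.inl h
      · intro y z
        by_cases h : y ∈ ξ.carrier
        · by_cases h' : z ∈ ξ.carrier
          · exact Or.inr (ξ.inf_mem h h')
          · exact Or.inl (Or.inr h')
        · exact Or.inl (Or.inl h)
      · intro y Z hZ
        by_cases h : y ∈ ξ.carrier
        · exact Or.inr (ξ.tight y h Z hZ)
        · exact Or.inl h
    · rintro ⟨⟨⟨⟨h1, h2⟩, h3⟩, h4⟩, h5⟩
      refine ⟨⟨{y | χ y = true}, ⟨x, h1⟩, by simp [h2], ?_, ?_, ?_⟩, h1, ?_⟩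
      · intro y z hy hyz
        simpa [show χ y = true from hy] using h3 y z hyz
      · intro y z hy hz
        simpa [show χ y = true from hy, show χ z = true from hz] using h4 y z
      · intro y hy Z hZ
        simpa [show χ y = true from hy] using h5 y Z hZ
      · funext y
        simp [indicator]
  rw [himg]
  refine IsClosed.isCompact ?_
  refine (((((hcl _ _).inter (hcl _ _)).inter ?_).inter ?_).inter ?_)
  · exact isClosed_iInter fun y => isClosed_iInter fun z => isClosed_iInter fun _ =>
      (hcl _ _).union (hcl _ _)
  · exact isClosed_iInter fun y => isClosed_iInter fun z =>
      ((hcl _ _).union (hcl _ _)).union (hcl _ _)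
  · exact isClosed_iInter fun y => isClosed_iInter fun Z => isClosed_iInter fun _ =>
      (hcl _ _).union (Set.Finite.isClosed_biUnion Z.finite_toSet fun z _ => hcl _ _)

end TightFilter

/-- A grading `φ : S ∖ {0} → G` making `S` strongly `E*`-unitary: `φ (s t) = φ s φ t` whenever
`s t ≠ 0`, and `φ⁻¹(1)` consists of idempotents. The value of `φ` at `0` plays no role. -/
structure StrongGrading (S G : Type*) [InverseSemigroupWithZero S] [Group G] where
  toFun : S → G
  map_mul : ∀ s t : S, s * t ≠ 0 → toFun (s * t) = toFun s * toFun t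
  idem_of_eq_one : ∀ s : S, s ≠ 0 → toFun s = 1 → s * s = s

namespace StrongGrading

open InverseSemigroupWithZero

variable {S G : Type*} [InverseSemigroupWithZero S] [Group G] (φ : StrongGrading S G)

/-- `E_g = {s s⁻¹ : s ≠ 0, φ s = g} ∪ {0}`. -/
def E (g : G) : Set (Idem S) := {e | e = ⊥ ∨ ∃ s : S, s ≠ 0 ∧ φ.toFun s = g ∧ ran s = e}

/-- The open set `U_g` of tight filters that meet `E_g`. -/
def U (g : G) : Set (TightFilter (Idem S)) := {ξ | ∃ e ∈ φ.E g, e ∈ ξ.carrier}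

theorem ne_zero_of_mul_inv {s : S} (h : s * s⁻¹ ≠ 0) : s ≠ 0 := by
  rintro rfl; exact h (zero_mul _)

theorem ran_ne_bot {s : S} (h : s ≠ 0) : ran s ≠ ⊥ := by
  rw [Idem.ne_bot_iff]
  intro h'
  apply h
  rw [← mul_inv_mul s, show s * s⁻¹ = 0 from h', zero_mul]

theorem inv_ne_zero' {s : S} (h : s ≠ 0) : s⁻¹ ≠ 0 := by
  intro h'
  apply h
  rw [← mul_inv_mul s, h', mul_zero, zero_mul]

theorem ran_inv (s : S) : ran s⁻¹ = src s := Idem.ext <| by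
  change s⁻¹ * s⁻¹⁻¹ = s⁻¹ * s
  rw [inv_inv']

theorem src_inv (s : S) : src s⁻¹ = ran s := Idem.ext <| by
  change s⁻¹⁻¹ * s⁻¹ = s * s⁻¹
  rw [inv_inv']

theorem src_ne_bot {s : S} (h : s ≠ 0) : src s ≠ ⊥ := by
  rw [← ran_inv]; exact ran_ne_bot (inv_ne_zero' h)

theorem ne_zero_of_src {s : S} (h : src s ≠ ⊥) : s ≠ 0 := by
  rintro rfl
  exact h (Idem.ext (mul_zero _))

theorem ne_zero_of_src_mem {s : S} {ξ : TightFilter (Idem S)} (h : src s ∈ ξ.carrier) : s ≠ 0 :=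
  ne_zero_of_src fun h' => ξ.bot_notMem (h' ▸ h)

theorem ne_zero_of_ran_mem {s : S} {ξ : TightFilter (Idem S)} (h : ran s ∈ ξ.carrier) : s ≠ 0 := by
  rw [← src_inv] at h
  have := inv_ne_zero' (ne_zero_of_src_mem h)
  rwa [inv_inv'] at this

theorem map_idem {e : S} (he : e * e = e) (h0 : e ≠ 0) : φ.toFun e = 1 := by
  have h := φ.map_mul e e (by rwa [he])
  rw [he] at h
  exact left_eq_mul.1 h

theorem map_inv {s : S} (h : s ≠ 0) : φ.toFun s⁻¹ = (φ.toFun s)⁻¹ := by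
  have h1 : s * s⁻¹ ≠ 0 := Idem.ne_bot_iff.1 (ran_ne_bot h)
  have h2 := φ.map_mul _ _ h1
  rw [φ.map_idem (mul_inv_idem s) h1] at h2
  exact (inv_eq_of_mul_eq_one_right h2.symm).symm

theorem mem_U_iff {g : G} {ξ : TightFilter (Idem S)} :
    ξ ∈ φ.U g ↔ ∃ s : S, φ.toFun s = g ∧ ran s ∈ ξ.carrier := by
  constructor
  · rintro ⟨e, he | ⟨s, _, hs, rfl⟩, hξ⟩
    · exact absurd (he ▸ hξ) ξ.bot_notMem
    · exact ⟨s, hs, hξ⟩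
  · rintro ⟨s, hs, hξ⟩
    exact ⟨_, Or.inr ⟨s, ne_zero_of_ran_mem hξ, hs, rfl⟩, hξ⟩

theorem src_mul (s t : S) : (src (s * t)).1 = t⁻¹ * (src s).1 * t := by
  change (s * t)⁻¹ * (s * t) = t⁻¹ * (s⁻¹ * s) * t
  rw [mul_inv_rev']; simp only [mul_assoc]

theorem ran_mul (s t : S) : (ran (s * t)).1 = s * (ran t).1 * s⁻¹ := by
  change (s * t) * (s * t)⁻¹ = s * (t * t⁻¹) * s⁻¹
  rw [mul_inv_rev']; simp only [mul_assoc]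

theorem src_idem (e : Idem S) : src e.1 = e := Idem.ext <| by
  change e.1⁻¹ * e.1 = e.1
  rw [inv_of_idem e.2, e.2]

theorem ran_idem (e : Idem S) : ran e.1 = e := Idem.ext <| by
  change e.1 * e.1⁻¹ = e.1
  rw [inv_of_idem e.2, e.2]

theorem ran_mul_le (s t : S) : ran (s * t) ≤ ran s := by
  rw [Idem.le_def, ran_mul]
  change s * (t * t⁻¹) * s⁻¹ * (s * s⁻¹) = _
  calc s * (t * t⁻¹) * s⁻¹ * (s * s⁻¹) = s * (t * t⁻¹) * (s⁻¹ * s * s⁻¹) := by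
        simp only [mul_assoc]
    _ = _ := by rw [inv_mul_inv]; rfl

theorem src_mul_le (s t : S) : src (s * t) ≤ src t := by
  have h := ran_mul_le t⁻¹ s⁻¹
  rwa [← mul_inv_rev', ran_inv, ran_inv] at h

theorem conj_src_eq (s : S) (e : Idem S) : src (e.1 * s) = conj s⁻¹ e := Idem.ext <| by
  rw [src_mul, src_idem]
  change _ = s⁻¹ * e.1 * s⁻¹⁻¹
  rw [inv_inv']

/-- If `s` and `t` have equal degree and compatible sources, then `s t⁻¹` is idempotent. -/
theorem idem_mul_inv {s t : S} (h : φ.toFun s = φ.toFun t) (h0 : s * (t⁻¹ * t) ≠ 0) :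
    (s * t⁻¹) * (s * t⁻¹) = s * t⁻¹ := by
  have h1 : s * t⁻¹ ≠ 0 := by
    intro h'
    apply h0
    rw [← mul_assoc, h', zero_mul]
  have ht : t ≠ 0 := by
    rintro rfl
    exact h0 (by rw [mul_zero, mul_zero])
  refine φ.idem_of_eq_one _ h1 ?_
  rw [φ.map_mul _ _ h1, φ.map_inv ht, h, mul_inv_cancel]

theorem src_inf (s t : S) : src (s * (t⁻¹ * t)) = src s ⊓ src t := Idem.ext <| by
  rw [src_mul, inv_of_idem (inv_mul_idem t), Idem.inf_val]
  change (t⁻¹ * t) * (s⁻¹ * s) * (t⁻¹ * t) = (s⁻¹ * s) * (t⁻¹ * t)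
  rw [idem_comm _ _ (inv_mul_idem t) (inv_mul_idem s), mul_assoc, inv_mul_idem]

/-- If `φ t = g` and `t⁻¹ t ∈ ξ`, then the translate of `ξ` by `g` consists of all `y` with
`t⁻¹ y t ∈ ξ`. -/
theorem translate_aux {t : S} {ξ : TightFilter (Idem S)} (ht : src t ∈ ξ.carrier) (y : Idem S) :
    (∃ s : S, φ.toFun s = φ.toFun t ∧ src s ∈ ξ.carrier ∧ ran s ≤ y) ↔
      conj t⁻¹ y ∈ ξ.carrier := by
  constructor
  · rintro ⟨s, hs, hsξ, hsy⟩
    have hmem := ξ.inf_mem hsξ ht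
    rw [← src_inf] at hmem
    have hf := φ.idem_mul_inv hs (ne_zero_of_src_mem hmem)
    set f : Idem S := ⟨s * t⁻¹, hf⟩ with hfdef
    have hft : s * (t⁻¹ * t) = f.1 * t := by rw [← mul_assoc]
    rw [hft] at hmem
    have hfy : f ≤ y := by
      refine le_trans ?_ hsy
      rw [← ran_idem f]
      exact ran_mul_le _ _
    refine ξ.mem_of_le hmem ?_
    rw [Idem.le_def]
    rw [Idem.le_def] at hfy
    rw [conj_src_eq]
    change t⁻¹ * f.1 * t⁻¹⁻¹ * (t⁻¹ * y.1 * t⁻¹⁻¹) = t⁻¹ * f.1 * t⁻¹⁻¹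
    rw [inv_inv']
    calc t⁻¹ * f.1 * t * (t⁻¹ * y.1 * t) = t⁻¹ * (f.1 * (t * t⁻¹)) * y.1 * t := by
          simp only [mul_assoc]
      _ = t⁻¹ * ((t * t⁻¹) * f.1) * y.1 * t := by rw [idem_comm _ _ f.2 (mul_inv_idem t)]
      _ = (t⁻¹ * t * t⁻¹) * (f.1 * y.1) * t := by simp only [mul_assoc]
      _ = t⁻¹ * f.1 * t := by rw [inv_mul_inv, hfy]
  · intro h
    rw [← conj_src_eq] at h
    have h0 := ne_zero_of_src_mem h
    refine ⟨y.1 * t, ?_, h, ?_⟩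
    · rw [φ.map_mul _ _ h0, φ.map_idem y.2, one_mul]
      intro hy
      exact h0 (by rw [hy, zero_mul])
    · have := ran_mul_le y.1 t
      rwa [ran_idem] at this

theorem conj_inf (s : S) (x y : Idem S) : conj s (x ⊓ y) = conj s x ⊓ conj s y :=
  Idem.ext <| by
    rw [Idem.inf_val]
    change s * (x.1 * y.1) * s⁻¹ = s * x.1 * s⁻¹ * (s * y.1 * s⁻¹)
    calc s * (x.1 * y.1) * s⁻¹ = (s * s⁻¹ * s) * (x.1 * y.1) * s⁻¹ := by rw [mul_inv_mul]
      _ = s * ((s⁻¹ * s) * x.1) * y.1 * s⁻¹ := by simp only [mul_assoc]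
      _ = s * (x.1 * (s⁻¹ * s)) * y.1 * s⁻¹ := by rw [idem_comm _ _ (inv_mul_idem s) x.2]
      _ = _ := by simp only [mul_assoc]

theorem conj_mono (s : S) {x y : Idem S} (h : x ≤ y) : conj s x ≤ conj s y := by
  rw [← inf_eq_left] at h ⊢
  rw [← conj_inf, h]

theorem conj_bot (s : S) : conj s (⊥ : Idem S) = ⊥ := Idem.ext <| by
  change s * 0 * s⁻¹ = 0
  rw [mul_zero, zero_mul]

theorem conj_inv_conj (s : S) (x : Idem S) : conj s⁻¹ (conj s x) = src s ⊓ x :=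
  Idem.ext <| by
    rw [Idem.inf_val]
    change s⁻¹ * (s * x.1 * s⁻¹) * s⁻¹⁻¹ = s⁻¹ * s * x.1
    rw [inv_inv']
    calc s⁻¹ * (s * x.1 * s⁻¹) * s = (s⁻¹ * s) * (x.1 * (s⁻¹ * s)) := by simp only [mul_assoc]
      _ = (s⁻¹ * s) * ((s⁻¹ * s) * x.1) := by rw [idem_comm _ _ x.2 (inv_mul_idem s)]
      _ = _ := by rw [← mul_assoc, inv_mul_idem]

theorem conj_conj_inv (s : S) (x : Idem S) : conj s (conj s⁻¹ x) = ran s ⊓ x := by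
  have h := conj_inv_conj s⁻¹ x
  rwa [inv_inv', src_inv] at h

theorem conj_le_ran (s : S) (x : Idem S) : conj s x ≤ ran s := by
  have h := ran_mul_le s x.1
  have h2 : ran (s * x.1) = conj s x := Idem.ext <| by rw [ran_mul, ran_idem]; rfl
  rwa [h2] at h

/-- The partial homeomorphism `φ_g : U_{g⁻¹} → U_g`: it sends `ξ` to the filter generated by the
elements `s s⁻¹` with `φ s = g` and `s⁻¹ s ∈ ξ`, extending the maps
`E_{g⁻¹} → E_g`, `s⁻¹ s ↦ s s⁻¹`. -/
noncomputable def translate (g : G) (ξ : TightFilter (Idem S)) (hξ : ξ ∈ φ.U g⁻¹) :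
    TightFilter (Idem S) :=
  have ht : ∃ t : S, φ.toFun t = g ∧ src t ∈ ξ.carrier := by
    obtain ⟨s, hs, hsξ⟩ := φ.mem_U_iff.1 hξ
    refine ⟨s⁻¹, ?_, by rwa [src_inv]⟩
    rw [φ.map_inv (ne_zero_of_ran_mem hsξ), hs, inv_inv]
  have key : ∃ t : S, src t ∈ ξ.carrier ∧ ∀ y : Idem S,
      ((∃ s : S, φ.toFun s = g ∧ src s ∈ ξ.carrier ∧ ran s ≤ y) ↔ conj t⁻¹ y ∈ ξ.carrier) := by
    obtain ⟨t, rfl, ht⟩ := ht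
    exact ⟨t, ht, fun y => φ.translate_aux ht y⟩
  { carrier := {y | ∃ s : S, φ.toFun s = g ∧ src s ∈ ξ.carrier ∧ ran s ≤ y}
    nonempty := by
      obtain ⟨t, h1, h2⟩ := ht
      exact ⟨ran t, t, h1, h2, le_rfl⟩
    bot_notMem := by
      rintro ⟨s, -, hs, hs0⟩
      exact ran_ne_bot (ne_zero_of_src_mem hs) (le_bot_iff.1 hs0)
    mem_of_le := by
      rintro x y ⟨s, h1, h2, h3⟩ hxy
      exact ⟨s, h1, h2, h3.trans hxy⟩
    inf_mem := by
      obtain ⟨t, -, key⟩ := key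
      intro x y hx hy
      have hx' := (key x).1 hx
      have hy' := (key y).1 hy
      refine (key (x ⊓ y)).2 ?_
      rw [conj_inf]
      exact ξ.inf_mem hx' hy'
    tight := by
      classical
      obtain ⟨t, ht, key⟩ := key
      intro x hx Z hZ
      have hx' := (key x).1 hx
      obtain ⟨w, hw, hwξ⟩ := ξ.tight _ hx' (Z.image (conj t⁻¹)) (by
        constructor
        · intro w hw
          obtain ⟨z, hz, rfl⟩ := Finset.mem_image.1 hw
          exact conj_mono _ (hZ.1 z hz)
        · intro y hy hy0
          have hyt : y ≤ src t := hy.trans (by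
            have := conj_le_ran t⁻¹ x
            rwa [ran_inv] at this)
          have hback : conj t⁻¹ (conj t y) = y := by
            rw [conj_inv_conj, inf_eq_right.2 hyt]
          obtain ⟨z, hz, hz0⟩ := hZ.2 (conj t y)
            ((conj_mono t hy).trans (by rw [conj_conj_inv]; exact inf_le_right))
            (fun h => hy0 (by rw [← hback, h, conj_bot]))
          refine ⟨_, Finset.mem_image_of_mem _ hz, fun h => hz0 ?_⟩
          have h2 : conj t (conj t⁻¹ z ⊓ y) = z ⊓ conj t y := by
            rw [conj_inf, conj_conj_inv, inf_comm (ran t) z, inf_assoc,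
              inf_eq_right.2 (conj_le_ran t y)]
          rw [← h2, h, conj_bot])
      obtain ⟨z, hz, rfl⟩ := Finset.mem_image.1 hw
      exact ⟨z, hz, (key z).2 hwξ⟩ }

theorem mem_translate {g : G} {ξ : TightFilter (Idem S)} {hξ : ξ ∈ φ.U g⁻¹} {y : Idem S} :
    y ∈ (φ.translate g ξ hξ).carrier ↔
      ∃ s : S, φ.toFun s = g ∧ src s ∈ ξ.carrier ∧ ran s ≤ y := Iff.rfl

theorem translate_mem (g : G) (ξ : TightFilter (Idem S)) (hξ : ξ ∈ φ.U g⁻¹) :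
    φ.translate g ξ hξ ∈ φ.U g := by
  obtain ⟨s, hs, hsξ⟩ := φ.mem_U_iff.1 hξ
  refine φ.mem_U_iff.2 ⟨s⁻¹, ?_, φ.mem_translate.2 ⟨s⁻¹, ?_, by rwa [src_inv], le_rfl⟩⟩ <;>
  rw [φ.map_inv (ne_zero_of_ran_mem hsξ), hs, inv_inv]

theorem translate_translate (g : G) (ξ : TightFilter (Idem S)) (hξ : ξ ∈ φ.U g⁻¹)
    (h' : φ.translate g ξ hξ ∈ φ.U g⁻¹⁻¹) :
    φ.translate g⁻¹ (φ.translate g ξ hξ) h' = ξ := by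
  obtain ⟨s, hs, hsξ⟩ := φ.mem_U_iff.1 hξ
  have hs0 := ne_zero_of_ran_mem hsξ
  have ht : φ.toFun s⁻¹ = g := by rw [φ.map_inv hs0, hs, inv_inv]
  have h1 : src s ∈ (φ.translate g ξ hξ).carrier :=
    φ.mem_translate.2 ⟨s⁻¹, ht, by rwa [src_inv], by rw [ran_inv]⟩
  ext y
  rw [mem_translate, ← hs, φ.translate_aux h1, mem_translate, ← ht,
    φ.translate_aux (by rwa [src_inv]), inv_inv', conj_conj_inv]
  exact ⟨fun h => ξ.mem_of_le h inf_le_right, fun h => ξ.inf_mem hsξ h⟩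

theorem isOpen_U (g : G) : IsOpen (φ.U g) := by
  have h : φ.U g = ⋃ e ∈ φ.E g, TightFilter.V e := by
    ext ξ; simp [U, TightFilter.V]
  rw [h]
  exact isOpen_biUnion fun e _ => (TightFilter.isClopen_V e).isOpen

theorem continuous_translate (g : G) :
    Continuous fun ξ : φ.U g⁻¹ => φ.translate g ξ.1 ξ.2 := by
  refine continuous_induced_rng.2 (continuous_pi fun y => ?_)
  rw [continuous_iff_continuousAt]
  rintro ⟨ξ, hξ⟩
  obtain ⟨s, hs, hsξ⟩ := φ.mem_U_iff.1 hξ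
  obtain ⟨t, rfl⟩ : ∃ t, s = t⁻¹ := ⟨s⁻¹, (inv_inv' s).symm⟩
  have ht0 : t ≠ 0 := by
    have := inv_ne_zero' (ne_zero_of_ran_mem hsξ)
    rwa [inv_inv'] at this
  rw [φ.map_inv ht0, inv_inj] at hs
  subst hs
  rw [ran_inv] at hsξ
  have hopen : IsOpen {η : φ.U (φ.toFun t)⁻¹ | src t ∈ η.1.carrier} :=
    (TightFilter.isClopen_V (src t)).isOpen.preimage continuous_subtype_val
  have hc : Continuous fun η : φ.U (φ.toFun t)⁻¹ => TightFilter.indicator η.1 (conj t⁻¹ y) :=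
    (continuous_apply (conj t⁻¹ y)).comp
      ((continuous_induced_dom (f := TightFilter.indicator)).comp continuous_subtype_val)
  refine hc.continuousAt.congr ?_
  filter_upwards [hopen.mem_nhds hsξ] with η hη
  have := φ.translate_aux hη y
  simp only [TightFilter.indicator, Function.comp_apply, decide_eq_decide]
  rw [← this]
  rfl

theorem isClosed_support' {X R : Type*} [TopologicalSpace X] [Zero R] {f : X → R}
    (hf : IsLocallyConstant f) : IsClosed (Function.support f) :=
  (hf.isOpen_fiber 0).isClosed_compl

variable (R : Type*) [CommRing R]

/-- The coefficient ideal `D_g` of all locally constant, compactly supported functions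
`f : T(E) → R` on the space of tight filters whose support is contained in `U_g`. -/
def D (g : G) : Submodule R (TightFilter (Idem S) → R) where
  carrier := {f | IsLocallyConstant f ∧ IsCompact (Function.support f) ∧
    Function.support f ⊆ φ.U g}
  add_mem' := by
    rintro a b ⟨ha1, ha2, ha3⟩ ⟨hb1, hb2, hb3⟩
    have hab : IsLocallyConstant (a + b) := ha1.add hb1
    exact ⟨hab, (ha2.union hb2).of_isClosed_subset (isClosed_support' hab)
      (Function.support_add a b),
      (Function.support_add a b).trans (Set.union_subset ha3 hb3)⟩
  zero_mem' := ⟨IsLocallyConstant.const 0, by simp, by simp⟩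
  smul_mem' := by
    rintro r a ⟨ha1, ha2, ha3⟩
    have hab : IsLocallyConstant (r • a) := ha1.comp (r • ·)
    have hs : Function.support (r • a) ⊆ Function.support a :=
      Function.support_const_smul_subset r a
    exact ⟨hab, ha2.of_isClosed_subset (isClosed_support' hab) hs, hs.trans ha3⟩

variable {R}

theorem mem_U_inv_inv {g : G} {ξ : TightFilter (Idem S)} (h : ξ ∈ φ.U g) : ξ ∈ φ.U g⁻¹⁻¹ := by
  rwa [inv_inv]

open Classical in
/-- The map `α_g : D_{g⁻¹} → D_g`, `α_g(f) = f ∘ φ_{g⁻¹}` on `U_g`, extended by zero. -/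
noncomputable def alpha (g : G) (f : TightFilter (Idem S) → R) : TightFilter (Idem S) → R :=
  fun ξ => if h : ξ ∈ φ.U g then f (φ.translate g⁻¹ ξ (φ.mem_U_inv_inv h)) else 0

theorem alpha_add (g : G) (a b : TightFilter (Idem S) → R) :
    φ.alpha g (a + b) = φ.alpha g a + φ.alpha g b := by
  funext ξ
  by_cases h : ξ ∈ φ.U g <;> simp [alpha, h]

theorem alpha_smul (g : G) (r : R) (a : TightFilter (Idem S) → R) :
    φ.alpha g (r • a) = r • φ.alpha g a := by
  funext ξ
  by_cases h : ξ ∈ φ.U g <;> simp [alpha, h]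

theorem support_alpha_subset (g : G) (f : TightFilter (Idem S) → R) :
    Function.support (φ.alpha g f) ⊆ φ.U g := by
  intro ξ hξ
  by_contra h
  exact hξ (by simp [alpha, h])

theorem translate_congr {g g' : G} (h : g = g') {ξ ξ' : TightFilter (Idem S)} (h2 : ξ = ξ')
    (h3 : ξ ∈ φ.U g⁻¹) (h4 : ξ' ∈ φ.U g'⁻¹) : φ.translate g ξ h3 = φ.translate g' ξ' h4 := by
  subst h; subst h2; rfl

theorem isCompact_support_alpha (g : G) {f : TightFilter (Idem S) → R} (hf : f ∈ φ.D R g⁻¹) :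
    IsCompact (Function.support (φ.alpha g f)) := by
  obtain ⟨-, hf2, hf3⟩ := hf
  have h1 : IsCompact ((Subtype.val : φ.U g⁻¹ → _) ⁻¹' Function.support f) := by
    refine (Topology.IsInducing.subtypeVal.isCompact_preimage_iff ?_).2 hf2
    rwa [Subtype.range_coe]
  have h2 := h1.image (φ.continuous_translate g)
  convert h2 using 1
  ext ξ
  constructor
  · intro hξ
    have hU := φ.support_alpha_subset g f hξ
    have hξ' : f (φ.translate g⁻¹ ξ (φ.mem_U_inv_inv hU)) ≠ 0 := by
      simpa [alpha, hU] using hξ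
    refine ⟨⟨φ.translate g⁻¹ ξ (φ.mem_U_inv_inv hU), φ.translate_mem _ _ _⟩, hξ', ?_⟩
    have h3 := φ.translate_translate g⁻¹ ξ (φ.mem_U_inv_inv hU)
      (φ.mem_U_inv_inv (φ.translate_mem _ _ _))
    refine Eq.trans ?_ h3
    exact φ.translate_congr (inv_inv g).symm rfl _ _
  · rintro ⟨⟨η, hη⟩, hη', rfl⟩
    have hU := φ.translate_mem g η hη
    change φ.alpha g f (φ.translate g η hη) ≠ 0
    simp only [alpha, hU, dif_pos]
    rw [φ.translate_translate]
    exact hη'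

theorem _root_.TightFilter.t2Space {E : Type*} [SemilatticeInf E] [OrderBot E] :
    T2Space (TightFilter E) := by
  refine T2Space.of_injective_continuous (f := TightFilter.indicator) ?_ continuous_induced_dom
  intro ξ η h
  ext x
  simpa [TightFilter.indicator] using congrFun h x

theorem isLocallyConstant_alpha (g : G) {f : TightFilter (Idem S) → R} (hf : f ∈ φ.D R g⁻¹) :
    IsLocallyConstant (φ.alpha g f) := by
  have := TightFilter.t2Space (E := Idem S)
  rw [IsLocallyConstant.iff_eventually_eq]
  intro ξ
  by_cases h : ξ ∈ φ.U g
  · have h1 : IsLocallyConstant fun η : φ.U g⁻¹⁻¹ => f (φ.translate g⁻¹ η.1 η.2) :=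
      hf.1.comp_continuous (φ.continuous_translate g⁻¹)
    have h2 := (IsLocallyConstant.iff_eventually_eq _).1 h1 ⟨ξ, φ.mem_U_inv_inv h⟩
    rw [nhds_subtype_eq_comap, Filter.eventually_comap] at h2
    filter_upwards [h2, (φ.isOpen_U g).mem_nhds h] with η hη hU
    have := hη ⟨η, φ.mem_U_inv_inv hU⟩ rfl
    simpa [alpha, h, hU] using this
  · have hz : φ.alpha g f ξ = 0 := by simp [alpha, h]
    have hcl := (φ.isCompact_support_alpha g hf).isClosed
    filter_upwards [hcl.isOpen_compl.mem_nhds (show ξ ∈ (Function.support (φ.alpha g f))ᶜ from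
      fun h' => h' hz)] with η hη
    rw [hz]
    exact Function.notMem_support.1 hη

theorem alpha_mem (g : G) {f : TightFilter (Idem S) → R} (hf : f ∈ φ.D R g⁻¹) :
    φ.alpha g f ∈ φ.D R g :=
  ⟨φ.isLocallyConstant_alpha g hf, φ.isCompact_support_alpha g hf, φ.support_alpha_subset g f⟩

theorem mulCoeff_mem {g h : G} {a b : TightFilter (Idem S) → R} (ha : a ∈ φ.D R g)
    (hb : b ∈ φ.D R h) : φ.alpha g (φ.alpha g⁻¹ a * b) ∈ φ.D R (g * h) := by
  have ha' : φ.alpha g⁻¹ a ∈ φ.D R g⁻¹ := φ.alpha_mem g⁻¹ (by rwa [inv_inv])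
  have hc : φ.alpha g⁻¹ a * b ∈ φ.D R g⁻¹ := by
    have hl : IsLocallyConstant (φ.alpha g⁻¹ a * b) := ha'.1.mul hb.1
    have hs : Function.support (φ.alpha g⁻¹ a * b) ⊆ Function.support (φ.alpha g⁻¹ a) := by
      intro ξ hξ h0
      exact hξ (by simp [h0])
    exact ⟨hl, ha'.2.1.of_isClosed_subset (isClosed_support' hl) hs, hs.trans ha'.2.2⟩
  have hm := φ.alpha_mem g hc
  refine ⟨hm.1, hm.2.1, ?_⟩
  intro ξ hξ
  have hU := hm.2.2 hξ
  have hξ' : (φ.alpha g⁻¹ a * b) (φ.translate g⁻¹ ξ (φ.mem_U_inv_inv hU)) ≠ 0 := by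
    simpa only [alpha, hU, dif_pos, Function.mem_support] using hξ
  have hbU := hb.2.2 (show φ.translate g⁻¹ ξ (φ.mem_U_inv_inv hU) ∈ Function.support b from
    fun h0 => hξ' (by rw [Pi.mul_apply, h0, mul_zero]))
  obtain ⟨t, ht, htξ⟩ := φ.mem_U_iff.1 hbU
  obtain ⟨s, hs, hsξ, hst⟩ := φ.mem_translate.1 htξ
  have hr : ran (s⁻¹ * t) = src s := by
    refine Idem.ext ?_
    rw [ran_mul, inv_inv']
    change s⁻¹ * (ran t).1 * s = s⁻¹ * s
    rw [Idem.le_def] at hst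
    have hst' : s * s⁻¹ * (ran t).1 = s * s⁻¹ := hst
    calc s⁻¹ * (ran t).1 * s = s⁻¹ * (s * s⁻¹ * (ran t).1) * s := by
          conv_lhs => rw [← inv_mul_inv s]
          simp only [mul_assoc]
      _ = s⁻¹ * s * s⁻¹ * s := by rw [hst']; simp only [mul_assoc]
      _ = s⁻¹ * s := by rw [inv_mul_inv]
  have hmem : ran (s⁻¹ * t) ∈ ξ.carrier := by rwa [hr]
  refine φ.mem_U_iff.2 ⟨s⁻¹ * t, ?_, hmem⟩
  rw [φ.map_mul _ _ (ne_zero_of_ran_mem hmem), φ.map_inv (ne_zero_of_src_mem hsξ), hs, ht, inv_inv]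

variable (R)

/-- The product `(a δ_g) (b δ_h) = α_g (α_{g⁻¹}(a) b) δ_{g h}` on coefficients. -/
noncomputable def mulCoeff (g h : G) : φ.D R g →ₗ[R] φ.D R h →ₗ[R] φ.D R (g * h) :=
  LinearMap.mk₂ R (fun a b => ⟨φ.alpha g (φ.alpha g⁻¹ a.1 * b.1), φ.mulCoeff_mem a.2 b.2⟩)
    (fun a a' b => Subtype.ext <| by simp [alpha_add, add_mul])
    (fun r a b => Subtype.ext <| by simp [alpha_smul])
    (fun a b b' => Subtype.ext <| by simp [alpha_add, mul_add])
    (fun r a b => Subtype.ext <| by simp [alpha_smul])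

/-- The partial skew group ring `L_R(S)` of the partial action of `G` on the space of tight
filters: finite formal sums `∑ a_g δ_g` with `a_g ∈ D_g`. -/
def SkewRing : Type _ := DirectSum G fun g => φ.D R g

noncomputable instance : AddCommGroup (φ.SkewRing R) :=
  inferInstanceAs (AddCommGroup (DirectSum G fun g => φ.D R g))

noncomputable instance : Module R (φ.SkewRing R) :=
  inferInstanceAs (Module R (DirectSum G fun g => φ.D R g))

open Classical in
/-- The element `a δ_g` for `a ∈ D_g`. -/
noncomputable def delta (g : G) : φ.D R g →ₗ[R] φ.SkewRing R :=
  DirectSum.lof R G (fun g => φ.D R g) g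

open Classical in
/-- The linear map on `SkewRing` with given values on the summands `D_g δ_g`. -/
noncomputable def skewLift {M : Type*} [AddCommMonoid M] [Module R M]
    (f : ∀ g, φ.D R g →ₗ[R] M) : φ.SkewRing R →ₗ[R] M :=
  DirectSum.toModule R G M f

open Classical in
theorem skewLift_delta {M : Type*} [AddCommMonoid M] [Module R M]
    (f : ∀ g, φ.D R g →ₗ[R] M) (g : G) (a : φ.D R g) :
    φ.skewLift R f (φ.delta R g a) = f g a :=
  (DirectSum.toModule_lof (M := fun g => φ.D R g) (φ := f) R g a :)

/-- The bilinear multiplication of the partial skew group ring. -/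
noncomputable def skewMul : φ.SkewRing R →ₗ[R] φ.SkewRing R →ₗ[R] φ.SkewRing R :=
  φ.skewLift R fun g => LinearMap.flip <| φ.skewLift R fun h =>
    LinearMap.flip <| (φ.mulCoeff R g h).compr₂ (φ.delta R (g * h))

noncomputable instance : NonUnitalNonAssocRing (φ.SkewRing R) where
  mul x y := φ.skewMul R x y
  left_distrib x y z := map_add (φ.skewMul R x) y z
  right_distrib x y z := LinearMap.map_add₂ (φ.skewMul R) x y z
  zero_mul x := LinearMap.map_zero₂ (φ.skewMul R) x
  mul_zero x := map_zero (φ.skewMul R x)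

instance : IsScalarTower R (φ.SkewRing R) (φ.SkewRing R) where
  smul_assoc r x y := LinearMap.map_smul₂ (φ.skewMul R) r x y

instance : SMulCommClass R (φ.SkewRing R) (φ.SkewRing R) where
  smul_comm r x y := (map_smul (φ.skewMul R x) r y).symm

theorem delta_mul_delta (g h : G) (a : φ.D R g) (b : φ.D R h) :
    φ.delta R g a * φ.delta R h b = φ.delta R (g * h) (φ.mulCoeff R g h a b) := by
  change φ.skewMul R (φ.delta R g a) (φ.delta R h b) = _
  simp [skewMul, skewLift_delta]

theorem isLocallyConstant_indicator {X : Type*} [TopologicalSpace X] {A : Set X} (hA : IsClopen A) :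
    IsLocallyConstant (Set.indicator A (fun _ => (1 : R))) := by
  rw [IsLocallyConstant.iff_eventually_eq]
  intro x
  by_cases h : x ∈ A
  · filter_upwards [hA.isOpen.mem_nhds h] with y hy
    simp [h, hy]
  · filter_upwards [hA.isClosed.isOpen_compl.mem_nhds h] with y hy
    simp [h, show y ∉ A from hy]

theorem indicator_mem {g : G} {x : Idem S} (hx : x ∈ φ.E g) :
    Set.indicator (TightFilter.V x) (fun _ => (1 : R)) ∈ φ.D R g := by
  have hl : IsLocallyConstant (Set.indicator (TightFilter.V x) (fun _ => (1 : R))) :=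
    isLocallyConstant_indicator R (TightFilter.isClopen_V x)
  have hs : Function.support (Set.indicator (TightFilter.V x) (fun _ => (1 : R))) ⊆
      TightFilter.V x := Set.support_indicator_subset
  exact ⟨hl, (TightFilter.isCompact_V x).of_isClosed_subset (isClosed_support' hl) hs,
    hs.trans fun ξ hξ => ⟨x, hx, hξ⟩⟩

/-- The element `x δ_g` for `x ∈ E_g`, where `x` stands for the characteristic function of `V_x`. -/
noncomputable def idemDelta (g : G) (x : Idem S) (hx : x ∈ φ.E g) : φ.SkewRing R :=
  φ.delta R g ⟨_, φ.indicator_mem R hx⟩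

end StrongGrading

/-- A generalized Boolean dynamical system `(𝓑, 𝓛, θ, 𝓘)`: for each letter `a` an endomorphism
`θ_a` of the generalized Boolean algebra `𝓑` and an ideal `𝓘_a` of `𝓑` that contains
`𝓕_a = {A : A ≤ θ_a C for some C}`. -/
structure GenBoolDynSystem (B L : Type*) [GeneralizedBooleanAlgebra B] where
  θ : L → B → B
  map_bot : ∀ a, θ a ⊥ = ⊥
  map_sup : ∀ a A C, θ a (A ⊔ C) = θ a A ⊔ θ a C
  map_inf : ∀ a A C, θ a (A ⊓ C) = θ a A ⊓ θ a C
  map_sdiff : ∀ a A C, θ a (A \ C) = θ a A \ θ a C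
  I : L → Order.Ideal B
  mem_I_of_le : ∀ a A C, A ≤ θ a C → A ∈ I a

namespace GenBoolDynSystem

variable {B L : Type*} [GeneralizedBooleanAlgebra B] (𝒟 : GenBoolDynSystem B L)

/-- `Δ_A`, the set of letters `a` with `θ_a(A) ≠ ∅`. -/
def Δ (A : B) : Set L := {a | 𝒟.θ a A ≠ ⊥}

/-- The set `𝓑_reg` of regular elements: `0 < |Δ_C| < ∞` for all `∅ ≠ C ≤ A`. -/
def Reg : Set B := {A | ∀ C ≤ A, C ≠ ⊥ → (𝒟.Δ C).Nonempty ∧ (𝒟.Δ C).Finite}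

theorem Δ_finite_of_reg {A : B} (hA : A ∈ 𝒟.Reg) : (𝒟.Δ A).Finite := by
  by_cases h : A = ⊥
  · subst h
    have : 𝒟.Δ ⊥ = ∅ := by
      ext a; simp [Δ, 𝒟.map_bot]
    rw [this]; exact Set.finite_empty
  · exact (hA A le_rfl h).2

theorem θ_mem_I (a : L) (A : B) : 𝒟.θ a A ∈ 𝒟.I a := 𝒟.mem_I_of_le a _ A le_rfl

theorem inf_mem_I {a : L} {A : B} (hA : A ∈ 𝒟.I a) (C : B) : A ⊓ C ∈ 𝒟.I a :=
  (𝒟.I a).lower inf_le_left hA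

/-! The algebra of the system. -/

/-- The generators `p_A` for `A ∈ 𝓑`, and `s_{a,A}`, `s*_{a,A}` for `A ∈ 𝓘_a`. -/
inductive Gen
  | p (A : B)
  | s (a : L) (A : B) (hA : A ∈ 𝒟.I a)
  | sStar (a : L) (A : B) (hA : A ∈ 𝒟.I a)

variable (R : Type*) [CommRing R]

/-- The free (associative, not necessarily unital) `R`-algebra on the generators. -/
abbrev FreeAlg : Type _ := MonoidAlgebra R (FreeSemigroup 𝒟.Gen)

variable {𝒟} in
/-- A generator, as an element of the free algebra. -/
noncomputable def ι (x : 𝒟.Gen) : 𝒟.FreeAlg R := MonoidAlgebra.single (FreeSemigroup.of x) 1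

open Gen in
/-- The defining relations. -/
inductive Rel : 𝒟.FreeAlg R → 𝒟.FreeAlg R → Prop
  | p_bot : Rel (ι R (p ⊥)) 0
  | p_inf (A A' : B) : Rel (ι R (p (A ⊓ A'))) (ι R (p A) * ι R (p A'))
  | p_sup (A A' : B) :
      Rel (ι R (p (A ⊔ A'))) (ι R (p A) + ι R (p A') - ι R (p (A ⊓ A')))
  | p_s (A : B) (a : L) (C : B) (hC : C ∈ 𝒟.I a) :
      Rel (ι R (p A) * ι R (s a C hC)) (ι R (s a C hC) * ι R (p (𝒟.θ a A)))
  | sStar_p (A : B) (a : L) (C : B) (hC : C ∈ 𝒟.I a) :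
      Rel (ι R (sStar a C hC) * ι R (p A)) (ι R (p (𝒟.θ a A)) * ι R (sStar a C hC))
  | sStar_s_same (a : L) (C C' : B) (hC : C ∈ 𝒟.I a) (hC' : C' ∈ 𝒟.I a) :
      Rel (ι R (sStar a C hC) * ι R (s a C' hC')) (ι R (p (C ⊓ C')))
  | sStar_s_ne (a a' : L) (haa' : a ≠ a') (C C' : B) (hC : C ∈ 𝒟.I a) (hC' : C' ∈ 𝒟.I a') :
      Rel (ι R (sStar a C hC) * ι R (s a' C' hC')) 0
  | s_p (a : L) (C : B) (hC : C ∈ 𝒟.I a) (C' : B) :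
      Rel (ι R (s a C hC) * ι R (p C')) (ι R (s a (C ⊓ C') (𝒟.inf_mem_I hC C')))
  | p_sStar (a : L) (C : B) (hC : C ∈ 𝒟.I a) (C' : B) :
      Rel (ι R (p C') * ι R (sStar a C hC)) (ι R (sStar a (C ⊓ C') (𝒟.inf_mem_I hC C')))
  | p_reg (A : B) (hA : A ∈ 𝒟.Reg) :
      Rel (ι R (p A)) (∑ a ∈ (𝒟.Δ_finite_of_reg hA).toFinset,
        ι R (s a (𝒟.θ a A) (𝒟.θ_mem_I a A)) * ι R (sStar a (𝒟.θ a A) (𝒟.θ_mem_I a A)))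

/-- The smallest `R`-algebra congruence that contains the defining relations. (The relations are
taken with all scalar multiples, so that the congruence respects the scalar multiplication.) -/
noncomputable def con : RingCon (𝒟.FreeAlg R) :=
  ringConGen fun x y => ∃ (r : R) (x' y' : 𝒟.FreeAlg R),
    𝒟.Rel R x' y' ∧ x = r • x' ∧ y = r • y'

theorem con_smul (r : R) {x y : 𝒟.FreeAlg R} (h : 𝒟.con R x y) : 𝒟.con R (r • x) (r • y) := by
  change RingConGen.Rel _ x y at h
  change RingConGen.Rel _ (r • x) (r • y)
  induction h with
  | of x y h =>
    obtain ⟨r', x', y', h, rfl, rfl⟩ := h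
    exact .of _ _ ⟨r * r', x', y', h, smul_smul _ _ _, smul_smul _ _ _⟩
  | refl x => exact .refl _
  | symm _ ih => exact .symm ih
  | trans _ _ ih1 ih2 => exact .trans ih1 ih2
  | add _ _ ih1 ih2 => rw [smul_add, smul_add]; exact .add ih1 ih2
  | mul _ h2 ih1 _ => rw [← smul_mul_assoc, ← smul_mul_assoc]; exact .mul ih1 h2

/-- The `R`-algebra `L_R(𝓑, 𝓛, θ, 𝓘)`: the universal (associative, not necessarily unital)
`R`-algebra on the generators subject to the defining relations. -/
def LeavittAlgebra : Type _ := (𝒟.con R).Quotient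

noncomputable instance : NonUnitalRing (𝒟.LeavittAlgebra R) :=
  inferInstanceAs (NonUnitalRing (𝒟.con R).Quotient)

/-- The quotient map from the free algebra. -/
noncomputable def LeavittAlgebra.mk (x : 𝒟.FreeAlg R) : 𝒟.LeavittAlgebra R := (x : (𝒟.con R).Quotient)

noncomputable instance : SMul R (𝒟.LeavittAlgebra R) where
  smul r := Quotient.map (r • ·) fun _ _ h => 𝒟.con_smul R r h

noncomputable instance : Module R (𝒟.LeavittAlgebra R) :=
  Function.Surjective.module R
    (⟨⟨LeavittAlgebra.mk 𝒟 R, rfl⟩, fun _ _ => rfl⟩ : 𝒟.FreeAlg R →+ 𝒟.LeavittAlgebra R)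
    Quotient.mk_surjective fun _ _ => rfl

instance : IsScalarTower R (𝒟.LeavittAlgebra R) (𝒟.LeavittAlgebra R) where
  smul_assoc r x y := by
    induction x using Quotient.inductionOn with | _ x =>
    induction y using Quotient.inductionOn with | _ y =>
    exact congrArg (LeavittAlgebra.mk 𝒟 R) (smul_mul_assoc r x y)

instance : SMulCommClass R (𝒟.LeavittAlgebra R) (𝒟.LeavittAlgebra R) where
  smul_comm r x y := by
    induction x using Quotient.inductionOn with | _ x =>
    induction y using Quotient.inductionOn with | _ y =>
    exact congrArg (LeavittAlgebra.mk 𝒟 R) (mul_smul_comm r x y).symm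

/-- The element `p_A`. -/
noncomputable def p (A : B) : 𝒟.LeavittAlgebra R := LeavittAlgebra.mk 𝒟 R (ι R (.p A))

/-- The element `s_{a,A}`. -/
noncomputable def s (a : L) (A : B) (hA : A ∈ 𝒟.I a) : 𝒟.LeavittAlgebra R :=
  LeavittAlgebra.mk 𝒟 R (ι R (.s a A hA))

/-- The element `s*_{a,A}`. -/
noncomputable def sStar (a : L) (A : B) (hA : A ∈ 𝒟.I a) : 𝒟.LeavittAlgebra R :=
  LeavittAlgebra.mk 𝒟 R (ι R (.sStar a A hA))

/-! The inverse semigroup of the system. -/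

/-- `θ_α = θ_{α_n} ∘ ⋯ ∘ θ_{α_1}` for a word `α = α_1 ⋯ α_n`; it is the identity for the empty
word. -/
def θw : List L → B → B
  | [], A => A
  | a :: α, A => θw α (𝒟.θ a A)

/-- `𝓘_α = {A : A ≤ θ_{α_2 ⋯ α_n}(C) for some C ∈ 𝓘_{α_1}}` for a nonempty word
`α = α_1 ⋯ α_n`, and `𝓘_ω = 𝓑` for the empty word `ω`. -/
def Iw : List L → Set B
  | [] => Set.univ
  | a :: α => {A | ∃ C ∈ 𝒟.I a, A ≤ 𝒟.θw α C}

theorem θw_bot (α : List L) : 𝒟.θw α ⊥ = ⊥ := by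
  induction α with
  | nil => rfl
  | cons a α ih => rw [θw, 𝒟.map_bot, ih]

theorem θw_inf (α : List L) (A C : B) : 𝒟.θw α (A ⊓ C) = 𝒟.θw α A ⊓ 𝒟.θw α C := by
  induction α generalizing A C with
  | nil => rfl
  | cons a α ih => rw [θw, 𝒟.map_inf, ih]; rfl

theorem θw_mono (α : List L) {A C : B} (h : A ≤ C) : 𝒟.θw α A ≤ 𝒟.θw α C := by
  rw [← inf_eq_left] at h ⊢
  rw [← θw_inf, h]

theorem θw_append (α β : List L) (A : B) : 𝒟.θw (α ++ β) A = 𝒟.θw β (𝒟.θw α A) := by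
  induction α generalizing A with
  | nil => rfl
  | cons a α ih => exact ih _

theorem Iw_mono {α : List L} {A C : B} (h : A ≤ C) (hC : C ∈ 𝒟.Iw α) : A ∈ 𝒟.Iw α := by
  cases α with
  | nil => trivial
  | cons a α =>
    obtain ⟨D, hD, hCD⟩ := hC
    exact ⟨D, hD, h.trans hCD⟩

theorem Iw_append {α : List L} {A : B} (hA : A ∈ 𝒟.Iw α) (β : List L) :
    𝒟.θw β A ∈ 𝒟.Iw (α ++ β) := by
  cases α with
  | nil =>
    cases β with
    | nil => trivial
    | cons b β => exact ⟨𝒟.θ b A, 𝒟.θ_mem_I b A, le_rfl⟩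
  | cons a α =>
    obtain ⟨D, hD, hAD⟩ := hA
    exact ⟨D, hD, (𝒟.θw_mono β hAD).trans (𝒟.θw_append α β D).ge⟩

theorem mem_Iw_singleton {a : L} {A : B} (hA : A ∈ 𝒟.I a) : A ∈ 𝒟.Iw [a] := ⟨A, hA, le_rfl⟩

/-- The inverse semigroup `S_{(𝓑, 𝓛, θ, 𝓘)}`: zero and the triples `(α, A, β)` with
`∅ ≠ A ∈ 𝓘_α ∩ 𝓘_β`. -/
inductive InvSgp
  | zero
  | triple (α : List L) (A : B) (β : List L) (hA : A ≠ ⊥) (hα : A ∈ 𝒟.Iw α) (hβ : A ∈ 𝒟.Iw β)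

namespace InvSgp

instance : Zero 𝒟.InvSgp := ⟨zero⟩

variable {𝒟}

open Classical in
/-- The triple `(α, A, β)`, read as `0` if `A = ∅`. -/
noncomputable def mk (α : List L) (A : B) (β : List L) (hα : A ∈ 𝒟.Iw α) (hβ : A ∈ 𝒟.Iw β) :
    𝒟.InvSgp :=
  if h : A = ⊥ then 0 else triple α A β h hα hβ

theorem inf_mem_left {α : List L} {A : B} (hA : A ∈ 𝒟.Iw α) (C : B) : A ⊓ C ∈ 𝒟.Iw α :=
  𝒟.Iw_mono inf_le_left hA

theorem inf_mem_right {α : List L} {A : B} (hA : A ∈ 𝒟.Iw α) (C : B) : C ⊓ A ∈ 𝒟.Iw α :=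
  𝒟.Iw_mono inf_le_right hA

open Classical in
/-- The product `(α, A, β) (γ, C, δ)`: it is `(α γ', θ_{γ'}(A) ∧ C, δ)` if `γ = β γ'`, it is
`(α, A ∧ θ_{β'}(C), δ β')` if `β = γ β'`, and `0` otherwise. -/
noncomputable instance : Mul 𝒟.InvSgp where
  mul
    | zero, _ => 0
    | triple .., zero => 0
    | triple α A β _ hα _, triple γ C δ _ _ hδ =>
      if β <+: γ then
        mk (α ++ γ.drop β.length) (𝒟.θw (γ.drop β.length) A ⊓ C) δ
          (inf_mem_left (𝒟.Iw_append hα _) _) (inf_mem_right hδ _)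
      else if γ <+: β then
        mk α (A ⊓ 𝒟.θw (β.drop γ.length) C) (δ ++ β.drop γ.length)
          (inf_mem_left hα _) (inf_mem_right (𝒟.Iw_append hδ _) _)
      else 0

/-- `(α, A, β)⁻¹ = (β, A, α)`. -/
instance : Inv 𝒟.InvSgp where
  inv
    | zero => 0
    | triple α A β hA hα hβ => triple β A α hA hβ hα

protected theorem zero_mul (x : 𝒟.InvSgp) : 0 * x = 0 := by cases x <;> rfl

protected theorem mul_zero (x : 𝒟.InvSgp) : x * 0 = 0 := by cases x <;> rfl

theorem mk_bot {α β : List L} (hα : (⊥ : B) ∈ 𝒟.Iw α) (hβ : ⊥ ∈ 𝒟.Iw β) :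
    mk α ⊥ β hα hβ = 0 := dif_pos rfl

theorem mk_of_eq_bot {α β : List L} {A : B} {hα : A ∈ 𝒟.Iw α} {hβ : A ∈ 𝒟.Iw β} (h : A = ⊥) :
    mk α A β hα hβ = 0 := dif_pos h

theorem mk_of_ne {α β : List L} {A : B} {hα : A ∈ 𝒟.Iw α} {hβ : A ∈ 𝒟.Iw β} (h : A ≠ ⊥) :
    mk α A β hα hβ = triple α A β h hα hβ := dif_neg h

theorem mk_congr {α β α' β' : List L} {A A' : B} {hα : A ∈ 𝒟.Iw α} {hβ : A ∈ 𝒟.Iw β}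
    {hα' : A' ∈ 𝒟.Iw α'} {hβ' : A' ∈ 𝒟.Iw β'} (h1 : α = α') (h2 : A = A') (h3 : β = β') :
    mk α A β hα hβ = mk α' A' β' hα' hβ' := by
  subst h1; subst h2; subst h3; rfl

theorem exists_mk (x : 𝒟.InvSgp) : x = 0 ∨ ∃ α A β hα hβ, x = mk α A β hα hβ := by
  cases x with
  | zero => exact Or.inl rfl
  | triple α A β hA hα hβ => exact Or.inr ⟨α, A, β, hα, hβ, (mk_of_ne hA).symm⟩

theorem inv_mk {α β : List L} {A : B} (hα : A ∈ 𝒟.Iw α) (hβ : A ∈ 𝒟.Iw β) :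
    (mk α A β hα hβ)⁻¹ = mk β A α hβ hα := by
  by_cases h : A = ⊥
  · rw [mk_of_eq_bot h, mk_of_eq_bot h]; rfl
  · rw [mk_of_ne h, mk_of_ne h]; rfl

theorem mk_mul_left {α β γ' δ : List L} {A C : B} (hα : A ∈ 𝒟.Iw α) (hβ : A ∈ 𝒟.Iw β)
    (hγ : C ∈ 𝒟.Iw (β ++ γ')) (hδ : C ∈ 𝒟.Iw δ) :
    mk α A β hα hβ * mk (β ++ γ') C δ hγ hδ =
      mk (α ++ γ') (𝒟.θw γ' A ⊓ C) δ (inf_mem_left (𝒟.Iw_append hα _) _)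
        (inf_mem_right hδ _) := by
  by_cases hA : A = ⊥
  · rw [mk_of_eq_bot hA, InvSgp.zero_mul, mk_of_eq_bot (by rw [hA, θw_bot, bot_inf_eq])]
  by_cases hC : C = ⊥
  · rw [mk_of_eq_bot hC, InvSgp.mul_zero, mk_of_eq_bot (by rw [hC, inf_bot_eq])]
  rw [mk_of_ne hA, mk_of_ne hC]
  refine (if_pos (List.prefix_append β γ')).trans ?_
  exact mk_congr (by rw [List.drop_left]) (by rw [List.drop_left]) rfl

theorem mk_mul_right {α γ β' δ : List L} {A C : B} (hα : A ∈ 𝒟.Iw α)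
    (hβ : A ∈ 𝒟.Iw (γ ++ β')) (hγ : C ∈ 𝒟.Iw γ) (hδ : C ∈ 𝒟.Iw δ) :
    mk α A (γ ++ β') hα hβ * mk γ C δ hγ hδ =
      mk α (A ⊓ 𝒟.θw β' C) (δ ++ β') (inf_mem_left hα _)
        (inf_mem_right (𝒟.Iw_append hδ _) _) := by
  by_cases hb : β' = []
  · subst hb
    simp only [List.append_nil] at hβ ⊢
    have h := mk_mul_left (γ' := []) hα hβ (by rwa [List.append_nil]) hδ
    simp only [List.append_nil] at h
    exact h
  by_cases hA : A = ⊥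
  · rw [mk_of_eq_bot hA, InvSgp.zero_mul, mk_of_eq_bot (by rw [hA, bot_inf_eq])]
  by_cases hC : C = ⊥
  · rw [mk_of_eq_bot hC, InvSgp.mul_zero, mk_of_eq_bot (by rw [hC, θw_bot, inf_bot_eq])]
  rw [mk_of_ne hA, mk_of_ne hC]
  have hn : ¬ (γ ++ β' <+: γ) := fun h => hb (by simpa using h.length_le)
  refine (if_neg hn).trans ((if_pos (List.prefix_append γ β')).trans ?_)
  exact mk_congr rfl (by rw [List.drop_left]) (by rw [List.drop_left])

theorem mk_mul_none {α β γ δ : List L} {A C : B} (hα : A ∈ 𝒟.Iw α) (hβ : A ∈ 𝒟.Iw β)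
    (hγ : C ∈ 𝒟.Iw γ) (hδ : C ∈ 𝒟.Iw δ) (h1 : ¬ β <+: γ) (h2 : ¬ γ <+: β) :
    mk α A β hα hβ * mk γ C δ hγ hδ = 0 := by
  by_cases hA : A = ⊥
  · rw [mk_of_eq_bot hA, InvSgp.zero_mul]
  by_cases hC : C = ⊥
  · rw [mk_of_eq_bot hC, InvSgp.mul_zero]
  rw [mk_of_ne hA, mk_of_ne hC]
  exact (if_neg h1).trans (if_neg h2)

theorem mk_mul_same {α β δ : List L} {A C : B} (hα : A ∈ 𝒟.Iw α) (hβ : A ∈ 𝒟.Iw β)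
    (hβ' : C ∈ 𝒟.Iw β) (hδ : C ∈ 𝒟.Iw δ) :
    mk α A β hα hβ * mk β C δ hβ' hδ =
      mk α (A ⊓ C) δ (inf_mem_left hα _) (inf_mem_right hδ _) := by
  have h := mk_mul_left (γ' := []) hα hβ (by rwa [List.append_nil]) hδ
  simp only [List.append_nil] at h
  exact h

theorem prefix_cases (β γ : List L) :
    (∃ γ', γ = β ++ γ') ∨ (∃ β', β = γ ++ β') ∨ (¬ β <+: γ ∧ ¬ γ <+: β) := by
  by_cases h1 : β <+: γ
  · obtain ⟨t, rfl⟩ := h1; exact Or.inl ⟨t, rfl⟩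
  by_cases h2 : γ <+: β
  · obtain ⟨t, rfl⟩ := h2; exact Or.inr (Or.inl ⟨t, rfl⟩)
  exact Or.inr (Or.inr ⟨h1, h2⟩)

theorem not_prefix_append {β γ : List L} (h1 : ¬ β <+: γ) (h2 : ¬ γ <+: β) (ε : List L) :
    ¬ β <+: γ ++ ε ∧ ¬ γ ++ ε <+: β :=
  ⟨fun h => (List.prefix_or_prefix_of_prefix h (List.prefix_append γ ε)).elim h1 h2,
    fun h => h2 ((List.prefix_append γ ε).trans h)⟩

protected theorem mul_assoc (x y z : 𝒟.InvSgp) : x * y * z = x * (y * z) := by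
  rcases exists_mk x with rfl | ⟨α, A, β, hα, hβ, rfl⟩
  · simp only [InvSgp.zero_mul]
  rcases exists_mk y with rfl | ⟨γ, C, δ, hγ, hδ, rfl⟩
  · simp only [InvSgp.zero_mul, InvSgp.mul_zero]
  rcases exists_mk z with rfl | ⟨ε, D, ζ, hε, hζ, rfl⟩
  · simp only [InvSgp.mul_zero]
  rcases prefix_cases β γ with ⟨γ', rfl⟩ | ⟨β', rfl⟩ | ⟨h1, h2⟩
  · rcases prefix_cases δ ε with ⟨ε', rfl⟩ | ⟨δ', rfl⟩ | ⟨h3, h4⟩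
    · rw [mk_mul_left, mk_mul_left, mk_mul_left]
      have h : ∀ (w : List L) (hw : w = β ++ (γ' ++ ε')) (E : B) (hE : E ∈ 𝒟.Iw w)
          (hE' : E ∈ 𝒟.Iw ζ), mk α A β hα hβ * mk w E ζ hE hE' =
          mk (α ++ (γ' ++ ε')) (𝒟.θw (γ' ++ ε') A ⊓ E) ζ
            (inf_mem_left (𝒟.Iw_append hα _) _) (inf_mem_right hE' _) := by
        rintro w rfl E hE hE'; exact mk_mul_left _ _ _ _
      rw [h _ (List.append_assoc _ _ _)]
      exact mk_congr (List.append_assoc _ _ _)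
        (by rw [θw_append, θw_inf, inf_assoc]) rfl
    · rw [mk_mul_left, mk_mul_right, mk_mul_right, mk_mul_left]
      exact mk_congr rfl (by rw [inf_assoc]) rfl
    · rw [mk_mul_left, mk_mul_none _ _ _ _ h3 h4, mk_mul_none _ _ _ _ h3 h4, InvSgp.mul_zero]
  · rcases prefix_cases δ ε with ⟨ε', rfl⟩ | ⟨δ', rfl⟩ | ⟨h3, h4⟩
    · rw [mk_mul_right, mk_mul_left]
      rcases prefix_cases β' ε' with ⟨μ, rfl⟩ | ⟨μ, rfl⟩ | ⟨h5, h6⟩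
      · have hl : ∀ (w : List L) (hw : w = (δ ++ β') ++ μ) (x1 : List L) (E D : B)
            (e1 : E ∈ 𝒟.Iw x1) (e2 : E ∈ 𝒟.Iw (δ ++ β')) (d1 : D ∈ 𝒟.Iw w) (d2 : D ∈ 𝒟.Iw ζ),
            mk x1 E (δ ++ β') e1 e2 * mk w D ζ d1 d2 =
            mk (x1 ++ μ) (𝒟.θw μ E ⊓ D) ζ
            (inf_mem_left (𝒟.Iw_append e1 _) _) (inf_mem_right d2 _) := by
          rintro w rfl _ E D _ _ _ _; exact mk_mul_left _ _ _ _
        have hr : ∀ (w : List L) (hw : w = (γ ++ β') ++ μ) (E : B)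
            (e1 : E ∈ 𝒟.Iw w) (e2 : E ∈ 𝒟.Iw ζ),
            mk α A (γ ++ β') hα hβ * mk w E ζ e1 e2 =
            mk (α ++ μ) (𝒟.θw μ A ⊓ E) ζ
            (inf_mem_left (𝒟.Iw_append hα _) _) (inf_mem_right e2 _) := by
          rintro w rfl E _ _; exact mk_mul_left _ _ _ _
        rw [hl _ (List.append_assoc _ _ _).symm, hr _ (List.append_assoc _ _ _).symm]
        exact mk_congr rfl (by rw [θw_inf, θw_append, inf_assoc]) rfl
      · have hl : ∀ (w : List L) (hw : w = (δ ++ ε') ++ μ) (x1 : List L) (E : B)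
            (e1 : E ∈ 𝒟.Iw x1) (e2 : E ∈ 𝒟.Iw w),
            mk x1 E w e1 e2 * mk (δ ++ ε') D ζ hε hζ =
            mk x1 (E ⊓ 𝒟.θw μ D) (ζ ++ μ)
            (inf_mem_left e1 _) (inf_mem_right (𝒟.Iw_append hζ _) _) := by
          rintro w rfl _ E _ _; exact mk_mul_right _ _ _ _
        have hr : ∀ (w : List L) (hw : w = (γ ++ ε') ++ μ) (E : B) (a2 : A ∈ 𝒟.Iw w)
            (e1 : E ∈ 𝒟.Iw (γ ++ ε')) (e2 : E ∈ 𝒟.Iw ζ),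
            mk α A w hα a2 * mk (γ ++ ε') E ζ e1 e2 =
            mk α (A ⊓ 𝒟.θw μ E) (ζ ++ μ)
            (inf_mem_left hα _) (inf_mem_right (𝒟.Iw_append e2 _) _) := by
          rintro w rfl E _ _ _; exact mk_mul_right _ _ _ _
        rw [hl _ (List.append_assoc _ _ _).symm, hr _ (List.append_assoc _ _ _).symm]
        exact mk_congr rfl (by rw [θw_inf, θw_append, inf_assoc]) rfl
      · have hp : ∀ (x : List L) {u v : List L}, ¬ u <+: v → ¬ x ++ u <+: x ++ v :=
          fun x u v h h' => h ((List.prefix_append_right_inj x).1 h')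
        rw [mk_mul_none _ _ _ _ (hp δ h5) (hp δ h6), mk_mul_none _ _ _ _ (hp γ h5) (hp γ h6)]
    · rw [mk_mul_right, mk_mul_right, mk_mul_right]
      have h : ∀ (w : List L) (hw : w = δ' ++ β') (w' : List L) (hw' : w' = ε ++ (δ' ++ β'))
          (E : B) (e1 : E ∈ 𝒟.Iw α) (e2 : E ∈ 𝒟.Iw w'),
          mk α E w' e1 e2 * mk ε D ζ hε hζ =
          mk α (E ⊓ 𝒟.θw (δ' ++ β') D) (ζ ++ (δ' ++ β'))
            (inf_mem_left e1 _) (inf_mem_right (𝒟.Iw_append hζ _) _) := by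
        rintro w rfl w' rfl E e1 e2; exact mk_mul_right _ _ _ _
      rw [h _ rfl _ (List.append_assoc _ _ _)]
      exact mk_congr rfl (by rw [θw_append, θw_inf, inf_assoc]) (List.append_assoc _ _ _).symm
    · rw [mk_mul_right, mk_mul_none _ _ _ _ h3 h4, InvSgp.mul_zero]
      have h5 := not_prefix_append h4 h3 β'
      exact mk_mul_none _ _ _ _ h5.2 h5.1
  · rw [mk_mul_none _ _ _ _ h1 h2, InvSgp.zero_mul]
    rcases prefix_cases δ ε with ⟨ε', rfl⟩ | ⟨δ', rfl⟩ | ⟨h3, h4⟩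
    · rw [mk_mul_left]
      have h5 := not_prefix_append h1 h2 ε'
      exact (mk_mul_none _ _ _ _ h5.1 h5.2).symm
    · rw [mk_mul_right, mk_mul_none _ _ _ _ h1 h2]
    · rw [mk_mul_none _ _ _ _ h3 h4, InvSgp.mul_zero]

/-- An idempotent is zero or of the form `(α, A, α)`. -/
theorem exists_of_idem {x : 𝒟.InvSgp} (h : x * x = x) : x = 0 ∨ ∃ α A hα, x = mk α A α hα hα := by
  cases x with
  | zero => exact Or.inl rfl
  | triple α A β hA hα hβ =>
    right
    suffices hs : α = β by
      subst hs; exact ⟨α, A, hα, (mk_of_ne hA).symm⟩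
    rw [← mk_of_ne hA] at h
    rcases prefix_cases β α with ⟨γ', rfl⟩ | ⟨β', rfl⟩ | ⟨h1, h2⟩
    · rw [mk_mul_left, mk_of_ne hA] at h
      by_cases h0 : 𝒟.θw γ' A ⊓ A = ⊥
      · rw [mk_of_eq_bot h0] at h; cases h
      · rw [mk_of_ne h0] at h
        injection h with h3
        simpa using h3
    · rw [mk_mul_right, mk_of_ne hA] at h
      by_cases h0 : A ⊓ 𝒟.θw β' A = ⊥
      · rw [mk_of_eq_bot h0] at h; cases h
      · rw [mk_of_ne h0] at h
        injection h with _ _ h3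
        simpa using h3
    · rw [mk_mul_none _ _ _ _ h1 h2, mk_of_ne hA] at h; cases h

noncomputable instance : InverseSemigroupWithZero 𝒟.InvSgp where
  mul_assoc := InvSgp.mul_assoc
  zero_mul := InvSgp.zero_mul
  mul_zero := InvSgp.mul_zero
  mul_inv_mul x := by
    rcases exists_mk x with rfl | ⟨α, A, β, hα, hβ, rfl⟩
    · rw [InvSgp.mul_zero]
    · rw [inv_mk, mk_mul_same, mk_mul_same]
      exact mk_congr rfl (by simp) rfl
  inv_mul_inv x := by
    rcases exists_mk x with rfl | ⟨α, A, β, hα, hβ, rfl⟩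
    · rfl
    · rw [inv_mk, mk_mul_same, mk_mul_same]
      exact mk_congr rfl (by simp) rfl
  idem_comm e f he hf := by
    rcases exists_of_idem he with rfl | ⟨α, A, hα, rfl⟩
    · rw [InvSgp.mul_zero, InvSgp.zero_mul]
    rcases exists_of_idem hf with rfl | ⟨γ, C, hγ, rfl⟩
    · rw [InvSgp.mul_zero, InvSgp.zero_mul]
    rcases prefix_cases α γ with ⟨γ', rfl⟩ | ⟨β', rfl⟩ | ⟨h1, h2⟩
    · rw [mk_mul_left, mk_mul_right]
      exact mk_congr rfl (inf_comm _ _) rfl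
    · rw [mk_mul_left, mk_mul_right]
      exact mk_congr rfl (inf_comm _ _) rfl
    · rw [mk_mul_none _ _ _ _ h1 h2, mk_mul_none _ _ _ _ h2 h1]

end InvSgp

/-- A word `α_1 ⋯ α_n`, viewed as an element of the free group on `𝓛`. -/
def word (α : List L) : FreeGroup L := (α.map FreeGroup.of).prod

theorem word_append (α β : List L) : word (α ++ β) = word α * word β := by simp [word]

theorem word_injective : Function.Injective (word (L := L)) := by
  classical
  have h : ∀ α : List L, word α = FreeGroup.mk (α.map fun a => (a, true)) := by
    intro α
    induction α with
    | nil => rfl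
    | cons a α ih =>
      rw [show word (a :: α) = FreeGroup.of a * word α by simp [word], ih]
      rfl
  have hr : ∀ α : List L, FreeGroup.reduce (α.map fun a => (a, true)) =
      α.map fun a => (a, true) := by
    intro α
    apply FreeGroup.IsReduced.reduce_eq
    unfold FreeGroup.IsReduced
    rw [List.isChain_map]
    induction α with
    | nil => simp
    | cons a α ih =>
      cases α with
      | nil => simp
      | cons b α => exact List.isChain_cons_cons.2 ⟨fun _ => rfl, ih⟩
  intro α β hab
  rw [h, h] at hab
  have h2 := congrArg FreeGroup.toWord hab
  rw [FreeGroup.toWord_mk, FreeGroup.toWord_mk, hr, hr] at h2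
  exact List.map_injective_iff.2 (fun a b hab => (Prod.mk.inj hab).1) h2

/-- The underlying map `(α, A, β) ↦ α β⁻¹` of the grading (with an irrelevant value at `0`). -/
def degree : 𝒟.InvSgp → FreeGroup L
  | .zero => 1
  | .triple α _ β _ _ _ => word α * (word β)⁻¹

theorem degree_mk {α β : List L} {A : B} {hα : A ∈ 𝒟.Iw α} {hβ : A ∈ 𝒟.Iw β}
    (h : InvSgp.mk α A β hα hβ ≠ 0) :
    𝒟.degree (InvSgp.mk α A β hα hβ) = word α * (word β)⁻¹ := by
  by_cases hA : A = ⊥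
  · exact absurd (InvSgp.mk_of_eq_bot hA) h
  · rw [InvSgp.mk_of_ne hA]; rfl

/-- The grading `(α, A, β) ↦ α β⁻¹` of the inverse semigroup by the free group on `𝓛`, which
makes it strongly `E*`-unitary. -/
def grading : StrongGrading 𝒟.InvSgp (FreeGroup L) where
  toFun := 𝒟.degree
  map_mul x y hxy := by
    rcases InvSgp.exists_mk x with rfl | ⟨α, A, β, hα, hβ, rfl⟩
    · exact absurd (zero_mul _) hxy
    rcases InvSgp.exists_mk y with rfl | ⟨γ, C, δ, hγ, hδ, rfl⟩
    · exact absurd (mul_zero _) hxy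
    have hx := 𝒟.degree_mk (left_ne_zero_of_mul hxy)
    have hy := 𝒟.degree_mk (right_ne_zero_of_mul hxy)
    rw [hx, hy]
    rcases InvSgp.prefix_cases β γ with ⟨γ', rfl⟩ | ⟨β', rfl⟩ | ⟨h1, h2⟩
    · rw [InvSgp.mk_mul_left] at hxy ⊢
      rw [𝒟.degree_mk hxy, word_append, word_append]
      group
    · rw [InvSgp.mk_mul_right] at hxy ⊢
      rw [𝒟.degree_mk hxy, word_append, word_append]
      group
    · exact absurd (InvSgp.mk_mul_none _ _ _ _ h1 h2) hxy
  idem_of_eq_one x hx h := by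
    rcases InvSgp.exists_mk x with rfl | ⟨α, A, β, hα, hβ, rfl⟩
    · exact absurd rfl hx
    rw [𝒟.degree_mk hx, mul_inv_eq_one] at h
    obtain rfl := word_injective h
    rw [InvSgp.mk_mul_same]
    exact InvSgp.mk_congr rfl (by simp) rfl

/-- The idempotent `(α, A, α)` for `A ∈ 𝓘_α`, read as `0` if `A = ∅`. -/
noncomputable def idem (α : List L) (A : B) (hA : A ∈ 𝒟.Iw α) :
    InverseSemigroupWithZero.Idem 𝒟.InvSgp :=
  ⟨InvSgp.mk α A α hA hA, by
    rw [InvSgp.mk_mul_same]; exact InvSgp.mk_congr rfl (by simp) rfl⟩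

theorem idem_mem_E {α β : List L} {A : B} (hα : A ∈ 𝒟.Iw α) (hβ : A ∈ 𝒟.Iw β) :
    𝒟.idem α A hα ∈ 𝒟.grading.E (word α * (word β)⁻¹) := by
  by_cases hA : A = ⊥
  · exact Or.inl (InverseSemigroupWithZero.Idem.ext (InvSgp.mk_of_eq_bot hA))
  · have h0 : InvSgp.mk α A β hα hβ ≠ 0 := by
      rw [InvSgp.mk_of_ne hA]; intro h; cases h
    refine Or.inr ⟨InvSgp.mk α A β hα hβ, h0, 𝒟.degree_mk h0,
      InverseSemigroupWithZero.Idem.ext ?_⟩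
    change InvSgp.mk α A β hα hβ * (InvSgp.mk α A β hα hβ)⁻¹ = InvSgp.mk α A α hα hα
    rw [InvSgp.inv_mk, InvSgp.mk_mul_same]
    exact InvSgp.mk_congr rfl (by simp) rfl

theorem mem_E_one (A : B) : 𝒟.idem [] A trivial ∈ 𝒟.grading.E 1 := by
  have h := 𝒟.idem_mem_E (α := []) (β := []) (A := A) trivial trivial
  rwa [mul_inv_cancel] at h

theorem mem_E_of {a : L} {A : B} (hA : A ∈ 𝒟.I a) :
    𝒟.idem [a] A (𝒟.mem_Iw_singleton hA) ∈ 𝒟.grading.E (FreeGroup.of a) := by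
  have h := 𝒟.idem_mem_E (α := [a]) (β := []) (𝒟.mem_Iw_singleton hA) trivial
  simpa [word] using h

theorem mem_E_of_inv {a : L} {A : B} (hA : A ∈ 𝒟.I a) :
    𝒟.idem [] A trivial ∈ 𝒟.grading.E (FreeGroup.of a)⁻¹ := by
  have h := 𝒟.idem_mem_E (α := []) (β := [a]) trivial (𝒟.mem_Iw_singleton hA)
  simpa [word] using h

end GenBoolDynSystem

/-!
Call a multiplicative map on the inverse semigroup `S` Cuntz–Krieger if it satisfies the relations
of the Leavitt algebra for joins and for regular sets. The elements `(ω, A, ω)`, `(a, A, ω)`,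
`(ω, A, a)` generate `S`, and a Cuntz–Krieger map sends them to a family that satisfies all defining
relations. Two Cuntz–Krieger maps matter: `(α, A, β) ↦ s_{α,A} s*_{β,A}` into the Leavitt algebra
`L`, and `s ↦ 1_{V_{ss*}} δ_{φ(s)}` into the partial skew group ring. The latter induces a
homomorphism `Φ` from `L`, which is surjective because these monomials span.

Conversely, the skew group ring is universal for tight multiplicative maps `t`: if a combination
`∑ cᵢ 1_{V_{xᵢ}}` vanishes, split `1` along the commuting idempotents `t(xᵢ)`; tightness provides,
for every nonzero piece `e`, a tight filter that contains exactly the `xᵢ` with `e t(xᵢ) = e`, and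
evaluating the sum there shows that `e` annihilates `∑ cᵢ t(xᵢ)`. Splitting needs a unit, so `L` is
embedded in its unitization. Every Cuntz–Krieger map is tight, by induction on the lengths of the
words in a cover, so there is a homomorphism `Ψ` back for which `Ψ ∘ Φ` is the embedding of `L`.
Hence `Φ` is injective.
-/

/-! ### Tight filters -/

/-- The finite set `Z` covers `x`: every nonzero `y ≤ x` meets an element of `Z`. Unlike in
`IsFiniteCover`, the elements of `Z` need not lie below `x`. -/
def Covers {E : Type*} [SemilatticeInf E] [OrderBot E] (Z : Finset E) (x : E) : Prop :=
  ∀ y ≤ x, y ≠ ⊥ → ∃ z ∈ Z, z ⊓ y ≠ ⊥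

namespace TightFilter

open Order

variable {E : Type*} [SemilatticeInf E] [OrderBot E]

theorem exists_inf_eq_bot_of_notMem {F : PFilter E} (hF : F.dual.IsMaximal) {z : E} (hz : z ∉ F) :
    ∃ w ∈ F, w ⊓ z = ⊥ := by
  by_contra! hne
  have hG : IsPFilter {a : E | ∃ w ∈ F, w ⊓ z ≤ a} := by
    refine IsPFilter.of_def ?_ ?_ fun hab ⟨w, hw, hwa⟩ => ⟨w, hw, hwa.trans hab⟩
    · obtain ⟨w, hw⟩ := F.nonempty
      exact ⟨w, w, hw, inf_le_left⟩
    · rintro a ⟨w, hw, hwa⟩ b ⟨w', hw', hwb⟩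
      exact ⟨_, ⟨w ⊓ w', PFilter.inf_mem hw hw', le_rfl⟩,
        (inf_le_inf_right z inf_le_left).trans hwa, (inf_le_inf_right z inf_le_right).trans hwb⟩
  have hzG : z ∈ hG.toPFilter := by
    obtain ⟨w, hw⟩ := F.nonempty
    exact ⟨w, hw, inf_le_right⟩
  have hlt : F.dual < hG.toPFilter.dual :=
    lt_of_le_of_ne (fun w hw => ⟨w, hw, inf_le_left⟩) fun h => hz (by
      change OrderDual.toDual z ∈ F.dual
      rw [h]
      exact hzG)
  have hbot : (⊥ : E) ∈ hG.toPFilter := by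
    change OrderDual.toDual (⊥ : E) ∈ (hG.toPFilter.dual : Set Eᵒᵈ)
    rw [hF.maximal_proper hlt]
    trivial
  obtain ⟨w, hw, hwz⟩ := hbot
  exact hne w hw (le_bot_iff.1 hwz)

theorem exists_le_forall_inf_eq_bot {F : PFilter E} (hF : F.dual.IsMaximal) {x : E} (hx : x ∈ F)
    (Z : Finset E) (hZ : ∀ z ∈ Z, z ∉ F) : ∃ w ∈ F, w ≤ x ∧ ∀ z ∈ Z, z ⊓ w = ⊥ := by
  classical
  induction Z using Finset.induction_on with
  | empty => exact ⟨x, hx, le_rfl, by simp⟩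
  | insert a Z _ ih =>
    rw [Finset.forall_mem_insert] at hZ
    obtain ⟨w, hw, hwx, hwZ⟩ := ih hZ.2
    obtain ⟨v, hv, hva⟩ := exists_inf_eq_bot_of_notMem hF hZ.1
    refine ⟨w ⊓ v, PFilter.inf_mem hw hv, inf_le_left.trans hwx,
      (Finset.forall_mem_insert _ _ _).2 ⟨?_, fun z hz => ?_⟩⟩
    · exact le_bot_iff.1 ((le_inf (inf_le_right.trans inf_le_right) inf_le_left).trans hva.le)
    · exact le_bot_iff.1 ((inf_le_inf_left z inf_le_left).trans (hwZ z hz).le)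

/-- A maximal proper filter, as a tight filter. -/
def ofMaximal (F : PFilter E) (hF : F.dual.IsMaximal) : TightFilter E where
  carrier := F
  nonempty := F.nonempty
  bot_notMem := Ideal.isProper_iff_top_notMem.1 hF.toIsProper
  mem_of_le hx hxy := PFilter.mem_of_le hxy hx
  inf_mem := PFilter.inf_mem
  tight x hx Z hZ := by
    by_contra! hZF
    obtain ⟨w, hwF, hwx, hwZ⟩ := exists_le_forall_inf_eq_bot hF hx Z hZF
    have hw : w ≠ ⊥ := by
      rintro rfl
      exact Ideal.isProper_iff_top_notMem.1 hF.toIsProper hwF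
    obtain ⟨z, hz, hzw⟩ := hZ.2 w hwx hw
    exact hzw (hwZ z hz)

theorem exists_mem_of_ne_bot {y : E} (hy : y ≠ ⊥) : ∃ ξ : TightFilter E, y ∈ ξ.carrier := by
  have hproper : (PFilter.principal y).dual.IsProper :=
    Ideal.isProper_iff_top_notMem.2 fun h => hy (le_bot_iff.1 (PFilter.mem_principal.1 h))
  obtain ⟨J, hyJ, hJ⟩ := hproper.exists_le_maximal
  have hy' : y ∈ PFilter.principal y := PFilter.mem_principal.2 le_rfl
  exact ⟨ofMaximal ⟨J⟩ hJ, hyJ hy'⟩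

theorem inf_mem_iff {ξ : TightFilter E} {x y : E} :
    x ⊓ y ∈ ξ.carrier ↔ x ∈ ξ.carrier ∧ y ∈ ξ.carrier :=
  ⟨fun h => ⟨ξ.mem_of_le h inf_le_left, ξ.mem_of_le h inf_le_right⟩, fun h => ξ.inf_mem h.1 h.2⟩

theorem exists_mem_of_covers {ξ : TightFilter E} {x : E} (hx : x ∈ ξ.carrier) {Z : Finset E}
    (hZ : Covers Z x) : ∃ z ∈ Z, z ∈ ξ.carrier := by
  classical
  have hcover : IsFiniteCover (Z.image (x ⊓ ·)) x := by
    refine ⟨Finset.forall_mem_image.2 fun z _ => inf_le_left, fun y hy hy0 => ?_⟩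
    obtain ⟨z, hz, h⟩ := hZ y hy hy0
    refine ⟨_, Finset.mem_image_of_mem _ hz, ?_⟩
    rwa [inf_comm x z, inf_assoc, inf_eq_right.2 hy]
  obtain ⟨w, hw, hwξ⟩ := ξ.tight x hx _ hcover
  obtain ⟨z, hz, rfl⟩ := Finset.mem_image.1 hw
  exact ⟨z, hz, (inf_mem_iff.1 hwξ).2⟩

theorem covers_iff_forall_tightFilter {x : E} {Z : Finset E} :
    Covers Z x ↔ ∀ ξ : TightFilter E, x ∈ ξ.carrier → ∃ z ∈ Z, z ∈ ξ.carrier := by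
  refine ⟨fun hZ ξ hx => exists_mem_of_covers hx hZ, fun h y hyx hy => ?_⟩
  obtain ⟨ξ, hξ⟩ := exists_mem_of_ne_bot hy
  obtain ⟨z, hz, hzξ⟩ := h ξ (ξ.mem_of_le hξ hyx)
  exact ⟨z, hz, fun hzy => ξ.bot_notMem (hzy ▸ ξ.inf_mem hzξ hξ)⟩

/-- The tight filters that contain `x` if and only if `ξ` does. -/
def agreeAt (ξ : TightFilter E) (x : E) : Set (TightFilter E) :=
  {η | x ∈ η.carrier ↔ x ∈ ξ.carrier}

theorem agreeAt_eq_V_or_compl (ξ : TightFilter E) (x : E) :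
    ξ.agreeAt x = V x ∨ ξ.agreeAt x = (V x)ᶜ := by
  by_cases hx : x ∈ ξ.carrier
  · exact Or.inl (Set.ext fun η => iff_true_right hx)
  · exact Or.inr (Set.ext fun η => iff_false_right hx)

theorem agreeAt_mem_nhds (ξ : TightFilter E) (x : E) : ξ.agreeAt x ∈ nhds ξ := by
  have hopen : IsOpen (ξ.agreeAt x) := by
    rcases ξ.agreeAt_eq_V_or_compl x with h | h <;> rw [h]
    exacts [(isClopen_V x).isOpen, (isClopen_V x).compl.isOpen]
  exact hopen.mem_nhds Iff.rfl

theorem hasBasis_nhds (ξ : TightFilter E) :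
    (nhds ξ).HasBasis (fun _ : Finset E => True) fun I => ⋂ x ∈ I, ξ.agreeAt x := by
  refine ⟨fun W => ⟨fun hW => ?_, fun ⟨I, _, hI⟩ => Filter.mem_of_superset
    ((Filter.biInter_finset_mem I).2 fun x _ => ξ.agreeAt_mem_nhds x) hI⟩⟩
  rw [nhds_induced, Filter.mem_comap] at hW
  obtain ⟨T, hT, hTW⟩ := hW
  rw [nhds_pi, Filter.mem_pi] at hT
  obtain ⟨I, hI, t, ht, hIT⟩ := hT
  refine ⟨hI.toFinset, trivial, fun η hη => hTW (hIT fun x hx => ?_)⟩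
  have hηξ : indicator η x = indicator ξ x :=
    decide_eq_decide.2 (Set.mem_iInter₂.1 hη x (hI.mem_toFinset.2 hx))
  rw [hηξ]
  exact mem_of_mem_nhds (ht x)

end TightFilter

/-! ### The partial skew group ring and tight maps -/

section IndicatorStable

variable {X R M : Type*} [Ring R] [AddCommGroup M] [Module R M]

/-- Restricting (and extending by zero) a function from `N` to the set `O` gives a function
in `N`. -/
def IndicatorStable (N : Submodule R (X → M)) (O : Set X) : Prop :=
  ∀ f ∈ N, O.indicator f ∈ N

namespace IndicatorStable

variable {N : Submodule R (X → M)} {O O' : Set X}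

theorem empty : IndicatorStable N ∅ := fun f _ => by
  rw [Set.indicator_empty']
  exact zero_mem N

theorem univ : IndicatorStable N Set.univ := fun f hf => by
  rwa [Set.indicator_univ]

theorem compl (h : IndicatorStable N O) : IndicatorStable N Oᶜ := fun f hf => by
  rw [Set.indicator_compl]
  exact sub_mem hf (h f hf)

theorem inter (h : IndicatorStable N O) (h' : IndicatorStable N O') :
    IndicatorStable N (O ∩ O') := fun f hf => by
  rw [← Set.indicator_indicator]
  exact h _ (h' f hf)

theorem biInter {ι : Type*} (I : Finset ι) {s : ι → Set X}
    (h : ∀ i ∈ I, IndicatorStable N (s i)) : IndicatorStable N (⋂ i ∈ I, s i) := by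
  classical
  induction I using Finset.induction_on with
  | empty => simpa using univ
  | insert i I _ ih =>
    rw [Finset.forall_mem_insert] at h
    rw [Finset.set_biInter_insert]
    exact h.1.inter (ih h.2)

theorem union (h : IndicatorStable N O) (h' : IndicatorStable N O') :
    IndicatorStable N (O ∪ O') := by
  rw [← compl_compl (O ∪ O'), Set.compl_union]
  exact (h.compl.inter h'.compl).compl

theorem indicator_union_mem (h : IndicatorStable N O) {f : X → M} (hf : O.indicator f ∈ N)
    (hf' : O'.indicator f ∈ N) : (O ∪ O').indicator f ∈ N := by
  have hunion : (O ∪ O').indicator f = O.indicator f + Oᶜ.indicator (O'.indicator f) := by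
    funext x
    by_cases hx : x ∈ O <;> by_cases hx' : x ∈ O' <;> simp [hx, hx']
  rw [hunion]
  exact add_mem hf (h.compl _ hf')

end IndicatorStable

theorem mem_of_isCompact_support_of_eventuallyEq [TopologicalSpace X] {N : Submodule R (X → M)}
    (hN : ∀ x, ∀ W ∈ nhds x, ∃ O ∈ nhds x, O ⊆ W ∧ IndicatorStable N O) {f : X → M}
    (hc : IsCompact (Function.support f))
    (hf : ∀ x ∈ Function.support f, ∃ g ∈ N, g =ᶠ[nhds x] f) : f ∈ N := by
  obtain ⟨O, hfO, -, hO⟩ : ∃ O, Function.support f ⊆ O ∧ IndicatorStable N O ∧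
      O.indicator f ∈ N := by
    refine hc.induction_on (p := fun s => ∃ O, s ⊆ O ∧ IndicatorStable N O ∧ O.indicator f ∈ N)
      ⟨∅, subset_rfl, .empty, ?_⟩ ?_ ?_ fun x hx => ?_
    · rw [Set.indicator_empty']
      exact zero_mem N
    · rintro s t hst ⟨O, htO, hO⟩
      exact ⟨O, hst.trans htO, hO⟩
    · rintro s t ⟨O, hsO, hO, hf⟩ ⟨O', htO', hO', hf'⟩
      exact ⟨O ∪ O', Set.union_subset_union hsO htO', hO.union hO', hO.indicator_union_mem hf hf'⟩
    · obtain ⟨g, hg, hgf⟩ := hf x hx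
      obtain ⟨O, hOx, hO, hON⟩ := hN x _ hgf
      refine ⟨O, mem_nhdsWithin_of_mem_nhds hOx, O, subset_rfl, hON, ?_⟩
      rw [← Set.indicator_congr hO]
      exact hON g hg
  rwa [Set.indicator_eq_self.2 hfO] at hO

end IndicatorStable

namespace StrongGrading

open InverseSemigroupWithZero

variable {S G : Type*} [InverseSemigroupWithZero S] [Group G] (φ : StrongGrading S G)

theorem ran_zero : ran (0 : S) = ⊥ := Idem.ext (zero_mul _)

theorem ran_mul_eq_conj (s t : S) : ran (s * t) = conj s (ran t) := Idem.ext (ran_mul s t)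

theorem ran_mem_E (s : S) : ran s ∈ φ.E (φ.toFun s) := by
  by_cases h : s = 0
  · exact Or.inl (by rw [h, ran_zero])
  · exact Or.inr ⟨s, h, rfl, rfl⟩

theorem ran_idem_mul (e : Idem S) (s : S) : ran (e.1 * s) = e ⊓ ran s := Idem.ext <| by
  rw [ran_mul, inv_of_idem e.2, mul_assoc, idem_comm _ _ (ran s).2 e.2, ← mul_assoc, e.2,
    Idem.inf_val]

theorem inf_mem_E (e : Idem S) {g : G} {x : Idem S} (hx : x ∈ φ.E g) : e ⊓ x ∈ φ.E g := by
  by_cases h0 : e ⊓ x = ⊥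
  · exact Or.inl h0
  rcases hx with rfl | ⟨s, -, rfl, rfl⟩
  · exact absurd (inf_bot_eq e) h0
  rw [← ran_idem_mul] at h0 ⊢
  have hes : e.1 * s ≠ 0 := fun h => h0 (by rw [h, ran_zero])
  have he : e.1 ≠ 0 := fun h => hes (by rw [h, zero_mul])
  refine Or.inr ⟨e.1 * s, hes, ?_, rfl⟩
  rw [φ.map_mul _ _ hes, φ.map_idem e.2 he, one_mul]

/-- The characteristic function of `V_x`. -/
noncomputable def charFn (R : Type*) [CommRing R] (x : Idem S) : TightFilter (Idem S) → R :=
  Set.indicator (TightFilter.V x) fun _ => 1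

section charFn

variable {R : Type*} [CommRing R]

theorem charFn_of_mem {x : Idem S} {ξ : TightFilter (Idem S)} (h : x ∈ ξ.carrier) :
    charFn R x ξ = 1 := Set.indicator_of_mem (s := TightFilter.V x) h _

theorem charFn_of_notMem {x : Idem S} {ξ : TightFilter (Idem S)} (h : x ∉ ξ.carrier) :
    charFn R x ξ = 0 := Set.indicator_of_notMem (s := TightFilter.V x) h _

theorem charFn_congr {x y : Idem S} {ξ η : TightFilter (Idem S)}
    (h : x ∈ ξ.carrier ↔ y ∈ η.carrier) : charFn R x ξ = charFn R y η := by
  by_cases hx : x ∈ ξ.carrier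
  · rw [charFn_of_mem hx, charFn_of_mem (h.1 hx)]
  · rw [charFn_of_notMem hx, charFn_of_notMem (mt h.2 hx)]

theorem charFn_bot : charFn R (⊥ : Idem S) = 0 := funext fun ξ => charFn_of_notMem ξ.bot_notMem

theorem indicator_V_charFn (x y : Idem S) :
    (TightFilter.V x).indicator (charFn R y) = charFn R (x ⊓ y) := by
  have hV : TightFilter.V x ∩ TightFilter.V y = TightFilter.V (x ⊓ y) :=
    Set.ext fun ξ => TightFilter.inf_mem_iff.symm
  rw [charFn, Set.indicator_indicator, hV, charFn]

end charFn

theorem mem_translate_inv_iff {s : S} {ξ : TightFilter (Idem S)} (hs : ran s ∈ ξ.carrier)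
    (hξ : ξ ∈ φ.U (φ.toFun s)⁻¹⁻¹) (y : Idem S) :
    y ∈ (φ.translate (φ.toFun s)⁻¹ ξ hξ).carrier ↔ conj s y ∈ ξ.carrier := by
  have h := φ.translate_aux (t := s⁻¹) (ξ := ξ) (by rwa [src_inv]) y
  rwa [inv_inv', φ.map_inv (ne_zero_of_ran_mem hs)] at h

section Monomial

variable (R : Type*) [CommRing R]

variable {R} in
theorem alpha_mul_apply {g : G} {ξ : TightFilter (Idem S)} (hξ : ξ ∈ φ.U g)
    (a b : TightFilter (Idem S) → R) :
    φ.alpha g (φ.alpha g⁻¹ a * b) ξ = a ξ * b (φ.translate g⁻¹ ξ (φ.mem_U_inv_inv hξ)) := by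
  have hη := φ.translate_mem g⁻¹ ξ (φ.mem_U_inv_inv hξ)
  simp only [alpha, hξ, hη, dif_pos, Pi.mul_apply]
  rw [φ.translate_translate]

theorem alpha_charFn (s t : S) :
    φ.alpha (φ.toFun s) (φ.alpha (φ.toFun s)⁻¹ (charFn R (ran s)) * charFn R (ran t)) =
      charFn R (ran (s * t)) := by
  funext ξ
  by_cases hs : ran s ∈ ξ.carrier
  · rw [φ.alpha_mul_apply (φ.mem_U_iff.2 ⟨s, rfl, hs⟩), charFn_of_mem hs, one_mul,
      ran_mul_eq_conj]
    exact charFn_congr (φ.mem_translate_inv_iff hs _ _)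
  · rw [charFn_of_notMem fun h => hs (ξ.mem_of_le h (ran_mul_le s t))]
    by_cases hξ : ξ ∈ φ.U (φ.toFun s)
    · rw [φ.alpha_mul_apply hξ, charFn_of_notMem hs, zero_mul]
    · exact dif_neg hξ

/-- The element `s s⁻¹ δ_{φ(s)}` of the partial skew group ring. -/
noncomputable def monomial (s : S) : φ.SkewRing R :=
  φ.idemDelta R (φ.toFun s) (ran s) (φ.ran_mem_E s)

theorem idemDelta_congr {g g' : G} {x x' : Idem S} (hg : g = g') (hx : x = x') (h : x ∈ φ.E g)
    (h' : x' ∈ φ.E g') : φ.idemDelta R g x h = φ.idemDelta R g' x' h' := by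
  subst hg; subst hx; rfl

theorem idemDelta_bot (g : G) (h : ⊥ ∈ φ.E g) : φ.idemDelta R g ⊥ h = 0 := by
  have hzero : (⟨_, φ.indicator_mem R h⟩ : φ.D R g) = 0 := Subtype.ext charFn_bot
  rw [idemDelta, hzero, map_zero]

theorem idemDelta_eq_monomial {g : G} {x : Idem S} (h : x ∈ φ.E g) {s : S} (hx : ran s = x)
    (hg : s ≠ 0 → φ.toFun s = g) : φ.idemDelta R g x h = φ.monomial R s := by
  by_cases hs : s = 0
  · have hx' : x = ⊥ := by rw [← hx, hs, ran_zero]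
    subst hx'
    exact (φ.idemDelta_bot R g h).trans ((φ.idemDelta_congr R rfl hx (φ.ran_mem_E s)
      (Or.inl rfl)).trans (φ.idemDelta_bot R _ _)).symm
  · exact φ.idemDelta_congr R (hg hs).symm hx.symm _ _

theorem monomial_zero : φ.monomial R (0 : S) = 0 :=
  (φ.idemDelta_eq_monomial R (g := 1) (Or.inl rfl) ran_zero fun h => absurd rfl h).symm.trans
    (φ.idemDelta_bot R _ _)

theorem monomial_mul (s t : S) : φ.monomial R s * φ.monomial R t = φ.monomial R (s * t) := by
  have hmem : ran (s * t) ∈ φ.E (φ.toFun s * φ.toFun t) := by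
    by_cases h : s * t = 0
    · exact Or.inl (by rw [h, ran_zero])
    · exact φ.map_mul s t h ▸ φ.ran_mem_E (s * t)
  calc φ.monomial R s * φ.monomial R t
      = φ.idemDelta R (φ.toFun s * φ.toFun t) (ran (s * t)) hmem :=
        (φ.delta_mul_delta R _ _ _ _).trans
          (congrArg _ (Subtype.ext (φ.alpha_charFn R s t)))
    _ = φ.monomial R (s * t) := φ.idemDelta_eq_monomial R hmem rfl (φ.map_mul s t)

/-- The span of the characteristic functions of the sets `V_x` with `x ∈ E_g`. -/
def charSpan (g : G) : Submodule R (TightFilter (Idem S) → R) :=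
  Submodule.span R (charFn R '' φ.E g)

theorem indicatorStable_V (g : G) (x : Idem S) :
    IndicatorStable (φ.charSpan R g) (TightFilter.V x) := by
  intro f hf
  induction hf using Submodule.span_induction with
  | mem f hf =>
    obtain ⟨y, hy, rfl⟩ := hf
    rw [indicator_V_charFn]
    exact Submodule.subset_span ⟨_, φ.inf_mem_E x hy, rfl⟩
  | zero =>
    rw [Set.indicator_zero']
    exact zero_mem _
  | add f f' _ _ h h' =>
    rw [Set.indicator_add']
    exact add_mem h h'
  | smul r f _ h =>
    exact (Set.indicator_const_smul _ r f).symm ▸ Submodule.smul_mem _ r h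

theorem exists_indicatorStable_mem_nhds (g : G) (ξ : TightFilter (Idem S))
    {W : Set (TightFilter (Idem S))} (hW : W ∈ nhds ξ) :
    ∃ O ∈ nhds ξ, O ⊆ W ∧ IndicatorStable (φ.charSpan R g) O := by
  obtain ⟨I, -, hI⟩ := ξ.hasBasis_nhds.mem_iff.1 hW
  refine ⟨_, ξ.hasBasis_nhds.mem_of_mem trivial, hI, .biInter I fun x _ => ?_⟩
  rcases ξ.agreeAt_eq_V_or_compl x with h | h <;> rw [h]
  exacts [φ.indicatorStable_V R g x, (φ.indicatorStable_V R g x).compl]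

theorem D_eq_charSpan (g : G) : φ.D R g = φ.charSpan R g := by
  refine le_antisymm (fun f hf => ?_) (Submodule.span_le.2 ?_)
  · obtain ⟨hl, hc, hU⟩ := hf
    refine mem_of_isCompact_support_of_eventuallyEq
      (fun ξ W => φ.exists_indicatorStable_mem_nhds R g ξ) hc fun ξ hξ => ?_
    obtain ⟨x, hx, hxξ⟩ := hU hξ
    refine ⟨f ξ • charFn R x, Submodule.smul_mem _ _ (Submodule.subset_span ⟨x, hx, rfl⟩), ?_⟩
    filter_upwards [(IsLocallyConstant.iff_eventually_eq f).1 hl ξ,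
      (TightFilter.isClopen_V x).isOpen.mem_nhds hxξ] with η hη hxη
    rw [Pi.smul_apply, charFn_of_mem hxη, smul_eq_mul, mul_one, hη]
  · rintro _ ⟨x, hx, rfl⟩
    exact φ.indicator_mem R hx

theorem span_charFn_preimage (g : G) :
    Submodule.span R (((↑) : φ.D R g → TightFilter (Idem S) → R) ⁻¹' (charFn R '' φ.E g)) = ⊤ := by
  rw [φ.D_eq_charSpan R g]
  exact Submodule.span_span_coe_preimage

theorem delta_mem_span_monomial (g : G) (a : φ.D R g) :
    φ.delta R g a ∈ Submodule.span R (Set.range (φ.monomial R)) := by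
  have ha : φ.delta R g a ∈ (Submodule.span R
      (((↑) : φ.D R g → TightFilter (Idem S) → R) ⁻¹' (charFn R '' φ.E g))).map (φ.delta R g) :=
    Submodule.mem_map_of_mem (φ.span_charFn_preimage R g ▸ Submodule.mem_top)
  rw [Submodule.map_span] at ha
  refine Submodule.span_le.2 ?_ ha
  rintro _ ⟨⟨_, hD⟩, ⟨x, hx, rfl⟩, rfl⟩
  rcases id hx with rfl | ⟨s, -, rfl, rfl⟩
  · have hzero : φ.delta R g ⟨charFn R ⊥, hD⟩ = 0 := φ.idemDelta_bot R g hx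
    exact hzero ▸ zero_mem (Submodule.span R (Set.range (φ.monomial R)))
  · exact Submodule.subset_span ⟨s, rfl⟩

theorem span_monomial : Submodule.span R (Set.range (φ.monomial R)) = ⊤ := by
  classical
  refine Submodule.eq_top_iff'.2 fun x => ?_
  induction x using DirectSum.induction_on with
  | zero => exact zero_mem _
  | of g a => exact φ.delta_mem_span_monomial R g a
  | add x y hx hy => exact add_mem hx hy

variable {R} in
theorem monomial_induction {p : φ.SkewRing R → Prop} (monomial : ∀ s, p (φ.monomial R s))
    (zero : p 0) (add : ∀ x y, p x → p y → p (x + y)) (smul : ∀ (r : R) x, p x → p (r • x))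
    (x : φ.SkewRing R) : p x := by
  have hx : x ∈ Submodule.span R (Set.range (φ.monomial R)) :=
    φ.span_monomial R ▸ Submodule.mem_top
  induction hx using Submodule.span_induction with
  | mem x hx =>
    obtain ⟨s, rfl⟩ := hx
    exact monomial s
  | zero => exact zero
  | add x y _ _ hx hy => exact add x y hx hy
  | smul r x _ hx => exact smul r x hx

variable {R} in
theorem skew_mul_assoc (x y z : φ.SkewRing R) : x * y * z = x * (y * z) := by
  induction x using φ.monomial_induction with
  | zero => simp only [zero_mul]
  | add x x' hx hx' => simp only [add_mul, hx, hx']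
  | smul r x hx => simp only [smul_mul_assoc, hx]
  | monomial s =>
  induction y using φ.monomial_induction with
  | zero => simp only [zero_mul, mul_zero]
  | add y y' hy hy' => simp only [add_mul, mul_add, hy, hy']
  | smul r y hy => simp only [smul_mul_assoc, mul_smul_comm, hy]
  | monomial t =>
  induction z using φ.monomial_induction with
  | zero => simp only [mul_zero]
  | add z z' hz hz' => simp only [mul_add, hz, hz']
  | smul r z hz => simp only [mul_smul_comm, hz]
  | monomial u => simp only [monomial_mul, mul_assoc]

noncomputable instance : NonUnitalRing (φ.SkewRing R) :=
  { (inferInstance : NonUnitalNonAssocRing (φ.SkewRing R)) with mul_assoc := φ.skew_mul_assoc }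

open Classical in
/-- The linear map that reads off the coefficient `a_g` of `∑ a_h δ_h`. -/
noncomputable def coeff (g : G) : φ.SkewRing R →ₗ[R] (TightFilter (Idem S) → R) :=
  φ.skewLift R fun h => if h = g then (φ.D R h).subtype else 0

open Classical in
theorem coeff_monomial (g : G) (s : S) :
    φ.coeff R g (φ.monomial R s) = if φ.toFun s = g then charFn R (ran s) else 0 := by
  refine (φ.skewLift_delta R _ _ _).trans ?_
  split_ifs <;> rfl

end Monomial

theorem inv_mul_idem_of_eq {s t : S} (h : φ.toFun s = φ.toFun t) :
    s⁻¹ * t * (s⁻¹ * t) = s⁻¹ * t := by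
  by_cases h0 : s⁻¹ * t = 0
  · rw [h0, zero_mul]
  · have hs : s ≠ 0 := by
      rintro rfl
      exact h0 (by rw [inv_of_idem (zero_mul (0 : S)), zero_mul])
    exact φ.idem_of_eq_one _ h0 (by rw [φ.map_mul _ _ h0, φ.map_inv hs, h, inv_mul_cancel])

theorem inv_mul_comm_of_eq {s t : S} (h : φ.toFun s = φ.toFun t) : s⁻¹ * t = t⁻¹ * s := by
  rw [← inv_of_idem (φ.inv_mul_idem_of_eq h), mul_inv_rev', inv_inv']

theorem ran_mul_comm_of_eq {s t : S} (h : φ.toFun s = φ.toFun t) :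
    (ran s).1 * t = (ran t).1 * s :=
  calc s * s⁻¹ * t = s * s⁻¹ * (t * t⁻¹ * t) := by rw [mul_inv_mul]
    _ = t * t⁻¹ * (s * s⁻¹) * t := by
      rw [← mul_assoc, idem_comm _ _ (mul_inv_idem s) (mul_inv_idem t)]
    _ = t * (t⁻¹ * s * (s⁻¹ * t)) := by simp only [mul_assoc]
    _ = t * (t⁻¹ * s) := by rw [φ.inv_mul_comm_of_eq h, φ.inv_mul_idem_of_eq h.symm]
    _ = t * t⁻¹ * s := (mul_assoc _ _ _).symm

end StrongGrading

theorem mul_eq_zero_of_forall_dichotomy {ι A : Type*} [NonUnitalRing A] {p : ι → A}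
    (hidem : ∀ i, p i * p i = p i) (hcomm : ∀ i j, p i * p j = p j * p i) (F : Finset ι) {x : A}
    (hx : ∀ e, (∀ i ∈ F, e * p i = e ∨ e * p i = 0) → e * x = 0) (e : A) : e * x = 0 := by
  classical
  induction F using Finset.induction_on with
  | empty => exact hx e (by simp)
  | insert a F _ ih =>
    refine ih fun e he => ?_
    have hin : e * p a * x = 0 := hx _ <| (Finset.forall_mem_insert _ _ _).2
      ⟨Or.inl (by rw [mul_assoc, hidem]), fun i hi => (he i hi).imp
        (fun h => by rw [mul_assoc, hcomm, ← mul_assoc, h])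
        (fun h => by rw [mul_assoc, hcomm, ← mul_assoc, h, zero_mul])⟩
    have hout : (e - e * p a) * x = 0 := hx _ <| (Finset.forall_mem_insert _ _ _).2
      ⟨Or.inr (by rw [sub_mul, mul_assoc, hidem, sub_self]), fun i hi => (he i hi).imp
        (fun h => by rw [sub_mul, mul_assoc, hcomm, ← mul_assoc, h])
        (fun h => by rw [sub_mul, mul_assoc, hcomm, ← mul_assoc, h, zero_mul, sub_zero])⟩
    rwa [sub_mul, hin, sub_zero] at hout

section Tight

open InverseSemigroupWithZero

variable {S A : Type*} [InverseSemigroupWithZero S] [NonUnitalRing A]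

/-- Every element of `A` that annihilates `t z` from the left for all `z ∈ Z` also annihilates
`t x`. If `A` is unital and `t` is multiplicative, this says `∏ (1 - t z) * t x = 0`. -/
def IsDominated (t : S → A) (Z : Finset (Idem S)) (x : Idem S) : Prop :=
  ∀ e, (∀ z ∈ Z, e * t z.1 = 0) → e * t x.1 = 0

/-- Tightness, in the sense of Exel's tight representations: every `x` is dominated by each of its
covers. -/
def IsTight (t : S → A) : Prop :=
  ∀ (x : Idem S) (Z : Finset (Idem S)), Covers Z x → IsDominated t Z x

theorem IsTight.exists_tightFilter {t : S → A} (ht : IsTight t) {x : Idem S}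
    {Z : Finset (Idem S)} {e : A} (hZ : ∀ z ∈ Z, e * t z.1 = 0) (hx : e * t x.1 ≠ 0) :
    ∃ ξ : TightFilter (Idem S), x ∈ ξ.carrier ∧ ∀ z ∈ Z, z ∉ ξ.carrier := by
  by_contra! h
  exact hx (ht x Z (TightFilter.covers_iff_forall_tightFilter.2 h) e hZ)

theorem IsTight.exists_tightFilter_forall_mem_iff (hm : ∀ a b, t (a * b) = t a * t b)
    (ht : IsTight t) {F : Finset S} {e : A} (he : e ≠ 0)
    (hF : ∀ i ∈ F, e * t (ran i).1 = e ∨ e * t (ran i).1 = 0) {j : S} (hj : j ∈ F)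
    (hje : e * t (ran j).1 = e) :
    ∃ ξ : TightFilter (Idem S), ∀ i ∈ F, ran i ∈ ξ.carrier ↔ e * t (ran i).1 = e := by
  classical
  have hne : (F.filter fun i => e * t (ran i).1 = e).Nonempty :=
    ⟨j, Finset.mem_filter.2 ⟨hj, hje⟩⟩
  have hz : e * t ((F.filter fun i => e * t (ran i).1 = e).inf' hne ran).1 = e :=
    Finset.inf'_induction hne ran (p := fun z => e * t z.1 = e)
      (fun x hx y hy => by rw [Idem.inf_val, hm, ← mul_assoc, hx, hy])
      fun i hi => (Finset.mem_filter.1 hi).2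
  obtain ⟨ξ, hzξ, hξ⟩ := ht.exists_tightFilter (e := e)
    (Z := (F.filter fun i => e * t (ran i).1 = 0).image ran)
    (Finset.forall_mem_image.2 fun i hi => (Finset.mem_filter.1 hi).2) (hz.symm ▸ he)
  refine ⟨ξ, fun i hi => ⟨fun hiξ => (hF i hi).resolve_right fun h0 => ?_, fun h => ?_⟩⟩
  · exact hξ _ (Finset.mem_image_of_mem _ (Finset.mem_filter.2 ⟨hi, h0⟩)) hiξ
  · exact ξ.mem_of_le hzξ (Finset.inf'_le ran (Finset.mem_filter.2 ⟨hi, h⟩))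

end Tight

namespace StrongGrading

open InverseSemigroupWithZero

variable {S G R A : Type*} [InverseSemigroupWithZero S] [Group G] (φ : StrongGrading S G)
  [CommRing R]

section NonUnital

variable [NonUnitalRing A] [Module R A] {t : S → A}

theorem mul_sum_eq_zero_of_dichotomy [SMulCommClass R A A]
    (hm : ∀ a b, t (a * b) = t a * t b) (ht : IsTight t)
    {F : Finset S} {g : G} (hg : ∀ i ∈ F, φ.toFun i = g) {c : S → R}
    (hc : ∑ i ∈ F, c i • charFn R (ran i) = 0) {e : A}
    (he : ∀ i ∈ F, e * t (ran i).1 = e ∨ e * t (ran i).1 = 0) :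
    e * ∑ i ∈ F, c i • t i = 0 := by
  classical
  have hran (i : S) : t (ran i).1 * t i = t i := by rw [← hm]; exact congrArg t (mul_inv_mul i)
  by_cases hT : ∃ j ∈ F, e * t (ran j).1 = e ∧ e ≠ 0
  · obtain ⟨j, hj, hje, he0⟩ := hT
    obtain ⟨ξ, hξ⟩ := ht.exists_tightFilter_forall_mem_iff hm he0 he hj hje
    have hterm (i : S) (hi : i ∈ F) : e * t i = charFn R (ran i) ξ • (e * t j) := by
      rcases he i hi with h | h
      · rw [charFn_of_mem ((hξ i hi).2 h), one_smul, ← hje, mul_assoc, ← hm,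
          φ.ran_mul_comm_of_eq ((hg j hj).trans (hg i hi).symm), hm, ← mul_assoc, h, hje]
      · rw [charFn_of_notMem fun hiξ => he0 (((hξ i hi).1 hiξ).symm.trans h), zero_smul,
          ← hran i, ← mul_assoc, h, zero_mul]
    calc e * ∑ i ∈ F, c i • t i = (∑ i ∈ F, c i • charFn R (ran i)) ξ • (e * t j) := by
          rw [Finset.mul_sum, Finset.sum_apply, Finset.sum_smul]
          exact Finset.sum_congr rfl fun i hi => by
            rw [mul_smul_comm, hterm i hi, Pi.smul_apply, smul_assoc]
      _ = 0 := by rw [hc, Pi.zero_apply, zero_smul]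
  · rw [Finset.mul_sum]
    refine Finset.sum_eq_zero fun i hi => ?_
    push Not at hT
    have hi0 : e * t (ran i).1 = 0 := (he i hi).elim (fun h => h.trans (hT i hi h)) id
    rw [mul_smul_comm, ← hran i, ← mul_assoc, hi0, zero_mul, smul_zero]

end NonUnital

section Unital

variable [Ring A] [Algebra R A] {t : S → A}

theorem sum_eq_zero_of_sum_charFn_eq_zero (hm : ∀ a b, t (a * b) = t a * t b) (ht : IsTight t)
    {F : Finset S} {g : G} (hg : ∀ i ∈ F, φ.toFun i = g) {c : S → R}
    (hc : ∑ i ∈ F, c i • charFn R (ran i) = 0) : ∑ i ∈ F, c i • t i = 0 := by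
  rw [← one_mul (∑ i ∈ F, c i • t i)]
  refine mul_eq_zero_of_forall_dichotomy (p := fun i => t (ran i).1)
    (fun i => by rw [← hm, (ran i).2])
    (fun i j => by rw [← hm, ← hm, idem_comm _ _ (ran i).2 (ran j).2]) F
    (fun e he => φ.mul_sum_eq_zero_of_dichotomy hm ht hg hc he) 1

theorem linearCombination_eq_zero_of_monomial (hm : ∀ a b, t (a * b) = t a * t b)
    (ht : IsTight t) {c : S →₀ R} (hc : Finsupp.linearCombination R (φ.monomial R) c = 0) :
    Finsupp.linearCombination R t c = 0 := by
  classical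
  rw [Finsupp.linearCombination_apply, Finsupp.sum] at hc ⊢
  rw [← Finset.sum_fiberwise_of_maps_to fun s hs => Finset.mem_image_of_mem φ.toFun hs]
  refine Finset.sum_eq_zero fun g _ => φ.sum_eq_zero_of_sum_charFn_eq_zero hm ht
    (fun i hi => (Finset.mem_filter.1 hi).2) ?_
  have hcoeff := congrArg (φ.coeff R g) hc
  rw [map_sum, map_zero] at hcoeff
  rw [Finset.sum_filter]
  refine (Finset.sum_congr rfl fun s _ => ?_).trans hcoeff
  rw [map_smul, coeff_monomial]
  split_ifs <;> simp only [smul_zero]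

theorem exists_linearMap_monomial (hm : ∀ a b, t (a * b) = t a * t b) (ht : IsTight t) :
    ∃ Ψ : φ.SkewRing R →ₗ[R] A, ∀ s, Ψ (φ.monomial R s) = t s := by
  have hsurj : Function.Surjective (Finsupp.linearCombination R (φ.monomial R)) := by
    rw [← LinearMap.range_eq_top, Finsupp.range_linearCombination, φ.span_monomial R]
  have hker : LinearMap.ker (Finsupp.linearCombination R (φ.monomial R)) ≤
      LinearMap.ker (Finsupp.linearCombination R t) := fun c hc =>
    φ.linearCombination_eq_zero_of_monomial hm ht hc
  refine ⟨(LinearMap.ker _).liftQ _ hker ∘ₗ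
    (LinearMap.quotKerEquivOfSurjective _ hsurj).symm.toLinearMap, fun s => ?_⟩
  have hs : (LinearMap.quotKerEquivOfSurjective _ hsurj).symm (φ.monomial R s) =
      Submodule.Quotient.mk (Finsupp.single s 1) := by
    rw [LinearEquiv.symm_apply_eq, LinearMap.quotKerEquivOfSurjective_apply_mk,
      Finsupp.linearCombination_single, one_smul]
  rw [LinearMap.comp_apply, LinearEquiv.coe_coe, hs, Submodule.liftQ_apply,
    Finsupp.linearCombination_single, one_smul]

theorem exists_nonUnitalAlgHom_monomial (hm : ∀ a b, t (a * b) = t a * t b) (ht : IsTight t) :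
    ∃ Ψ : φ.SkewRing R →ₙₐ[R] A, ∀ s, Ψ (φ.monomial R s) = t s := by
  obtain ⟨Ψ, hΨ⟩ := φ.exists_linearMap_monomial (R := R) hm ht
  refine ⟨{ Ψ with map_zero' := map_zero Ψ, map_mul' := fun x y => ?_ }, hΨ⟩
  change Ψ (x * y) = Ψ x * Ψ y
  induction x using φ.monomial_induction with
  | zero => simp only [zero_mul, map_zero]
  | add x x' hx hx' => simp only [add_mul, map_add, hx, hx']
  | smul r x hx => simp only [smul_mul_assoc, map_smul, hx]
  | monomial s =>
  induction y using φ.monomial_induction with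
  | zero => simp only [mul_zero, map_zero]
  | add y y' hy hy' => simp only [mul_add, map_add, hy, hy']
  | smul r y hy => simp only [mul_smul_comm, map_smul, hy]
  | monomial u => rw [monomial_mul, hΨ, hΨ, hΨ, hm]

end Unital

end StrongGrading

/-! ### Cuntz–Krieger maps are tight -/

section Domination

open InverseSemigroupWithZero

variable {S A : Type*} [InverseSemigroupWithZero S] [NonUnitalRing A] {t : S → A}

open Classical in
theorem Covers.image_conj {u : S} {Z : Finset (Idem S)} (hZ : Covers Z (src u)) :
    Covers (Z.image (conj u)) (ran u) := by
  intro y hy hy0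
  have hback : conj u (conj u⁻¹ y) = y := by rw [StrongGrading.conj_conj_inv, inf_eq_right.2 hy]
  have hle : conj u⁻¹ y ≤ src u := StrongGrading.ran_inv u ▸ StrongGrading.conj_le_ran u⁻¹ y
  obtain ⟨z, hz, h⟩ := hZ (conj u⁻¹ y) hle fun h =>
    hy0 (by rw [← hback, h, StrongGrading.conj_bot])
  refine ⟨_, Finset.mem_image_of_mem _ hz, fun h0 => h ?_⟩
  have hconj := congrArg (conj u⁻¹) h0
  rwa [StrongGrading.conj_inf, StrongGrading.conj_inv_conj, StrongGrading.conj_bot,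
    inf_comm (src u), inf_assoc, inf_eq_right.2 hle] at hconj

open Classical in
theorem IsDominated.of_image_conj (hm : ∀ x y, t (x * y) = t x * t y) {u : S}
    {Z : Finset (Idem S)} (h : IsDominated t (Z.image (conj u)) (ran u)) :
    IsDominated t Z (src u) := by
  intro e he
  have hconj (z : Idem S) (hz : z ∈ Z) : e * t u⁻¹ * t (conj u z).1 = 0 := by
    have hcomm : u⁻¹ * (conj u z).1 = z.1 * (src u).1 * u⁻¹ := by
      rw [idem_comm _ _ z.2 (src u).2]
      simp only [conj, src, mul_assoc]
    rw [mul_assoc, ← hm, hcomm, hm, hm, ← mul_assoc, ← mul_assoc, he z hz, zero_mul, zero_mul]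
  have hsrc : (src u).1 = u⁻¹ * (ran u).1 * u := by
    simp only [src, ran, ← mul_assoc, inv_mul_inv]
  rw [hsrc, hm, hm, ← mul_assoc, ← mul_assoc, h _ (Finset.forall_mem_image.2 hconj), zero_mul]

theorem IsDominated.mono {Z W : Finset (Idem S)} {x : Idem S} (h : IsDominated t Z x)
    (hZW : Z ⊆ W) : IsDominated t W x := fun e he => h e fun z hz => he z (hZW hz)

end Domination

namespace GenBoolDynSystem

open InverseSemigroupWithZero

variable {B L : Type*} [GeneralizedBooleanAlgebra B] (𝒟 : GenBoolDynSystem B L)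

theorem mem_Iw_nil (A : B) : A ∈ 𝒟.Iw [] := trivial

/-- The idempotent `(ω, A, ω)`. -/
noncomputable abbrev rootIdem (A : B) : Idem 𝒟.InvSgp := 𝒟.idem [] A (𝒟.mem_Iw_nil A)

/-- The idempotent `(a, θ_a(A), a)`, the part of `(ω, A, ω)` that begins with the letter `a`. -/
noncomputable abbrev branchIdem (a : L) (A : B) : Idem 𝒟.InvSgp :=
  𝒟.idem [a] (𝒟.θ a A) (𝒟.mem_Iw_singleton (𝒟.θ_mem_I a A))

variable {𝒟}

theorem idem_eq_bot_iff {α : List L} {A : B} {hA : A ∈ 𝒟.Iw α} :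
    𝒟.idem α A hA = ⊥ ↔ A = ⊥ := by
  refine ⟨fun h => ?_, fun h => Idem.ext (InvSgp.mk_of_eq_bot h)⟩
  by_contra hA0
  have h0 : InvSgp.mk α A α hA hA = 0 := congrArg Idem.val h
  rw [InvSgp.mk_of_ne hA0] at h0
  cases h0

theorem idem_congr {α : List L} {A C : B} (h : A = C) (hA : A ∈ 𝒟.Iw α) :
    𝒟.idem α A hA = 𝒟.idem α C (h ▸ hA) := by
  subst h; rfl

theorem rootIdem_bot : 𝒟.rootIdem ⊥ = ⊥ := idem_eq_bot_iff.2 rfl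

theorem exists_eq_idem (x : Idem 𝒟.InvSgp) : ∃ α A hA, x = 𝒟.idem α A hA := by
  rcases InvSgp.exists_of_idem x.2 with h | ⟨α, A, hA, h⟩
  · exact ⟨[], ⊥, 𝒟.mem_Iw_nil ⊥, (Idem.ext h).trans rootIdem_bot.symm⟩
  · exact ⟨α, A, hA, Idem.ext h⟩

theorem ran_mk {α β : List L} {A : B} (hα : A ∈ 𝒟.Iw α) (hβ : A ∈ 𝒟.Iw β) :
    ran (InvSgp.mk α A β hα hβ) = 𝒟.idem α A hα := Idem.ext <| by
  change InvSgp.mk α A β hα hβ * (InvSgp.mk α A β hα hβ)⁻¹ = InvSgp.mk α A α hα hα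
  rw [InvSgp.inv_mk, InvSgp.mk_mul_same]
  exact InvSgp.mk_congr rfl (inf_idem A) rfl

theorem idem_inf_idem {α : List L} {A C : B} (hA : A ∈ 𝒟.Iw α) (hC : C ∈ 𝒟.Iw α) :
    𝒟.idem α A hA ⊓ 𝒟.idem α C hC = 𝒟.idem α (A ⊓ C) (InvSgp.inf_mem_left hA _) :=
  Idem.ext (InvSgp.mk_mul_same _ _ _ _)

theorem idem_inf_rootIdem {α : List L} {A C : B} (hC : C ∈ 𝒟.Iw α) :
    𝒟.idem α C hC ⊓ 𝒟.rootIdem A = 𝒟.idem α (C ⊓ 𝒟.θw α A) (InvSgp.inf_mem_left hC _) :=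
  Idem.ext (InvSgp.mk_mul_right (γ := []) _ _ _ _)

theorem rootIdem_inf (A C : B) : 𝒟.rootIdem A ⊓ 𝒟.rootIdem C = 𝒟.rootIdem (A ⊓ C) :=
  idem_inf_idem _ _

theorem rootIdem_mono {A C : B} (h : A ≤ C) : 𝒟.rootIdem A ≤ 𝒟.rootIdem C := by
  rw [← inf_eq_left, rootIdem_inf, inf_eq_left.2 h]

theorem branchIdem_le (a : L) (A : B) : 𝒟.branchIdem a A ≤ 𝒟.rootIdem A := by
  rw [← inf_eq_left, idem_inf_rootIdem]
  exact idem_congr (inf_idem _) _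

theorem eq_of_idem_cons_inf_ne_bot {a b : L} {α β : List L} {A C : B} {hA : A ∈ 𝒟.Iw (a :: α)}
    {hC : C ∈ 𝒟.Iw (b :: β)} (h : 𝒟.idem (a :: α) A hA ⊓ 𝒟.idem (b :: β) C hC ≠ ⊥) : a = b := by
  by_contra hab
  refine h (Idem.ext (InvSgp.mk_mul_none _ _ _ _ ?_ ?_)) <;> rw [List.cons_prefix_cons]
  exacts [fun h => hab h.1, fun h => hab h.1.symm]

/-- The word `α` of a triple `(α, A, β)`; the empty word for zero. -/
def InvSgp.leftWord : 𝒟.InvSgp → List L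
  | .zero => []
  | .triple α _ _ _ _ _ => α

/-- The set `A` of a triple `(ω, A, β)`; the empty set for all other elements. -/
def InvSgp.rootPart : 𝒟.InvSgp → B
  | .triple [] A _ _ _ _ => A
  | _ => ⊥

theorem leftWord_idem {α : List L} {A : B} {hA : A ∈ 𝒟.Iw α} (h : 𝒟.idem α A hA ≠ ⊥) :
    (𝒟.idem α A hA).1.leftWord = α := by
  change (InvSgp.mk α A α hA hA).leftWord = α
  rw [InvSgp.mk_of_ne (mt idem_eq_bot_iff.2 h)]
  rfl

theorem length_leftWord_idem_le {α : List L} {A : B} (hA : A ∈ 𝒟.Iw α) :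
    (𝒟.idem α A hA).1.leftWord.length ≤ α.length := by
  by_cases h : 𝒟.idem α A hA = ⊥
  · rw [h]
    exact Nat.zero_le _
  · rw [leftWord_idem h]

theorem eq_rootIdem_of_leftWord_eq_nil {z : Idem 𝒟.InvSgp} (hz : z.1.leftWord = []) :
    z = 𝒟.rootIdem z.1.rootPart := by
  by_cases h : z = ⊥
  · subst h
    exact rootIdem_bot.symm
  obtain ⟨α, A, hA, rfl⟩ := exists_eq_idem z
  obtain rfl : α = [] := (leftWord_idem h).symm.trans hz
  have hval : (𝒟.idem [] A hA).1 = _ := InvSgp.mk_of_ne (mt idem_eq_bot_iff.2 h)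
  rw [hval]
  rfl

theorem rootPart_eq_bot_of_leftWord_ne_nil {x : 𝒟.InvSgp} (hx : x.leftWord ≠ []) :
    x.rootPart = ⊥ := by
  match x, hx with
  | .triple (_ :: _) .., _ => rfl

theorem exists_eq_idem_cons {z : Idem 𝒟.InvSgp} (hz : z.1.leftWord ≠ []) :
    ∃ a γ C hC, z = 𝒟.idem (a :: γ) C hC ∧ z.1.leftWord = a :: γ := by
  have hz0 : z ≠ ⊥ := by
    rintro rfl
    exact hz rfl
  obtain ⟨α, C, hC, rfl⟩ := exists_eq_idem z
  have hα := leftWord_idem hz0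
  obtain ⟨a, γ, rfl⟩ := List.exists_cons_of_ne_nil (hα ▸ hz)
  exact ⟨a, γ, C, hC, rfl, hα⟩

theorem head?_leftWord_of_inf_ne_bot {z y : Idem 𝒟.InvSgp} (hz : z.1.leftWord ≠ []) {a : L}
    {A : B} (hy : y ≤ 𝒟.branchIdem a A) (hzy : z ⊓ y ≠ ⊥) : z.1.leftWord.head? = some a := by
  obtain ⟨b, γ, C, hC, rfl, hw⟩ := exists_eq_idem_cons hz
  have hne : 𝒟.idem (b :: γ) C hC ⊓ 𝒟.branchIdem a A ≠ ⊥ := fun h =>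
    hzy (le_bot_iff.1 ((inf_le_inf_left _ hy).trans h.le))
  rw [hw, eq_of_idem_cons_inf_ne_bot hne, List.head?_cons]

theorem exists_θ_ne_bot_of_inf_rootIdem_ne_bot {z : Idem 𝒟.InvSgp} (hz : z.1.leftWord ≠ [])
    {A : B} (hzA : z ⊓ 𝒟.rootIdem A ≠ ⊥) : (𝒟.Δ A).Nonempty := by
  obtain ⟨a, γ, C, hC, rfl, -⟩ := exists_eq_idem_cons hz
  refine ⟨a, fun h => hzA ?_⟩
  rw [idem_inf_rootIdem, idem_eq_bot_iff, θw, h, θw_bot, inf_bot_eq]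

theorem mem_reg_of_covers {A : B} {Z : Finset (Idem 𝒟.InvSgp)} (hZ : Covers Z (𝒟.rootIdem A))
    (hne : ∀ z ∈ Z, z.1.leftWord ≠ []) : A ∈ 𝒟.Reg := by
  intro C hCA hC
  constructor
  · obtain ⟨z, hz, hzC⟩ := hZ _ (rootIdem_mono hCA) (mt idem_eq_bot_iff.1 hC)
    exact exists_θ_ne_bot_of_inf_rootIdem_ne_bot (hne z hz) hzC
  · let head (z : Idem 𝒟.InvSgp) : Option L := z.1.leftWord.head?
    have hfin : {a | some a ∈ head '' Z}.Finite :=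
      (Z.finite_toSet.image head).preimage (Option.some_injective L).injOn
    refine hfin.subset fun a ha => ?_
    obtain ⟨z, hz, hza⟩ := hZ _ ((branchIdem_le a C).trans (rootIdem_mono hCA))
      (mt idem_eq_bot_iff.1 ha)
    exact ⟨z, hz, head?_leftWord_of_inf_ne_bot (hne z hz) le_rfl hza⟩

open Classical in
theorem covers_branchIdem {A : B} {Z : Finset (Idem 𝒟.InvSgp)} (hZ : Covers Z (𝒟.rootIdem A))
    (hne : ∀ z ∈ Z, z.1.leftWord ≠ []) (a : L) :
    Covers (Z.filter fun z => z.1.leftWord.head? = some a) (𝒟.branchIdem a A) := by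
  intro y hy hy0
  obtain ⟨z, hz, hzy⟩ := hZ y (hy.trans (branchIdem_le a A)) hy0
  exact ⟨z, Finset.mem_filter.2 ⟨hz, head?_leftWord_of_inf_ne_bot (hne z hz) hy hzy⟩, hzy⟩

open Classical in
theorem covers_sdiff_sup_rootPart {A : B} {Z : Finset (Idem 𝒟.InvSgp)}
    (hZ : Covers Z (𝒟.rootIdem A)) :
    Covers (Z.filter fun z => z.1.leftWord ≠ [])
      (𝒟.rootIdem (A \ Z.sup fun z => z.1.rootPart)) := by
  intro y hy hy0
  obtain ⟨z, hz, hzy⟩ := hZ y (hy.trans (rootIdem_mono sdiff_le)) hy0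
  refine ⟨z, Finset.mem_filter.2 ⟨hz, fun hnil => hzy (le_bot_iff.1 ?_)⟩, hzy⟩
  have hle : z ≤ 𝒟.rootIdem (Z.sup fun z => z.1.rootPart) :=
    (eq_rootIdem_of_leftWord_eq_nil hnil).le.trans
      (rootIdem_mono (Finset.le_sup (f := fun z : Idem 𝒟.InvSgp => z.1.rootPart) hz))
  refine (inf_le_inf hle hy).trans ?_
  rw [rootIdem_inf, inf_sdiff_self_right, rootIdem_bot]

/-- The element `(ω, A, α)`. -/
noncomputable def coIsometry (α : List L) (A : B) (hA : A ∈ 𝒟.Iw α) : 𝒟.InvSgp :=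
  InvSgp.mk [] A α (𝒟.mem_Iw_nil A) hA

theorem ran_coIsometry {α : List L} {A : B} (hA : A ∈ 𝒟.Iw α) :
    ran (coIsometry α A hA) = 𝒟.rootIdem A := ran_mk _ _

theorem src_coIsometry {α : List L} {A : B} (hA : A ∈ 𝒟.Iw α) :
    src (coIsometry α A hA) = 𝒟.idem α A hA := by
  rw [← StrongGrading.ran_inv, coIsometry, InvSgp.inv_mk, ran_mk]

theorem conj_coIsometry_idem_cons {a : L} {γ : List L} {A C : B} (hA : A ∈ 𝒟.Iw [a])
    (hC : C ∈ 𝒟.Iw (a :: γ)) :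
    conj (coIsometry [a] A hA) (𝒟.idem (a :: γ) C hC) =
      𝒟.idem γ (𝒟.θw γ A ⊓ C ⊓ 𝒟.θw γ A)
        (InvSgp.inf_mem_right (𝒟.Iw_append (𝒟.mem_Iw_nil A) γ) _) := Idem.ext <| by
  change InvSgp.mk [] A [a] (𝒟.mem_Iw_nil A) hA * InvSgp.mk ([a] ++ γ) C (a :: γ) hC hC *
    (InvSgp.mk [] A [a] (𝒟.mem_Iw_nil A) hA)⁻¹ = InvSgp.mk _ _ _ _ _
  rw [InvSgp.inv_mk, InvSgp.mk_mul_left]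
  exact InvSgp.mk_mul_right (γ := [a]) _ _ _ _

theorem length_leftWord_conj_coIsometry_lt {a : L} {A : B} (hA : A ∈ 𝒟.Iw [a])
    {z : Idem 𝒟.InvSgp} (hz : z.1.leftWord.head? = some a) :
    (conj (coIsometry [a] A hA) z).1.leftWord.length < z.1.leftWord.length := by
  have hne : z.1.leftWord ≠ [] := by
    rintro h
    simp [h] at hz
  obtain ⟨b, γ, C, hC, rfl, hw⟩ := exists_eq_idem_cons hne
  rw [hw, List.head?_cons, Option.some_inj] at hz
  subst hz
  rw [hw, conj_coIsometry_idem_cons]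
  exact Nat.lt_succ_of_le (length_leftWord_idem_le _)

/-- A multiplicative map on the inverse semigroup that satisfies the relations of the Leavitt
algebra for joins and for regular elements. -/
structure IsCuntzKrieger {X : Type*} [NonUnitalRing X] (t : 𝒟.InvSgp → X) : Prop where
  map_mul : ∀ x y, t (x * y) = t x * t y
  map_zero : t 0 = 0
  map_sup : ∀ A C : B, t (𝒟.rootIdem (A ⊔ C)).1 =
    t (𝒟.rootIdem A).1 + t (𝒟.rootIdem C).1 - t (𝒟.rootIdem (A ⊓ C)).1
  map_reg : ∀ (A : B) (hA : A ∈ 𝒟.Reg), t (𝒟.rootIdem A).1 =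
    ∑ a ∈ (𝒟.Δ_finite_of_reg hA).toFinset, t (𝒟.branchIdem a A).1

namespace IsCuntzKrieger

variable {X : Type*} [NonUnitalRing X] {t : 𝒟.InvSgp → X} (ht : IsCuntzKrieger t)
include ht

theorem map_inf (x y : Idem 𝒟.InvSgp) : t (x ⊓ y).1 = t x.1 * t y.1 := ht.map_mul _ _

theorem map_rootIdem_bot : t (𝒟.rootIdem ⊥).1 = 0 := by
  rw [rootIdem_bot, Idem.bot_val, ht.map_zero]

theorem mul_map_rootIdem_sup {e : X} {A C : B} (hA : e * t (𝒟.rootIdem A).1 = 0)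
    (hC : e * t (𝒟.rootIdem C).1 = 0) : e * t (𝒟.rootIdem (A ⊔ C)).1 = 0 := by
  rw [ht.map_sup, ← rootIdem_inf, ht.map_inf, mul_sub, mul_add, ← mul_assoc, hA, hC, zero_mul,
    add_zero, sub_zero]

theorem mul_map_rootIdem_sup_rootPart {Z : Finset (Idem 𝒟.InvSgp)} {e : X}
    (he : ∀ z ∈ Z, e * t z.1 = 0) :
    e * t (𝒟.rootIdem (Z.sup fun z => z.1.rootPart)).1 = 0 := by
  refine Finset.sup_induction (p := fun A => e * t (𝒟.rootIdem A).1 = 0) ?_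
    (fun A hA C hC => ht.mul_map_rootIdem_sup hA hC) fun z hz => ?_
  · rw [ht.map_rootIdem_bot, mul_zero]
  · by_cases hnil : z.1.leftWord = []
    · rw [← eq_rootIdem_of_leftWord_eq_nil hnil, he z hz]
    · rw [rootPart_eq_bot_of_leftWord_ne_nil hnil, ht.map_rootIdem_bot, mul_zero]

theorem mul_map_rootIdem_of_sdiff {e : X} {A C : B} (hC : e * t (𝒟.rootIdem C).1 = 0)
    (hAC : e * t (𝒟.rootIdem (A \ C)).1 = 0) : e * t (𝒟.rootIdem A).1 = 0 := by
  have hsup := ht.mul_map_rootIdem_sup hAC hC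
  rw [sdiff_sup_self] at hsup
  have hle : 𝒟.rootIdem (A ⊔ C) ⊓ 𝒟.rootIdem A = 𝒟.rootIdem A := by
    rw [rootIdem_inf, inf_eq_right.2 le_sup_left]
  rw [← hle, ht.map_inf, ← mul_assoc, hsup, zero_mul]

theorem isDominated_rootIdem_of_branchIdem {A : B} (hA : A ∈ 𝒟.Reg) {Z : Finset (Idem 𝒟.InvSgp)}
    (h : ∀ a, IsDominated t Z (𝒟.branchIdem a A)) : IsDominated t Z (𝒟.rootIdem A) := by
  intro e he
  rw [ht.map_reg A hA, Finset.mul_sum]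
  exact Finset.sum_eq_zero fun a _ => h a e he

open Classical in
theorem isDominated_branchIdem {a : L} {A : B} {Z : Finset (Idem 𝒟.InvSgp)}
    (h : IsDominated t (Z.image
      (conj (coIsometry [a] (𝒟.θ a A) (𝒟.mem_Iw_singleton (𝒟.θ_mem_I a A)))))
      (𝒟.rootIdem (𝒟.θ a A))) : IsDominated t Z (𝒟.branchIdem a A) := by
  rw [branchIdem, ← src_coIsometry]
  refine .of_image_conj ht.map_mul ?_
  rwa [ran_coIsometry]

/-- Cut away from `A` the root part `A₀` of `Z`. What remains is covered by elements with nonempty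
words, hence regular, and the regular relation reduces it to its branches, where the words of the
cover become shorter. -/
theorem isDominated_rootIdem {n : ℕ} {A : B} {Z : Finset (Idem 𝒟.InvSgp)}
    (hn : ∀ z ∈ Z, z.1.leftWord.length < n) (hZ : Covers Z (𝒟.rootIdem A)) :
    IsDominated t Z (𝒟.rootIdem A) := by
  classical
  induction n generalizing A Z with
  | zero =>
    intro e _
    by_cases hA : A = ⊥
    · rw [hA, ht.map_rootIdem_bot, mul_zero]
    · obtain ⟨z, hz, -⟩ := hZ _ le_rfl (mt idem_eq_bot_iff.1 hA)
      exact absurd (hn z hz) (Nat.not_lt_zero _)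
  | succ n ih =>
    have hcov := covers_sdiff_sup_rootPart hZ
    set A₀ := Z.sup fun z => z.1.rootPart
    set Z₁ := Z.filter fun z => z.1.leftWord ≠ []
    have hne : ∀ z ∈ Z₁, z.1.leftWord ≠ [] := fun z hz => (Finset.mem_filter.1 hz).2
    suffices hdom : IsDominated t Z₁ (𝒟.rootIdem (A \ A₀)) from fun e he =>
      ht.mul_map_rootIdem_of_sdiff (ht.mul_map_rootIdem_sup_rootPart he)
        (hdom.mono (Finset.filter_subset _ _) e he)
    refine ht.isDominated_rootIdem_of_branchIdem (mem_reg_of_covers hcov hne) fun a => ?_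
    refine IsDominated.mono (ht.isDominated_branchIdem (ih (Finset.forall_mem_image.2 ?_) ?_))
      (Finset.filter_subset (fun z => z.1.leftWord.head? = some a) Z₁)
    · intro z hz
      obtain ⟨hz₁, hza⟩ := Finset.mem_filter.1 hz
      exact (length_leftWord_conj_coIsometry_lt _ hza).trans_le
        (Nat.le_of_lt_succ (hn z (Finset.mem_filter.1 hz₁).1))
    · rw [← ran_coIsometry (𝒟.mem_Iw_singleton (𝒟.θ_mem_I a (A \ A₀)))]
      refine Covers.image_conj ?_
      rw [src_coIsometry]
      exact covers_branchIdem hcov hne a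

theorem isTight : IsTight t := by
  classical
  intro x Z hZ
  obtain ⟨α, A, hA, rfl⟩ := exists_eq_idem x
  rw [← src_coIsometry] at hZ ⊢
  have hcov := hZ.image_conj
  refine .of_image_conj ht.map_mul ?_
  rw [ran_coIsometry] at hcov ⊢
  exact ht.isDominated_rootIdem
    (fun z hz => Nat.lt_succ_of_le (Finset.le_sup (f := fun z => z.1.leftWord.length) hz)) hcov

end IsCuntzKrieger

end GenBoolDynSystem

/-! ### The Leavitt algebra -/

namespace GenBoolDynSystem

variable {B L : Type*} [GeneralizedBooleanAlgebra B] {𝒟 : GenBoolDynSystem B L}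
  {R : Type*} [CommRing R]
  {X : Type*} [NonUnitalRing X] [Module R X]

namespace LeavittAlgebra

variable (𝒟 R) in
/-- The quotient map from the free algebra, as a homomorphism. -/
noncomputable def mkHom : 𝒟.FreeAlg R →ₙₐ[R] 𝒟.LeavittAlgebra R where
  toFun := mk 𝒟 R
  map_smul' _ _ := rfl
  map_zero' := rfl
  map_add' _ _ := rfl
  map_mul' _ _ := rfl

theorem mkHom_surjective : Function.Surjective (mkHom 𝒟 R) := Quotient.mk_surjective

theorem mkHom_eq_of_rel {x y : 𝒟.FreeAlg R} (h : 𝒟.Rel R x y) : mkHom 𝒟 R x = mkHom 𝒟 R y :=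
  Quotient.sound (RingConGen.Rel.of _ _ ⟨1, x, y, h, (one_smul R x).symm, (one_smul R y).symm⟩)

theorem hom_ext {F F' : 𝒟.LeavittAlgebra R →ₙₐ[R] X}
    (h : ∀ x, F (mk 𝒟 R (ι R x)) = F' (mk 𝒟 R (ι R x))) : F = F' := by
  have hfree : F.comp (mkHom 𝒟 R) = F'.comp (mkHom 𝒟 R) :=
    MonoidAlgebra.nonUnitalAlgHom_ext' R (FreeSemigroup.hom_ext (funext h))
  ext x
  obtain ⟨x, rfl⟩ := mkHom_surjective x
  exact congrArg (· x) hfree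

variable [IsScalarTower R X X] [SMulCommClass R X X]

variable (R) in
/-- The homomorphism from the free algebra with prescribed values on the generators. -/
noncomputable def freeLift (f : 𝒟.Gen → X) : 𝒟.FreeAlg R →ₙₐ[R] X :=
  MonoidAlgebra.liftMagma R (FreeSemigroup.lift f)

theorem freeLift_ι (f : 𝒟.Gen → X) (x : 𝒟.Gen) : freeLift R f (ι R x) = f x := by
  simp [freeLift, ι, MonoidAlgebra.liftMagma_apply_apply]

theorem freeLift_eq_of_con {f : 𝒟.Gen → X}
    (hf : ∀ x y, 𝒟.Rel R x y → freeLift R f x = freeLift R f y) :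
    𝒟.con R ≤ (⊥ : RingCon X).comap (freeLift R f) := by
  refine RingCon.ringConGen_le.2 ?_
  rintro _ _ ⟨r, x, y, h, rfl, rfl⟩
  change freeLift R f (r • x) = freeLift R f (r • y)
  rw [map_smul, map_smul, hf x y h]

/-- The homomorphism from the Leavitt algebra with prescribed values on the generators that
satisfy the relations. -/
noncomputable def lift (f : 𝒟.Gen → X)
    (hf : ∀ x y, 𝒟.Rel R x y → freeLift R f x = freeLift R f y) :
    𝒟.LeavittAlgebra R →ₙₐ[R] X where
  toFun := Quotient.lift (freeLift R f) (freeLift_eq_of_con hf)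
  map_smul' r x := by
    obtain ⟨x, rfl⟩ := mkHom_surjective x
    exact map_smul (freeLift R f) r x
  map_zero' := map_zero (freeLift R f)
  map_add' x y := by
    obtain ⟨x, rfl⟩ := mkHom_surjective x
    obtain ⟨y, rfl⟩ := mkHom_surjective y
    exact map_add (freeLift R f) x y
  map_mul' x y := by
    obtain ⟨x, rfl⟩ := mkHom_surjective x
    obtain ⟨y, rfl⟩ := mkHom_surjective y
    exact map_mul (freeLift R f) x y

theorem lift_mk_ι (f : 𝒟.Gen → X)
    (hf : ∀ x y, 𝒟.Rel R x y → freeLift R f x = freeLift R f y) (x : 𝒟.Gen) :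
    lift f hf (mk 𝒟 R (ι R x)) = f x := freeLift_ι f x

theorem p_bot : 𝒟.p R ⊥ = 0 := mkHom_eq_of_rel .p_bot

theorem p_mul_p (A C : B) : 𝒟.p R A * 𝒟.p R C = 𝒟.p R (A ⊓ C) :=
  (mkHom_eq_of_rel (.p_inf A C)).symm

theorem p_sup (A C : B) : 𝒟.p R (A ⊔ C) = 𝒟.p R A + 𝒟.p R C - 𝒟.p R (A ⊓ C) :=
  (mkHom_eq_of_rel (.p_sup A C)).trans (map_sub (mkHom 𝒟 R) _ _)

theorem p_mul_s {a : L} (A : B) {C : B} (hC : C ∈ 𝒟.I a) :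
    𝒟.p R A * 𝒟.s R a C hC = 𝒟.s R a C hC * 𝒟.p R (𝒟.θ a A) :=
  mkHom_eq_of_rel (.p_s A a C hC)

theorem sStar_mul_p {a : L} {C : B} (hC : C ∈ 𝒟.I a) (A : B) :
    𝒟.sStar R a C hC * 𝒟.p R A = 𝒟.p R (𝒟.θ a A) * 𝒟.sStar R a C hC :=
  mkHom_eq_of_rel (.sStar_p A a C hC)

theorem sStar_mul_s {a : L} {C C' : B} (hC : C ∈ 𝒟.I a) (hC' : C' ∈ 𝒟.I a) :
    𝒟.sStar R a C hC * 𝒟.s R a C' hC' = 𝒟.p R (C ⊓ C') :=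
  mkHom_eq_of_rel (.sStar_s_same a C C' hC hC')

theorem sStar_mul_s_of_ne {a b : L} (hab : a ≠ b) {C C' : B} (hC : C ∈ 𝒟.I a)
    (hC' : C' ∈ 𝒟.I b) : 𝒟.sStar R a C hC * 𝒟.s R b C' hC' = 0 :=
  mkHom_eq_of_rel (.sStar_s_ne a b hab C C' hC hC')

theorem s_mul_p {a : L} {C : B} (hC : C ∈ 𝒟.I a) (A : B) :
    𝒟.s R a C hC * 𝒟.p R A = 𝒟.s R a (C ⊓ A) (𝒟.inf_mem_I hC A) :=
  mkHom_eq_of_rel (.s_p a C hC A)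

theorem p_mul_sStar {a : L} (A : B) {C : B} (hC : C ∈ 𝒟.I a) :
    𝒟.p R A * 𝒟.sStar R a C hC = 𝒟.sStar R a (C ⊓ A) (𝒟.inf_mem_I hC A) :=
  mkHom_eq_of_rel (.p_sStar a C hC A)

theorem p_reg {A : B} (hA : A ∈ 𝒟.Reg) :
    𝒟.p R A = ∑ a ∈ (𝒟.Δ_finite_of_reg hA).toFinset,
      𝒟.s R a (𝒟.θ a A) (𝒟.θ_mem_I a A) * 𝒟.sStar R a (𝒟.θ a A) (𝒟.θ_mem_I a A) :=
  (mkHom_eq_of_rel (.p_reg A hA)).trans (map_sum (mkHom 𝒟 R) _ _)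

theorem s_congr {a : L} {C C' : B} (h : C = C') (hC : C ∈ 𝒟.I a) :
    𝒟.s R a C hC = 𝒟.s R a C' (h ▸ hC) := by
  subst h; rfl

end LeavittAlgebra

/-- The involution of the generators. -/
def Gen.adjoint : 𝒟.Gen → 𝒟.Gen
  | .p A => .p A
  | .s a A hA => .sStar a A hA
  | .sStar a A hA => .s a A hA

theorem Gen.adjoint_adjoint (x : 𝒟.Gen) : x.adjoint.adjoint = x := by
  cases x <;> rfl

namespace LeavittAlgebra

open MulOpposite

theorem adjoint_rel (x y : 𝒟.FreeAlg R) (h : 𝒟.Rel R x y) :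
    freeLift R (fun x : 𝒟.Gen => op (mk 𝒟 R (ι R x.adjoint))) x =
      freeLift R (fun x : 𝒟.Gen => op (mk 𝒟 R (ι R x.adjoint))) y := by
  cases h with
  | p_bot =>
    simp only [freeLift_ι, map_zero]
    exact congrArg op p_bot
  | p_inf A C =>
    simp only [freeLift_ι, map_mul]
    exact congrArg op (inf_comm A C ▸ (p_mul_p C A).symm)
  | p_sup A C =>
    simp only [freeLift_ι, map_add, map_sub]
    exact congrArg op (p_sup A C)
  | p_s A a C hC =>
    simp only [freeLift_ι, map_mul]
    exact congrArg op (sStar_mul_p hC A)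
  | sStar_p A a C hC =>
    simp only [freeLift_ι, map_mul]
    exact congrArg op (p_mul_s A hC)
  | sStar_s_same a C C' hC hC' =>
    simp only [freeLift_ι, map_mul]
    exact congrArg op (inf_comm C C' ▸ sStar_mul_s hC' hC)
  | sStar_s_ne a b hab C C' hC hC' =>
    simp only [freeLift_ι, map_mul, map_zero]
    exact congrArg op (sStar_mul_s_of_ne hab.symm hC' hC)
  | s_p a C hC A =>
    simp only [freeLift_ι, map_mul]
    exact congrArg op (p_mul_sStar A hC)
  | p_sStar a C hC A =>
    simp only [freeLift_ι, map_mul]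
    exact congrArg op (s_mul_p hC A)
  | p_reg A hA =>
    simp only [freeLift_ι, map_mul, map_sum]
    exact (congrArg op (p_reg hA)).trans (Finset.op_sum _ _)

/-- The anti-automorphism that interchanges `s_{a,A}` and `s*_{a,A}`. -/
noncomputable def adjointHom : 𝒟.LeavittAlgebra R →ₙₐ[R] (𝒟.LeavittAlgebra R)ᵐᵒᵖ :=
  lift _ adjoint_rel

theorem adjointHom_mk_ι (x : 𝒟.Gen) :
    adjointHom (mk 𝒟 R (ι R x)) = op (mk 𝒟 R (ι R x.adjoint)) := lift_mk_ι _ _ x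

theorem adjointHom_adjointHom (x : 𝒟.LeavittAlgebra R) :
    (adjointHom (adjointHom x).unop).unop = x := by
  let F : 𝒟.LeavittAlgebra R →ₙₐ[R] 𝒟.LeavittAlgebra R :=
    { toFun := fun x => (adjointHom (adjointHom x).unop).unop
      map_smul' := fun r x => by simp only [map_smul, unop_smul, MonoidHom.id_apply]
      map_zero' := by simp only [map_zero, unop_zero]
      map_add' := fun x y => by simp only [map_add, unop_add]
      map_mul' := fun x y => by simp only [map_mul, unop_mul] }
  have hF : F = NonUnitalAlgHom.id R _ := hom_ext fun x => by
    change (adjointHom (adjointHom (mk 𝒟 R (ι R x))).unop).unop = mk 𝒟 R (ι R x)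
    simp only [adjointHom_mk_ι, unop_op, Gen.adjoint_adjoint]
  exact congrArg (· x) hF

noncomputable instance : StarRing (𝒟.LeavittAlgebra R) where
  star x := (adjointHom x).unop
  star_involutive := adjointHom_adjointHom
  star_mul x y := by simp only [map_mul, unop_mul]
  star_add x y := by simp only [map_add, unop_add]

theorem star_mk_ι (x : 𝒟.Gen) : star (mk 𝒟 R (ι R x)) = mk 𝒟 R (ι R x.adjoint) :=
  congrArg unop (adjointHom_mk_ι x)

theorem star_p (A : B) : star (𝒟.p R A) = 𝒟.p R A := star_mk_ι (.p A)

theorem star_s {a : L} {A : B} (hA : A ∈ 𝒟.I a) : star (𝒟.s R a A hA) = 𝒟.sStar R a A hA :=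
  star_mk_ι (.s a A hA)

end LeavittAlgebra

end GenBoolDynSystem

namespace GenBoolDynSystem

variable {B L : Type*} [GeneralizedBooleanAlgebra B] {𝒟 : GenBoolDynSystem B L}

theorem mem_Iw_of_le_θw {α : List L} {A C : B} (h : A ≤ 𝒟.θw α C) : A ∈ 𝒟.Iw α :=
  𝒟.Iw_mono h (𝒟.Iw_append (𝒟.mem_Iw_nil C) α)

theorem mem_Iw_of_mem_append {α γ : List L} {C : B} (hC : C ∈ 𝒟.Iw (α ++ γ)) : C ∈ 𝒟.Iw γ := by
  induction α with
  | nil => exact hC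
  | cons a α ih =>
    obtain ⟨D, -, hCD⟩ := hC
    exact ih (mem_Iw_of_le_θw hCD)

namespace LeavittAlgebra

variable {R : Type*} [CommRing R]

variable (𝒟 R) in
open Classical in
/-- The element `s_{α,A}` for a word `α` and `A ∈ 𝓘_α`: it is `p_A` for the empty word, and
`s_{aα,A} = s_{a,C} s_{α,A}` for any `C ∈ 𝓘_a` with `A ≤ θ_α(C)`. It is zero if `A ∉ 𝓘_α`. -/
noncomputable def sw : List L → B → 𝒟.LeavittAlgebra R
  | [], A => 𝒟.p R A
  | a :: α, A =>
    if h : ∃ C ∈ 𝒟.I a, A ≤ 𝒟.θw α C then 𝒟.s R a h.choose h.choose_spec.1 * sw α A else 0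

theorem p_mul_sw (A : B) (α : List L) (C : B) :
    𝒟.p R A * sw 𝒟 R α C = sw 𝒟 R α C * 𝒟.p R (𝒟.θw α A) := by
  induction α generalizing A with
  | nil => exact (p_mul_p A C).trans (inf_comm A C ▸ (p_mul_p C A).symm)
  | cons a α ih =>
    rw [sw]
    split_ifs with h
    · rw [← mul_assoc, p_mul_s, mul_assoc, ih, ← mul_assoc, θw]
    · rw [mul_zero, zero_mul]

theorem p_mul_sw_of_le {A : B} {α : List L} {C : B} (h : C ≤ 𝒟.θw α A) :
    𝒟.p R A * sw 𝒟 R α C = sw 𝒟 R α C := by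
  induction α generalizing A with
  | nil => exact (p_mul_p A C).trans (congrArg _ (inf_eq_right.2 h))
  | cons a α ih =>
    rw [sw]
    split_ifs
    · rw [← mul_assoc, p_mul_s, mul_assoc, ih h]
    · rw [mul_zero]

theorem sw_cons {a : L} {α : List L} {A C : B} (hC : C ∈ 𝒟.I a) (hAC : A ≤ 𝒟.θw α C) :
    sw 𝒟 R (a :: α) A = 𝒟.s R a C hC * sw 𝒟 R α A := by
  have hinf {D D' : B} (hD : D ∈ 𝒟.I a) (hA : A ≤ 𝒟.θw α D') :
      𝒟.s R a D hD * sw 𝒟 R α A = 𝒟.s R a (D ⊓ D') (𝒟.inf_mem_I hD D') * sw 𝒟 R α A := by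
    rw [← s_mul_p, mul_assoc, p_mul_sw_of_le hA]
  have h : ∃ C ∈ 𝒟.I a, A ≤ 𝒟.θw α C := ⟨C, hC, hAC⟩
  rw [sw, dif_pos h, hinf _ hAC, hinf hC h.choose_spec.2]
  exact congrArg (· * _) (s_congr (inf_comm _ _) _)

theorem sw_mul_p {α : List L} {A : B} (hA : A ∈ 𝒟.Iw α) (C : B) :
    sw 𝒟 R α A * 𝒟.p R C = sw 𝒟 R α (A ⊓ C) := by
  induction α with
  | nil => exact p_mul_p _ _
  | cons a α ih =>
    obtain ⟨D, hD, hAD⟩ := hA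
    rw [sw_cons hD hAD, mul_assoc, ih (mem_Iw_of_le_θw hAD), sw_cons hD (inf_le_left.trans hAD)]

theorem sw_singleton {a : L} {A : B} (hA : A ∈ 𝒟.I a) : sw 𝒟 R [a] A = 𝒟.s R a A hA := by
  rw [sw_cons (α := []) (A := A) hA le_rfl, sw, s_mul_p]
  exact s_congr (inf_idem A) _

theorem sw_bot (α : List L) : sw 𝒟 R α ⊥ = 0 := by
  rw [← inf_idem ⊥, ← sw_mul_p (mem_Iw_of_le_θw (C := ⊥) bot_le), p_bot, mul_zero]

theorem sw_mul_sw {α γ : List L} {A C : B} (hA : A ∈ 𝒟.Iw α) (hC : C ≤ 𝒟.θw γ A) :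
    sw 𝒟 R α A * sw 𝒟 R γ C = sw 𝒟 R (α ++ γ) C := by
  induction α with
  | nil => exact p_mul_sw_of_le hC
  | cons a α ih =>
    obtain ⟨D, hD, hAD⟩ := hA
    have hCD : C ≤ 𝒟.θw (α ++ γ) D := by
      rw [θw_append]
      exact hC.trans (𝒟.θw_mono γ hAD)
    rw [sw_cons hD hAD, mul_assoc, ih (mem_Iw_of_le_θw hAD), List.cons_append, sw_cons hD hCD]

theorem star_sw_cons_mul_sw_cons {a : L} {α γ : List L} {A C : B} (hA : A ∈ 𝒟.Iw (a :: α))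
    (hC : C ∈ 𝒟.Iw (a :: γ)) :
    star (sw 𝒟 R (a :: α) A) * sw 𝒟 R (a :: γ) C = star (sw 𝒟 R α A) * sw 𝒟 R γ C := by
  obtain ⟨D, hD, hAD⟩ := hA
  obtain ⟨D', hD', hCD⟩ := hC
  calc star (sw 𝒟 R (a :: α) A) * sw 𝒟 R (a :: γ) C
      = star (sw 𝒟 R α A) * (𝒟.sStar R a D hD * 𝒟.s R a D' hD') * sw 𝒟 R γ C := by
        simp only [sw_cons hD hAD, sw_cons hD' hCD, star_mul, star_s, mul_assoc]
    _ = star (𝒟.p R D * sw 𝒟 R α A) * (𝒟.p R D' * sw 𝒟 R γ C) := by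
        simp only [sStar_mul_s, ← p_mul_p, star_mul, star_p, mul_assoc]
    _ = star (sw 𝒟 R α A) * sw 𝒟 R γ C := by rw [p_mul_sw_of_le hAD, p_mul_sw_of_le hCD]

theorem star_sw_cons_mul_sw_cons_of_ne {a b : L} (hab : a ≠ b) {α γ : List L} {A C : B}
    (hA : A ∈ 𝒟.Iw (a :: α)) (hC : C ∈ 𝒟.Iw (b :: γ)) :
    star (sw 𝒟 R (a :: α) A) * sw 𝒟 R (b :: γ) C = 0 := by
  obtain ⟨D, hD, hAD⟩ := hA
  obtain ⟨D', hD', hCD⟩ := hC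
  rw [sw_cons hD hAD, sw_cons hD' hCD, star_mul, star_s, mul_assoc,
    ← mul_assoc (𝒟.sStar R a D hD), sStar_mul_s_of_ne hab, zero_mul, mul_zero]

theorem star_sw_mul_sw_append {α γ : List L} {A C : B} (hA : A ∈ 𝒟.Iw α)
    (hC : C ∈ 𝒟.Iw (α ++ γ)) :
    star (sw 𝒟 R α A) * sw 𝒟 R (α ++ γ) C = 𝒟.p R A * sw 𝒟 R γ C := by
  induction α with
  | nil => rw [sw, star_p, List.nil_append]
  | cons a α ih =>
    rw [List.cons_append, star_sw_cons_mul_sw_cons (γ := α ++ γ) hA hC]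
    exact ih (mem_Iw_of_mem_append (α := [a]) hA) (mem_Iw_of_mem_append (α := [a]) hC)

theorem star_sw_mul_sw_of_not_prefix {α γ : List L} {A C : B} (hA : A ∈ 𝒟.Iw α)
    (hC : C ∈ 𝒟.Iw γ) (hαγ : ¬ α <+: γ) (hγα : ¬ γ <+: α) :
    star (sw 𝒟 R α A) * sw 𝒟 R γ C = 0 := by
  induction α generalizing γ with
  | nil => exact absurd List.nil_prefix hαγ
  | cons a α ih =>
    obtain _ | ⟨b, γ⟩ := γ
    · exact absurd List.nil_prefix hγα
    by_cases hab : a = b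
    · subst hab
      rw [star_sw_cons_mul_sw_cons hA hC]
      rw [List.cons_prefix_cons] at hαγ hγα
      exact ih (mem_Iw_of_mem_append (α := [a]) hA) (mem_Iw_of_mem_append (α := [a]) hC)
        (fun h => hαγ ⟨rfl, h⟩) fun h => hγα ⟨rfl, h⟩
    · exact star_sw_cons_mul_sw_cons_of_ne hab hA hC

theorem sw_mul_star_sw_of_le {α β : List L} {A C : B} (hA : A ∈ 𝒟.Iw α) (hC : C ∈ 𝒟.Iw β)
    (h : A ≤ C) : sw 𝒟 R α A * star (sw 𝒟 R β C) = sw 𝒟 R α A * star (sw 𝒟 R β A) := by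
  have hα : sw 𝒟 R α A = sw 𝒟 R α A * 𝒟.p R A := by rw [sw_mul_p hA, inf_idem]
  rw [hα, mul_assoc, mul_assoc, ← star_p, ← star_mul, ← star_mul, sw_mul_p hC,
    sw_mul_p (𝒟.Iw_mono h hC), inf_idem, inf_eq_right.2 h]

variable (R) in
/-- The element `s_{α,A} s*_{β,A}` for a triple `(α, A, β)`. -/
noncomputable def rep : 𝒟.InvSgp → 𝒟.LeavittAlgebra R
  | .zero => 0
  | .triple α A β _ _ _ => sw 𝒟 R α A * star (sw 𝒟 R β A)

theorem rep_zero : rep R (0 : 𝒟.InvSgp) = 0 := rfl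

theorem rep_mk {α β : List L} {A : B} (hα : A ∈ 𝒟.Iw α) (hβ : A ∈ 𝒟.Iw β) :
    rep R (InvSgp.mk α A β hα hβ) = sw 𝒟 R α A * star (sw 𝒟 R β A) := by
  by_cases h : A = ⊥
  · subst h
    rw [InvSgp.mk_bot, rep_zero, sw_bot, zero_mul]
  · rw [InvSgp.mk_of_ne h]
    rfl

theorem rep_inv (x : 𝒟.InvSgp) : rep R x⁻¹ = star (rep R x) := by
  obtain rfl | ⟨α, A, β, hα, hβ, rfl⟩ := InvSgp.exists_mk x
  · exact (star_zero _).symm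
  · rw [InvSgp.inv_mk, rep_mk, rep_mk, star_mul, star_star]

theorem rep_mul_rep_append {α β γ δ : List L} {A C : B} (hα : A ∈ 𝒟.Iw α) (hβ : A ∈ 𝒟.Iw β)
    (hγ : C ∈ 𝒟.Iw (β ++ γ)) (hδ : C ∈ 𝒟.Iw δ) :
    rep R (InvSgp.mk α A β hα hβ * InvSgp.mk (β ++ γ) C δ hγ hδ) =
      rep R (InvSgp.mk α A β hα hβ) * rep R (InvSgp.mk (β ++ γ) C δ hγ hδ) := by
  have hC : C ∈ 𝒟.Iw γ := mem_Iw_of_mem_append hγ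
  rw [InvSgp.mk_mul_left]
  simp only [rep_mk]
  symm
  calc sw 𝒟 R α A * star (sw 𝒟 R β A) * (sw 𝒟 R (β ++ γ) C * star (sw 𝒟 R δ C))
      = sw 𝒟 R α A * (star (sw 𝒟 R β A) * sw 𝒟 R (β ++ γ) C) * star (sw 𝒟 R δ C) := by
        simp only [mul_assoc]
    _ = sw 𝒟 R α A * sw 𝒟 R γ (𝒟.θw γ A ⊓ C) * star (sw 𝒟 R δ C) := by
        rw [star_sw_mul_sw_append hβ hγ, p_mul_sw, sw_mul_p hC, inf_comm]
    _ = sw 𝒟 R (α ++ γ) (𝒟.θw γ A ⊓ C) * star (sw 𝒟 R δ (𝒟.θw γ A ⊓ C)) := by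
        rw [sw_mul_sw hα inf_le_left, sw_mul_star_sw_of_le
          (InvSgp.inf_mem_left (𝒟.Iw_append hα γ) C) hδ inf_le_right]

theorem rep_mul (x y : 𝒟.InvSgp) : rep R (x * y) = rep R x * rep R y := by
  obtain rfl | ⟨α, A, β, hα, hβ, rfl⟩ := InvSgp.exists_mk x
  · rw [zero_mul, rep_zero, zero_mul]
  obtain rfl | ⟨γ, C, δ, hγ, hδ, rfl⟩ := InvSgp.exists_mk y
  · rw [mul_zero, rep_zero, mul_zero]
  obtain ⟨γ, rfl⟩ | ⟨β, rfl⟩ | ⟨hβγ, hγβ⟩ := InvSgp.prefix_cases β γ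
  · exact rep_mul_rep_append hα hβ hγ hδ
  · apply star_injective
    rw [star_mul, ← rep_inv, ← rep_inv, ← rep_inv, InverseSemigroupWithZero.mul_inv_rev',
      InvSgp.inv_mk, InvSgp.inv_mk]
    exact rep_mul_rep_append hδ hγ hβ hα
  · rw [InvSgp.mk_mul_none _ _ _ _ hβγ hγβ, rep_zero, rep_mk, rep_mk, mul_assoc,
      ← mul_assoc (star _), star_sw_mul_sw_of_not_prefix hβ hγ hβγ hγβ, zero_mul, mul_zero]

end LeavittAlgebra

/-- The element of the inverse semigroup that corresponds to a generator of the Leavitt algebra. -/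
noncomputable def Gen.toInvSgp : 𝒟.Gen → 𝒟.InvSgp
  | .p A => InvSgp.mk [] A [] (𝒟.mem_Iw_nil A) (𝒟.mem_Iw_nil A)
  | .s a A hA => InvSgp.mk [a] A [] (𝒟.mem_Iw_singleton hA) (𝒟.mem_Iw_nil A)
  | .sStar a A hA => InvSgp.mk [] A [a] (𝒟.mem_Iw_nil A) (𝒟.mem_Iw_singleton hA)

theorem Gen.toInvSgp_adjoint (x : 𝒟.Gen) : x.adjoint.toInvSgp = x.toInvSgp⁻¹ := by
  cases x <;> exact (InvSgp.inv_mk _ _).symm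

theorem Gen.toInvSgp_s_mul_sStar {a : L} {A : B} (hA : A ∈ 𝒟.I a) :
    (Gen.s a A hA).toInvSgp * (Gen.sStar a A hA).toInvSgp =
      (𝒟.idem [a] A (𝒟.mem_Iw_singleton hA)).1 :=
  (InvSgp.mk_mul_same _ _ _ _).trans (InvSgp.mk_congr rfl (inf_idem A) rfl)

section Generation

variable {P : 𝒟.InvSgp → Prop}

theorem InvSgp.forall_mk_nil_of_gen (gen : ∀ x : 𝒟.Gen, P x.toInvSgp)
    (mul : ∀ x y, P x → P y → P (x * y)) {α : List L} {A : B} (hA : A ∈ 𝒟.Iw α) :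
    P (InvSgp.mk α A [] hA (𝒟.mem_Iw_nil A)) := by
  induction α with
  | nil => exact gen (.p A)
  | cons a α ih =>
    have hA' : A ∈ 𝒟.Iw α := mem_Iw_of_mem_append (α := [a]) hA
    obtain ⟨C, hC, hAC⟩ := id hA
    have hmul : (Gen.s a C hC).toInvSgp * InvSgp.mk α A [] hA' (𝒟.mem_Iw_nil A) =
        InvSgp.mk (a :: α) A [] hA (𝒟.mem_Iw_nil A) :=
      (InvSgp.mk_mul_left (β := []) _ _ _ _).trans (InvSgp.mk_congr rfl (inf_eq_right.2 hAC) rfl)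
    exact hmul ▸ mul _ _ (gen _) (ih hA')

theorem InvSgp.induction_on_gen (zero : P 0) (gen : ∀ x : 𝒟.Gen, P x.toInvSgp)
    (mul : ∀ x y, P x → P y → P (x * y)) (x : 𝒟.InvSgp) : P x := by
  obtain rfl | ⟨α, A, β, hα, hβ, rfl⟩ := InvSgp.exists_mk x
  · exact zero
  have hinv : P (InvSgp.mk β A [] hβ (𝒟.mem_Iw_nil A))⁻¹ := by
    refine InvSgp.forall_mk_nil_of_gen (P := fun x => P x⁻¹) (fun x => ?_) (fun x y hx hy => ?_) hβ
    · exact x.toInvSgp_adjoint ▸ gen x.adjoint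
    · exact InverseSemigroupWithZero.mul_inv_rev' x y ▸ mul _ _ hy hx
  have hmul := mul _ _ (InvSgp.forall_mk_nil_of_gen gen mul hα) hinv
  rwa [InvSgp.inv_mk, InvSgp.mk_mul_same, InvSgp.mk_congr rfl (inf_idem A) rfl] at hmul

end Generation

namespace LeavittAlgebra

variable {R : Type*} [CommRing R]

theorem rep_toInvSgp (x : 𝒟.Gen) : rep R x.toInvSgp = mk 𝒟 R (ι R x) := by
  have hs {a : L} {A : B} (hA : A ∈ 𝒟.I a) : rep R (Gen.s a A hA).toInvSgp = 𝒟.s R a A hA := by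
    rw [Gen.toInvSgp, rep_mk, sw_singleton hA, sw, star_p, s_mul_p]
    exact s_congr (inf_idem A) _
  cases x with
  | p A =>
    rw [Gen.toInvSgp, rep_mk, sw, star_p, p_mul_p, inf_idem]
    rfl
  | s a A hA => exact hs hA
  | sStar a A hA =>
    rw [← Gen.adjoint_adjoint (.sStar a A hA), Gen.toInvSgp_adjoint, rep_inv, ← star_mk_ι]
    exact congrArg star (hs hA)

theorem isCuntzKrieger_rep : IsCuntzKrieger (rep (𝒟 := 𝒟) R) where
  map_mul := rep_mul
  map_zero := rep_zero
  map_sup A C := by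
    have h (A : B) : rep R (𝒟.rootIdem A).1 = 𝒟.p R A := rep_toInvSgp (.p A)
    simp only [h, p_sup]
  map_reg A hA := by
    refine (rep_toInvSgp (.p A)).trans ((p_reg hA).trans (Finset.sum_congr rfl fun a _ => ?_))
    rw [← Gen.toInvSgp_s_mul_sStar, rep_mul, rep_toInvSgp, rep_toInvSgp]
    rfl

end LeavittAlgebra

namespace IsCuntzKrieger

variable {X Y : Type*} [NonUnitalRing X] [NonUnitalRing Y] {t t' : 𝒟.InvSgp → X}

theorem comp (ht : IsCuntzKrieger t) {F : Type*} [FunLike F X Y] [NonUnitalRingHomClass F X Y]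
    (f : F) : IsCuntzKrieger fun x => f (t x) where
  map_mul x y := by rw [ht.map_mul, _root_.map_mul]
  map_zero := by rw [ht.map_zero, _root_.map_zero]
  map_sup A C := by rw [ht.map_sup, map_sub, map_add]
  map_reg A hA := by rw [ht.map_reg A hA, map_sum]

theorem eq_of_forall_gen (ht : IsCuntzKrieger t) (ht' : IsCuntzKrieger t')
    (h : ∀ x : 𝒟.Gen, t x.toInvSgp = t' x.toInvSgp) : t = t' := by
  funext x
  induction x using InvSgp.induction_on_gen with
  | zero => rw [ht.map_zero, ht'.map_zero]
  | gen x => exact h x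
  | mul x y hx hy => rw [ht.map_mul, ht'.map_mul, hx, hy]

variable (ht : IsCuntzKrieger t)
  {R : Type*} [CommRing R] [Module R X] [IsScalarTower R X X] [SMulCommClass R X X]
include ht

theorem freeLift_eq_of_rel (x y : 𝒟.FreeAlg R) (h : 𝒟.Rel R x y) :
    LeavittAlgebra.freeLift R (fun x => t x.toInvSgp) x =
      LeavittAlgebra.freeLift R (fun x => t x.toInvSgp) y := by
  cases h <;> simp only [LeavittAlgebra.freeLift_ι, _root_.map_mul, _root_.map_zero, map_add,
    map_sub, map_sum, ← ht.map_mul, Gen.toInvSgp_s_mul_sStar]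
  case p_bot => exact ht.map_rootIdem_bot
  case p_inf A C => exact congrArg t (InvSgp.mk_mul_same _ _ _ _).symm
  case p_sup A C => exact ht.map_sup A C
  case p_s A a C hC =>
    refine congrArg t ((InvSgp.mk_mul_left (β := []) _ _ _ _).trans ?_)
    exact (InvSgp.mk_congr rfl (inf_comm _ _) rfl).trans (InvSgp.mk_mul_same _ _ _ _).symm
  case sStar_p A a C hC =>
    refine congrArg t ((InvSgp.mk_mul_right (γ := []) _ _ _ _).trans ?_)
    exact (InvSgp.mk_congr rfl (inf_comm _ _) rfl).trans (InvSgp.mk_mul_same _ _ _ _).symm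
  case sStar_s_same a C C' hC hC' => exact congrArg t (InvSgp.mk_mul_same _ _ _ _)
  case sStar_s_ne a b hab C C' hC hC' =>
    refine (congrArg t (InvSgp.mk_mul_none _ _ _ _ ?_ ?_)).trans ht.map_zero <;>
      rw [List.cons_prefix_cons]
    exacts [fun h => hab h.1, fun h => hab h.1.symm]
  case s_p a C hC A => exact congrArg t (InvSgp.mk_mul_same _ _ _ _)
  case p_sStar a C hC A =>
    exact congrArg t ((InvSgp.mk_mul_same _ _ _ _).trans (InvSgp.mk_congr rfl (inf_comm _ _) rfl))
  case p_reg A hA => exact ht.map_reg A hA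

end IsCuntzKrieger

end GenBoolDynSystem

/-! ### The isomorphism -/

section charFn

open InverseSemigroupWithZero StrongGrading

variable {S R : Type*} [InverseSemigroupWithZero S] [CommRing R]

open Classical in
theorem charFn_eq_add_sub_of_covers {x y z : Idem S} (hx : x ≤ z) (hy : y ≤ z)
    (h : Covers {x, y} z) : charFn R z = charFn R x + charFn R y - charFn R (x ⊓ y) := by
  funext ξ
  have hz : z ∈ ξ.carrier ↔ x ∈ ξ.carrier ∨ y ∈ ξ.carrier := by
    refine ⟨fun hz => ?_, fun h => h.elim (ξ.mem_of_le · hx) (ξ.mem_of_le · hy)⟩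
    obtain ⟨w, hw, hwξ⟩ := TightFilter.exists_mem_of_covers hz h
    rw [Finset.mem_insert, Finset.mem_singleton] at hw
    rcases hw with rfl | rfl
    exacts [Or.inl hwξ, Or.inr hwξ]
  by_cases hxξ : x ∈ ξ.carrier <;> by_cases hyξ : y ∈ ξ.carrier <;>
    simp [charFn, TightFilter.V, Set.indicator, TightFilter.inf_mem_iff, hz, hxξ, hyξ]

open Classical in
theorem charFn_eq_sum_of_covers {ι : Type*} {F : Finset ι} {x : ι → Idem S} {z : Idem S}
    (hle : ∀ i ∈ F, x i ≤ z) (hdisj : ∀ i ∈ F, ∀ j ∈ F, x i ⊓ x j ≠ ⊥ → i = j)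
    (h : Covers (F.image x) z) : charFn R z = ∑ i ∈ F, charFn R (x i) := by
  funext ξ
  rw [Finset.sum_apply]
  by_cases hz : z ∈ ξ.carrier
  · obtain ⟨w, hw, hwξ⟩ := TightFilter.exists_mem_of_covers hz h
    obtain ⟨i, hi, rfl⟩ := Finset.mem_image.1 hw
    rw [charFn_of_mem hz, Finset.sum_eq_single_of_mem i hi, charFn_of_mem hwξ]
    refine fun j hj hji => charFn_of_notMem fun hjξ => hji (hdisj j hj i hi fun hbot => ?_)
    exact ξ.bot_notMem (hbot ▸ ξ.inf_mem hjξ hwξ)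
  · rw [charFn_of_notMem hz, Finset.sum_eq_zero]
    exact fun i hi => charFn_of_notMem fun hiξ => hz (ξ.mem_of_le hiξ (hle i hi))

end charFn

namespace StrongGrading

open InverseSemigroupWithZero

variable {S G : Type*} [InverseSemigroupWithZero S] [Group G] (φ : StrongGrading S G)
  (R : Type*) [CommRing R]

theorem mem_E_one (x : Idem S) : x ∈ φ.E 1 := by
  by_cases h : x = ⊥
  · exact Or.inl h
  · exact Or.inr ⟨x.1, Idem.ne_bot_iff.1 h, φ.map_idem x.2 (Idem.ne_bot_iff.1 h), ran_idem x⟩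

theorem monomial_idem (x : Idem S) :
    φ.monomial R x.1 = φ.delta R 1 ⟨charFn R x, φ.indicator_mem R (φ.mem_E_one x)⟩ :=
  (φ.idemDelta_eq_monomial R (φ.mem_E_one x) (ran_idem x) (φ.map_idem x.2)).symm

open Classical in
theorem monomial_eq_add_sub_of_covers {x y z : Idem S} (hx : x ≤ z) (hy : y ≤ z)
    (h : Covers {x, y} z) :
    φ.monomial R z.1 = φ.monomial R x.1 + φ.monomial R y.1 - φ.monomial R (x ⊓ y).1 := by
  simp only [monomial_idem, ← map_add, ← map_sub]
  exact congrArg _ (Subtype.ext (charFn_eq_add_sub_of_covers hx hy h))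

open Classical in
theorem monomial_eq_sum_of_covers {ι : Type*} {F : Finset ι} {x : ι → Idem S} {z : Idem S}
    (hle : ∀ i ∈ F, x i ≤ z) (hdisj : ∀ i ∈ F, ∀ j ∈ F, x i ⊓ x j ≠ ⊥ → i = j)
    (h : Covers (F.image x) z) : φ.monomial R z.1 = ∑ i ∈ F, φ.monomial R (x i).1 := by
  simp only [monomial_idem, ← map_sum]
  refine congrArg _ (Subtype.ext ((charFn_eq_sum_of_covers hle hdisj h).trans ?_))
  rw [Submodule.coe_sum]

end StrongGrading

namespace GenBoolDynSystem

open InverseSemigroupWithZero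

variable {B L : Type*} [GeneralizedBooleanAlgebra B] {𝒟 : GenBoolDynSystem B L}

theorem θw_sup (α : List L) (A C : B) : 𝒟.θw α (A ⊔ C) = 𝒟.θw α A ⊔ 𝒟.θw α C := by
  induction α generalizing A C with
  | nil => rfl
  | cons a α ih => simp only [θw, 𝒟.map_sup, ih]

open Classical in
theorem covers_rootIdem_sup (A C : B) :
    Covers {𝒟.rootIdem A, 𝒟.rootIdem C} (𝒟.rootIdem (A ⊔ C)) := by
  intro y hy hy0
  obtain ⟨α, D, hD, rfl⟩ := exists_eq_idem y
  by_contra! h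
  have hinf {A' : B} (hA' : 𝒟.rootIdem A' ⊓ 𝒟.idem α D hD = ⊥) : D ⊓ 𝒟.θw α A' = ⊥ := by
    rwa [inf_comm, idem_inf_rootIdem, idem_eq_bot_iff] at hA'
  rw [← inf_eq_left.2 hy, idem_inf_rootIdem, Ne, idem_eq_bot_iff, θw_sup, inf_sup_left,
    hinf (h _ (Finset.mem_insert_self _ _)), bot_sup_eq] at hy0
  exact hy0 (hinf (h _ (Finset.mem_insert_of_mem (Finset.mem_singleton_self _))))

theorem branchIdem_inf_idem_cons {a : L} {α : List L} {A C : B} (hC : C ∈ 𝒟.Iw (a :: α)) :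
    𝒟.branchIdem a A ⊓ 𝒟.idem (a :: α) C hC = 𝒟.idem (a :: α) C hC ⊓ 𝒟.rootIdem A := by
  rw [inf_comm, idem_inf_rootIdem]
  exact Idem.ext (InvSgp.mk_mul_right (γ := [a]) _ _ _ _)

theorem branchIdem_inf_rootIdem (a : L) (A C : B) :
    𝒟.branchIdem a A ⊓ 𝒟.rootIdem C = 𝒟.branchIdem a (A ⊓ C) := by
  rw [idem_inf_rootIdem]
  exact idem_congr (𝒟.map_inf a A C).symm _

open Classical in
theorem covers_rootIdem_of_mem_reg {A : B} (hA : A ∈ 𝒟.Reg) :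
    Covers ((𝒟.Δ_finite_of_reg hA).toFinset.image fun a => 𝒟.branchIdem a A)
      (𝒟.rootIdem A) := by
  intro y hy hy0
  suffices hbranch : ∃ a, 𝒟.branchIdem a A ⊓ y ≠ ⊥ by
    obtain ⟨a, ha⟩ := hbranch
    refine ⟨_, Finset.mem_image_of_mem _ ((Set.Finite.mem_toFinset _).2 fun h => ha ?_), ha⟩
    rw [branchIdem, idem_eq_bot_iff.2 h, bot_inf_eq]
  obtain ⟨α, D, hD, rfl⟩ := exists_eq_idem y
  rw [← inf_eq_left.2 hy] at hy0
  cases α with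
  | nil =>
    rw [rootIdem_inf, Ne, idem_eq_bot_iff] at hy0
    obtain ⟨a, ha⟩ := (hA (D ⊓ A) inf_le_right hy0).1
    refine ⟨a, ?_⟩
    rwa [branchIdem_inf_rootIdem, inf_comm, Ne, idem_eq_bot_iff]
  | cons a α => exact ⟨a, branchIdem_inf_idem_cons hD ▸ hy0⟩

variable {R : Type*} [CommRing R]

theorem isCuntzKrieger_monomial : IsCuntzKrieger (𝒟.grading.monomial R) where
  map_mul x y := (𝒟.grading.monomial_mul R x y).symm
  map_zero := 𝒟.grading.monomial_zero R
  map_sup A C := by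
    rw [← rootIdem_inf]
    exact 𝒟.grading.monomial_eq_add_sub_of_covers R (rootIdem_mono le_sup_left)
      (rootIdem_mono le_sup_right) (covers_rootIdem_sup A C)
  map_reg A hA :=
    𝒟.grading.monomial_eq_sum_of_covers R (fun a _ => branchIdem_le a A)
      (fun _ _ _ _ => eq_of_idem_cons_inf_ne_bot) (covers_rootIdem_of_mem_reg hA)

theorem monomial_mk {α β : List L} {A : B} (hα : A ∈ 𝒟.Iw α) (hβ : A ∈ 𝒟.Iw β) {g : FreeGroup L}
    (hg : word α * (word β)⁻¹ = g) (h : 𝒟.idem α A hα ∈ 𝒟.grading.E g) :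
    𝒟.grading.monomial R (InvSgp.mk α A β hα hβ) = 𝒟.grading.idemDelta R g (𝒟.idem α A hα) h :=
  (𝒟.grading.idemDelta_eq_monomial R h (ran_mk hα hβ) fun h0 => (𝒟.degree_mk h0).trans hg).symm

namespace LeavittAlgebra

variable (𝒟 R) in
/-- The homomorphism to the partial skew group ring that sends each generator to its monomial. -/
noncomputable def toSkewRing : 𝒟.LeavittAlgebra R →ₙₐ[R] 𝒟.grading.SkewRing R :=
  lift (fun x => 𝒟.grading.monomial R x.toInvSgp) isCuntzKrieger_monomial.freeLift_eq_of_rel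

theorem toSkewRing_mk_ι (x : 𝒟.Gen) :
    toSkewRing 𝒟 R (mk 𝒟 R (ι R x)) = 𝒟.grading.monomial R x.toInvSgp := lift_mk_ι _ _ x

theorem toSkewRing_rep (x : 𝒟.InvSgp) :
    toSkewRing 𝒟 R (rep R x) = 𝒟.grading.monomial R x :=
  congrFun ((isCuntzKrieger_rep.comp (toSkewRing 𝒟 R)).eq_of_forall_gen isCuntzKrieger_monomial
    fun x => by rw [rep_toInvSgp, toSkewRing_mk_ι]) x

theorem toSkewRing_surjective : Function.Surjective (toSkewRing 𝒟 R) := by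
  intro y
  induction y using 𝒟.grading.monomial_induction with
  | monomial s => exact ⟨rep R s, toSkewRing_rep s⟩
  | zero => exact ⟨0, map_zero _⟩
  | add y z hy hz =>
    obtain ⟨y, rfl⟩ := hy
    obtain ⟨z, rfl⟩ := hz
    exact ⟨y + z, map_add _ y z⟩
  | smul r y hy =>
    obtain ⟨y, rfl⟩ := hy
    exact ⟨r • y, map_smul _ r y⟩

theorem toSkewRing_injective : Function.Injective (toSkewRing 𝒟 R) := by
  let inr := Unitization.inrNonUnitalAlgHom R (𝒟.LeavittAlgebra R)
  have hck : IsCuntzKrieger fun x : 𝒟.InvSgp => inr (rep R x) := isCuntzKrieger_rep.comp inr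
  obtain ⟨Ψ, hΨ⟩ :=
    𝒟.grading.exists_nonUnitalAlgHom_monomial (R := R) hck.map_mul hck.isTight
  have hcomp : Ψ.comp (toSkewRing 𝒟 R) = inr := hom_ext fun x => by
    rw [NonUnitalAlgHom.comp_apply, toSkewRing_mk_ι, hΨ, rep_toInvSgp]
  have hinj : Function.Injective (Ψ.comp (toSkewRing 𝒟 R)) :=
    hcomp ▸ Unitization.inr_injective
  exact Function.Injective.of_comp hinj

theorem toSkewRing_p (A : B) : toSkewRing 𝒟 R (𝒟.p R A) =
    𝒟.grading.idemDelta R 1 (𝒟.idem [] A trivial) (𝒟.mem_E_one A) :=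
  (toSkewRing_mk_ι (.p A)).trans (monomial_mk _ _ (mul_inv_cancel _) _)

theorem toSkewRing_s {a : L} {A : B} (hA : A ∈ 𝒟.I a) : toSkewRing 𝒟 R (𝒟.s R a A hA) =
    𝒟.grading.idemDelta R (FreeGroup.of a)
      (𝒟.idem [a] A (𝒟.mem_Iw_singleton hA)) (𝒟.mem_E_of hA) :=
  (toSkewRing_mk_ι (.s a A hA)).trans (monomial_mk _ _ (by simp [word]) _)

theorem toSkewRing_sStar {a : L} {A : B} (hA : A ∈ 𝒟.I a) : toSkewRing 𝒟 R (𝒟.sStar R a A hA) =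
    𝒟.grading.idemDelta R (FreeGroup.of a)⁻¹ (𝒟.idem [] A trivial) (𝒟.mem_E_of_inv hA) :=
  (toSkewRing_mk_ι (.sStar a A hA)).trans (monomial_mk _ _ (by simp [word]) _)

end LeavittAlgebra

end GenBoolDynSystem

theorem mainTheorem4 {B L : Type*} [GeneralizedBooleanAlgebra B] (𝒟 : GenBoolDynSystem B L)
    (R : Type*) [CommRing R] :
    ∃ Φ : 𝒟.LeavittAlgebra R →ₙₐ[R] 𝒟.grading.SkewRing R,
      Function.Bijective Φ ∧
      (∀ A : B, Φ (𝒟.p R A) =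
        𝒟.grading.idemDelta R 1 (𝒟.idem [] A trivial) (𝒟.mem_E_one A)) ∧
      (∀ (a : L) (A : B) (hA : A ∈ 𝒟.I a), Φ (𝒟.s R a A hA) =
        𝒟.grading.idemDelta R (FreeGroup.of a)
          (𝒟.idem [a] A (𝒟.mem_Iw_singleton hA)) (𝒟.mem_E_of hA)) ∧
      (∀ (a : L) (A : B) (hA : A ∈ 𝒟.I a), Φ (𝒟.sStar R a A hA) =
        𝒟.grading.idemDelta R (FreeGroup.of a)⁻¹
          (𝒟.idem [] A trivial) (𝒟.mem_E_of_inv hA)) :=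
  open GenBoolDynSystem.LeavittAlgebra in
  ⟨toSkewRing 𝒟 R, ⟨toSkewRing_injective, toSkewRing_surjective⟩, toSkewRing_p,
    fun _ _ => toSkewRing_s, fun _ _ => toSkewRing_sStar⟩
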